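/- **Setting.** Let $\mathcal U,\mathcal X,\mathcal A,\mathcal Z,\mathcal W$ be standard Borel spaces. A trial consists of a confounder $U$, context $X$, treatment $A$, real reward $Y$, proxies $Z,W$, missingness indicators $R_X,R_Z,R_W\in\{0,1\}$ ($1$ = observed) and a pseudo treatment $A'$. Observationally, $$p_{\rm ob}(u,x,z,w,a,y)=p(x)\,p(u,z,w\mid x)\,\pi_{\rm ob}(a\mid u,x,z)\,p(y\mid u,x,w,a);$$ given these variables, $R_X,R_Z,R_W$ are drawn independently, with laws depending only on $X$, on $(Z,U,A,X)$ and on $(W,X,A)$ respectively; $A'\sim u$ is independent of everything ($u$ is a fixed probability measure on $\mathcal A$, e.g. the uniform one). In the interventional process with policy $\pi(a\mid x)$ the law is $\tilde p(x)p(u,z,w\mid x)\pi(a\mid x)p(y\mid u,x,w,a)$; $v^\pi$ is the mean of $Y$ under it, $g^*(x,a)=\mathbb E[Y\mid X=x,\mathrm{do}(A=a)]=\int\!\int y\,p(dy\mid u,x,w,a)\,p(du,dz,dw\mid x)$, and $v(g,\pi)=\int g(x,a)\,\tilde p(dx)\pi(da\mid x)$. For a class $\Pi$ of policies let $\pi^*\in\Pi$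 maximize $v^\pi$ and $\mathrm{SubOpt}(\pi)=v^{\pi^*}-v^\pi$. Let $\mu_1,\mu_2,\mu_3,\mu_4$ be the law of a trial given $(R_X,R_Z)=\mathbf 1$, $(R_W,R_X,R_Z)=\mathbf 1$, $(R_W,R_X)=\mathbf 1$, $R_X=1$, and let $Z_1=(A,X,Z)$, $Z_2=(A,W,X,Z)$, $Z_3=(A,W,X,A')$, $Z_4=(X,A')$. For $h=(h_1,h_2,h_3,g)$ put $$\alpha_1=h_1(Y,A,X,Z)-Y,\quad \alpha_2=h_2(A,W,X)-h_1(Y,A,X,Z),$$ $$\alpha_3=h_3(Y,A,X,A')-h_2(A',W,X),\quad \alpha_4=g(X,A')-h_3(Y,A,X,A'),$$ and $\mathcal T_kh=\mathbb E_{\mu_k}[\alpha_k\mid Z_k]$. The data are $T$ i.i.d. trials; $\mathcal D_k$ is the sub-sample satisfying the conditioning event of $\mu_k$, $T_k=|\mathcal D_k|$, and $\mathbb E_{\mathcal D_k}$, $\|\cdot\|_{\mathcal D_k,2}$ are the empirical mean and $L^2$ norm. For classes $\mathcal H$ of vectors $h$ and $\Theta_k$ of functions of $Z_k$ (measurable functions,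 with a countable subclass dense for sequential pointwise convergence), the latter star-shaped about $0$, let $$\mathcal L_{\mathcal D}(h)=\sum_{k=1}^4\sup_{\theta\in\Theta_k}\Big\{\mathbb E_{\mathcal D_k}[\alpha_k\theta]-\tfrac12\|\theta\|_{\mathcal D_k,2}^2\Big\},\qquad \mathrm{CI}_{\mathcal D}(e)=\{g: h=(h_1,h_2,h_3,g)\in\mathcal H,\ \mathcal L_{\mathcal D}(h)\le\inf_{\mathcal H}\mathcal L_{\mathcal D}+e\}.$$ A CAP policy $\hat\pi$ is a maximizer of $\inf_{g\in \mathrm{CI}_{\mathcal D}(e)}v(g,\pi)$ over $\pi\in\Pi$. **Assumptions.** 1. (Model) $W\perp A\mid(U,X)$, $Z\perp(Y,W)\mid(A,X,U)$, and PV completeness: for every $\sigma$ with $\sigma(U,X,A)$ integrable given $R_Z=1$, $\mathbb E_{\rm ob}[\sigma(U,X,A)\mid X,A,Z,R_Z=1]=0$ a.s. iff $\sigma(U,X,A)=0$ a.s. There is an exact solution $h^*$ of $\mathcal T_kh^*=0$, $k=1,\dots,4$. 2. (Realizability) Some $h^*_{\mathcal H}\in\mathcal H$, with last entry $g^*_{\mathcal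 H}$, satisfies $\big(\sum_k\|\mathcal T_kh^*_{\mathcal H}\|^2_{\mu_k,2}\big)^{1/2}\le\varepsilon_{\mathcal H}$ and $\sup_{\pi\in\Pi}\|g^*_{\mathcal H}-g^*\|_{\tilde p\pi,2}\le\varepsilon_{\mathcal H}$. 3. (Compatibility) $\inf_{\theta\in\Theta_k}\|\theta-\mathcal T_kh\|_{\mu_k,2}\le\varepsilon_\Theta$ for all $h\in\mathcal H$ and all $k$. 4. (Regularity) $|Y|\le L_Y$; all components of $h\in\mathcal H$ are bounded by $L_h$, all $\theta\in\Theta_k$ by $L_\theta$, and $|\alpha_k|\le L_\alpha$ for $h\in\mathcal H$, $|Y|\le L_Y$. 5. (Shift functions) There is a measurable $b_1(x,a,z)$, $b_1(X,A,Z)$ integrable under $\mu_1$, with $$\mathbb E_{\rm ob}[b_1(X,A,Z)\mid X=x,U=u,A=a,(R_X,R_Z)=\mathbf 1]=\frac{p_{\rm ob}(u\mid x)\,\tilde p(x)\,\pi^*(a\mid x)}{p_{\rm ob}(u,x,a\mid (R_X,R_Z)=\mathbf 1)},$$ and the density ratios here and in $$b_2=b_1(x,a,z)\frac{p_{\rm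 ob}(a,w,x\mid (R_X,R_Z)=\mathbf 1)}{p_{\rm ob}(a,w,x\mid (R_W,R_X,R_Z)=\mathbf 1)},\quad b_3=\frac{\tilde p(x)\pi^*(a'\mid x)\,p_{\rm ob}(a,w\mid x,R_X=1)}{u(a')\,p_{\rm ob}(x,a,w\mid (R_W,R_X)=\mathbf 1)},\quad b_4=\frac{\tilde p(x)\pi^*(a'\mid x)}{p_{\rm ob}(x\mid R_X=1)\,u(a')}$$ exist, i.e. each numerator is absolutely continuous with respect to its denominator. **Critical radii.** For a class $F$ of functions bounded by $c$, a critical radius of $F$ on $\mathcal D_k$ is any $r>0$ with $\mathbb E_\varepsilon\sup_{f\in F,\|f\|_{\mathcal D_k,2}\le r}T_k^{-1}\sum_{t\in\mathcal D_k}\varepsilon_tf(x_t)\le r^2/c$, $\varepsilon_t$ independent uniform signs. Say that $\eta_k$ *bounds the critical radius of $F$ with respect to $\xi\in(0,1)$* if $T_k>0$ and $\eta_k\ge c_0\big(r+c\sqrt{\log(c_1/\xi)/T_k}\big)$ for some critical radius $r$ of $F$ on $\mathcal D_k$. Let $\mathcal Q_k=\{\alpha_k\theta:h\in\mathcal H,\theta\in\Theta_k\}$,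 for which we take $c=\max(1,L_\alpha L_\theta)$; for $\Theta_k$ we take $c=\max(1,L_\theta)$. **Theorem.** There are universal constants $c_0>0,c_1\ge1$, and for each $L_\alpha$ a constant $C$ depending only on $L_\alpha$, such that under the assumptions above, for every $\xi\in(0,1)$, the following holds on an event of probability at least $1-8\xi$. Whenever $\eta_k$ bounds the critical radii of $\mathcal Q_k$ and of $\Theta_k$ with respect to $\xi$ for $k=1,\dots,4$, $\eta^2=\sum_k\eta_k^2$, and $e_{\mathcal D}>2\varepsilon_{\mathcal H}^2+(2L_\alpha^2+5/4)\eta^2$, every CAP policy $\hat\pi$ with threshold $e_{\mathcal D}$ satisfies $$\mathrm{SubOpt}(\hat\pi)\le C\,\sum_{k=1}^4\|b_k\|_{\mu_k,2}\,\big(\varepsilon_\Theta+\varepsilon_{\mathcal H}+\sqrt{e_{\mathcal D}}+\eta\big).$$ -/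

import Mathlib

open MeasureTheory ProbabilityTheory Filter Topology

noncomputable section

namespace CCB

/-- The primitives of a confounded contextual bandit with proxy variables and missing data, as
(conditional) distributions. The confounder is `U`, the context `X`, the treatment `A`, the reward
`Y` (real), the treatment proxy `Z`, the outcome proxy `W`.
The observational joint law is
`p(x) p(u,z,w | x) π_ob(a | u,x,z) p(y | u,x,w,a)`, and the three missingness indicators are drawn
independently given all these variables, `R_X` from `X`, `R_Z` from `(Z,U,A,X)` and `R_W` from
`(W,X,A)`. -/
structure PVModel (𝒰 𝒳 𝒜 𝒵 𝒲 : Type*) [MeasurableSpace 𝒰] [MeasurableSpace 𝒳]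
    [MeasurableSpace 𝒜] [MeasurableSpace 𝒵] [MeasurableSpace 𝒲] where
  /-- marginal law of the context in the observational process -/
  pX : Measure 𝒳
  /-- `p(u, z, w | x)` -/
  κ : Kernel 𝒳 (𝒰 × 𝒵 × 𝒲)
  /-- the observational policy `π_ob(a | u, x, z)` -/
  πob : Kernel (𝒰 × 𝒳 × 𝒵) 𝒜
  /-- the reward mechanism `p(y | u, x, w, a)` -/
  ρ : Kernel (𝒰 × 𝒳 × 𝒲 × 𝒜) ℝ
  /-- the law of `R_X` given its cause `X` (`true` means observed) -/
  mX : Kernel 𝒳 Bool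
  /-- the law of `R_Z` given its causes `(Z, U, A, X)` -/
  mZ : Kernel (𝒵 × 𝒰 × 𝒜 × 𝒳) Bool
  /-- the law of `R_W` given its causes `(W, X, A)` -/
  mW : Kernel (𝒲 × 𝒳 × 𝒜) Bool
  /-- the law `u(a')` of the pseudo random variable `A'`; the uniform law on the treatment space
  is the case of interest, but any fixed probability measure is allowed -/
  pseudo : Measure 𝒜
  /-- marginal law `p̃` of the context in the interventional process -/
  ptilde : Measure 𝒳
  [pX_prob : IsProbabilityMeasure pX]
  [κ_markov : IsMarkovKernel κ]
  [πob_markov : IsMarkovKernel πob]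
  [ρ_markov : IsMarkovKernel ρ]
  [mX_markov : IsMarkovKernel mX]
  [mZ_markov : IsMarkovKernel mZ]
  [mW_markov : IsMarkovKernel mW]
  [pseudo_prob : IsProbabilityMeasure pseudo]
  [ptilde_prob : IsProbabilityMeasure ptilde]

attribute [instance] PVModel.pX_prob PVModel.κ_markov PVModel.πob_markov PVModel.ρ_markov
  PVModel.mX_markov PVModel.mZ_markov PVModel.mW_markov PVModel.pseudo_prob PVModel.ptilde_prob

/-- Values of `(X, (U, Z, W), A, Y)`. -/
abbrev Core (𝒰 𝒳 𝒜 𝒵 𝒲 : Type*) := ((𝒳 × 𝒰 × 𝒵 × 𝒲) × 𝒜) × ℝ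

/-- Values of one full trial `((X, (U, Z, W), A, Y), (R_X, R_Z, R_W), A')`. -/
abbrev Trial (𝒰 𝒳 𝒜 𝒵 𝒲 : Type*) := (Core 𝒰 𝒳 𝒜 𝒵 𝒲 × Bool × Bool × Bool) × 𝒜

section Projections

variable {𝒰 𝒳 𝒜 𝒵 𝒲 : Type*}

/-- context -/
def vX (o : Trial 𝒰 𝒳 𝒜 𝒵 𝒲) : 𝒳 := o.1.1.1.1.1
/-- confounder -/
def vU (o : Trial 𝒰 𝒳 𝒜 𝒵 𝒲) : 𝒰 := o.1.1.1.1.2.1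
/-- treatment proxy -/
def vZ (o : Trial 𝒰 𝒳 𝒜 𝒵 𝒲) : 𝒵 := o.1.1.1.1.2.2.1
/-- outcome proxy -/
def vW (o : Trial 𝒰 𝒳 𝒜 𝒵 𝒲) : 𝒲 := o.1.1.1.1.2.2.2
/-- treatment -/
def vA (o : Trial 𝒰 𝒳 𝒜 𝒵 𝒲) : 𝒜 := o.1.1.1.2
/-- reward -/
def vY (o : Trial 𝒰 𝒳 𝒜 𝒵 𝒲) : ℝ := o.1.1.2
/-- missingness indicator of the context -/
def vRX (o : Trial 𝒰 𝒳 𝒜 𝒵 𝒲) : Bool := o.1.2.1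
/-- missingness indicator of the treatment proxy -/
def vRZ (o : Trial 𝒰 𝒳 𝒜 𝒵 𝒲) : Bool := o.1.2.2.1
/-- missingness indicator of the outcome proxy -/
def vRW (o : Trial 𝒰 𝒳 𝒜 𝒵 𝒲) : Bool := o.1.2.2.2
/-- pseudo random treatment `A'` -/
def vA' (o : Trial 𝒰 𝒳 𝒜 𝒵 𝒲) : 𝒜 := o.2

/-- The missingness condition of the `k`-th equation (equations are numbered from `0`):
`(R_X,R_Z)=1`, `(R_W,R_X,R_Z)=1`, `(R_W,R_X)=1`, `R_X=1`. -/
def mask : Fin 4 → Set (Trial 𝒰 𝒳 𝒜 𝒵 𝒲) :=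
  ![{o | vRX o = true ∧ vRZ o = true},
    {o | vRW o = true ∧ vRX o = true ∧ vRZ o = true},
    {o | vRW o = true ∧ vRX o = true},
    {o | vRX o = true}]

/-- conditioning variables `(A, X, Z)` of the first equation -/
def inst0 (o : Trial 𝒰 𝒳 𝒜 𝒵 𝒲) : 𝒜 × 𝒳 × 𝒵 := (vA o, vX o, vZ o)
/-- conditioning variables `(A, W, X, Z)` of the second equation -/
def inst1 (o : Trial 𝒰 𝒳 𝒜 𝒵 𝒲) : 𝒜 × 𝒲 × 𝒳 × 𝒵 := (vA o, vW o, vX o, vZ o)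
/-- conditioning variables `(A, W, X, A')` of the third equation -/
def inst2 (o : Trial 𝒰 𝒳 𝒜 𝒵 𝒲) : 𝒜 × 𝒲 × 𝒳 × 𝒜 := (vA o, vW o, vX o, vA' o)
/-- conditioning variables `(X, A')` of the fourth equation -/
def inst3 (o : Trial 𝒰 𝒳 𝒜 𝒵 𝒲) : 𝒳 × 𝒜 := (vX o, vA' o)

end Projections

/-- A vector `h = (h₁, h₂, h₃, g)` of candidate bridge functions
`h₁(y,a,x,z)`, `h₂(a,w,x)`, `h₃(y,a,x,a')`, `g(x,a')`. -/
structure Bridge (𝒳 𝒜 𝒵 𝒲 : Type*) where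
  h1 : ℝ × 𝒜 × 𝒳 × 𝒵 → ℝ
  h2 : 𝒜 × 𝒲 × 𝒳 → ℝ
  h3 : ℝ × 𝒜 × 𝒳 × 𝒜 → ℝ
  g : 𝒳 × 𝒜 → ℝ

/-- The classes `Θ₁, …, Θ₄` of test functions of the conditioning variables. -/
structure DualClass (𝒳 𝒜 𝒵 𝒲 : Type*) where
  Θ1 : Set (𝒜 × 𝒳 × 𝒵 → ℝ)
  Θ2 : Set (𝒜 × 𝒲 × 𝒳 × 𝒵 → ℝ)
  Θ3 : Set (𝒜 × 𝒲 × 𝒳 × 𝒜 → ℝ)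
  Θ4 : Set (𝒳 × 𝒜 → ℝ)

/-- A class of functions is pointwise measurable if all its members are measurable and a countable
subclass is dense for pointwise convergence of sequences. -/
def PointwiseMeasurable {α : Type*} [MeasurableSpace α] (F : Set (α → ℝ)) : Prop :=
  (∀ f ∈ F, Measurable f) ∧
    ∃ F₀ ⊆ F, F₀.Countable ∧ ∀ f ∈ F, ∃ s : ℕ → α → ℝ,
      (∀ n, s n ∈ F₀) ∧ ∀ a, Tendsto (fun n => s n a) atTop (𝓝 (f a))

section Bridges

variable {𝒰 𝒳 𝒜 𝒵 𝒲 : Type*}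

/-- The integrand `α_k(h(X), Y_k)` of the `k`-th equation. -/
def Bridge.resid (h : Bridge 𝒳 𝒜 𝒵 𝒲) : Fin 4 → Trial 𝒰 𝒳 𝒜 𝒵 𝒲 → ℝ :=
  ![fun o => h.h1 (vY o, vA o, vX o, vZ o) - vY o,
    fun o => h.h2 (vA o, vW o, vX o) - h.h1 (vY o, vA o, vX o, vZ o),
    fun o => h.h3 (vY o, vA o, vX o, vA' o) - h.h2 (vA' o, vW o, vX o),
    fun o => h.g (vX o, vA' o) - h.h3 (vY o, vA o, vX o, vA' o)]

/-- The `k`-th test function class, seen as a class of functions of the whole trial. -/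
def DualClass.onTrial (Θ : DualClass 𝒳 𝒜 𝒵 𝒲) : Fin 4 → Set (Trial 𝒰 𝒳 𝒜 𝒵 𝒲 → ℝ) :=
  ![(fun θ => θ ∘ inst0) '' Θ.Θ1, (fun θ => θ ∘ inst1) '' Θ.Θ2,
    (fun θ => θ ∘ inst2) '' Θ.Θ3, (fun θ => θ ∘ inst3) '' Θ.Θ4]

/-- The product class `𝒬_k = {α_k(h, Y_k) θ_k : h ∈ ℋ, θ_k ∈ Θ_k}`. -/
def prodClass (ℋ : Set (Bridge 𝒳 𝒜 𝒵 𝒲)) (Θ : DualClass 𝒳 𝒜 𝒵 𝒲) (k : Fin 4) :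
    Set (Trial 𝒰 𝒳 𝒜 𝒵 𝒲 → ℝ) :=
  {q | ∃ h ∈ ℋ, ∃ θ ∈ Θ.onTrial k, q = fun o => h.resid k o * θ o}

/-- The test classes are star-shaped about `0`. -/
def DualClass.StarShaped (Θ : DualClass 𝒳 𝒜 𝒵 𝒲) : Prop :=
  StarConvex ℝ 0 Θ.Θ1 ∧ StarConvex ℝ 0 Θ.Θ2 ∧ StarConvex ℝ 0 Θ.Θ3 ∧ StarConvex ℝ 0 Θ.Θ4

variable [MeasurableSpace 𝒰] [MeasurableSpace 𝒳] [MeasurableSpace 𝒜] [MeasurableSpace 𝒵]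
  [MeasurableSpace 𝒲]

/-- The σ-algebra generated by the conditioning variables of the `k`-th equation. -/
abbrev instAlg : Fin 4 → MeasurableSpace (Trial 𝒰 𝒳 𝒜 𝒵 𝒲) :=
  ![MeasurableSpace.comap inst0 inferInstance, MeasurableSpace.comap inst1 inferInstance,
    MeasurableSpace.comap inst2 inferInstance, MeasurableSpace.comap inst3 inferInstance]

/-- All components of `h` are measurable. -/
def Bridge.Meas (h : Bridge 𝒳 𝒜 𝒵 𝒲) : Prop :=
  Measurable h.h1 ∧ Measurable h.h2 ∧ Measurable h.h3 ∧ Measurable h.g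

/-- Pointwise measurability of a class of bridge vectors. -/
def BridgeClassMeas (ℋ : Set (Bridge 𝒳 𝒜 𝒵 𝒲)) : Prop :=
  (∀ h ∈ ℋ, h.Meas) ∧
    ∃ ℋ₀ ⊆ ℋ, ℋ₀.Countable ∧ ∀ h ∈ ℋ, ∃ s : ℕ → Bridge 𝒳 𝒜 𝒵 𝒲, (∀ n, s n ∈ ℋ₀) ∧
      (∀ p, Tendsto (fun n => (s n).h1 p) atTop (𝓝 (h.h1 p))) ∧
      (∀ p, Tendsto (fun n => (s n).h2 p) atTop (𝓝 (h.h2 p))) ∧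
      (∀ p, Tendsto (fun n => (s n).h3 p) atTop (𝓝 (h.h3 p))) ∧
      (∀ p, Tendsto (fun n => (s n).g p) atTop (𝓝 (h.g p)))

/-- Pointwise measurability of the four test classes. -/
def DualClass.Meas (Θ : DualClass 𝒳 𝒜 𝒵 𝒲) : Prop :=
  PointwiseMeasurable Θ.Θ1 ∧ PointwiseMeasurable Θ.Θ2 ∧ PointwiseMeasurable Θ.Θ3 ∧
    PointwiseMeasurable Θ.Θ4

end Bridges

section Empirical

variable {ι α : Type*}

/-- Empirical mean of `f` over the sub-sample `(x i)`, `i ∈ D`. -/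
def empMean (D : Finset ι) (x : ι → α) (f : α → ℝ) : ℝ := (∑ i ∈ D, f (x i)) / (D.card : ℝ)

/-- Empirical `L²` norm over the sub-sample `(x i)`, `i ∈ D`. -/
def empNorm (D : Finset ι) (x : ι → α) (f : α → ℝ) : ℝ :=
  Real.sqrt (empMean D x (fun a => f a ^ 2))

/-- The Rademacher sign coded by a Boolean. -/
def rsign (b : Bool) : ℝ := if b then 1 else -1

/-- Localized empirical Rademacher complexity of `F` at radius `η` on the data `(x i)`, `i ∈ D`:
the mean over independent uniform signs `ε` of
`sup {|D|⁻¹ ∑_{i ∈ D} ε_i f(x_i) : f ∈ F, ‖f‖_D ≤ η}`. -/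
def localRad [Fintype ι] [DecidableEq ι] (D : Finset ι) (x : ι → α) (F : Set (α → ℝ)) (η : ℝ) : ℝ :=
  (∑ ε : ι → Bool,
      sSup ((fun f : α → ℝ => (∑ i ∈ D, rsign (ε i) * f (x i)) / (D.card : ℝ)) ''
        {f | f ∈ F ∧ empNorm D x f ≤ η})) / (Fintype.card (ι → Bool) : ℝ)

/-- `r` is a critical radius, on the given data, of the class `F` of functions bounded by `c`. -/
def IsCriticalRadius [Fintype ι] [DecidableEq ι] (D : Finset ι) (x : ι → α) (F : Set (α → ℝ))
    (c r : ℝ) : Prop :=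
  0 < r ∧ localRad D x F r ≤ r ^ 2 / c

/-- `η` dominates, up to the numerical constants `c₀` and `c₁`, a critical radius of `F` plus the
deviation term at confidence level `ξ` of functions bounded by `c`. -/
def BoundsCriticalRadius [Fintype ι] [DecidableEq ι] (c₀ c₁ ξ : ℝ) (D : Finset ι) (x : ι → α)
    (F : Set (α → ℝ)) (c η : ℝ) : Prop :=
  0 < D.card ∧ ∃ r, IsCriticalRadius D x F c r ∧
    c₀ * (r + c * Real.sqrt (Real.log (c₁ / ξ) / (D.card : ℝ))) ≤ η

end Empirical

/-- Interventional policies `π(a | x)`. -/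
abbrev Policy (𝒳 𝒜 : Type*) [MeasurableSpace 𝒳] [MeasurableSpace 𝒜] :=
  {π : Kernel 𝒳 𝒜 // IsMarkovKernel π}

instance {𝒳 𝒜 : Type*} [MeasurableSpace 𝒳] [MeasurableSpace 𝒜] (π : Policy 𝒳 𝒜) :
    IsMarkovKernel π.1 := π.2

namespace PVModel

variable {𝒰 𝒳 𝒜 𝒵 𝒲 : Type*} [MeasurableSpace 𝒰] [MeasurableSpace 𝒳] [MeasurableSpace 𝒜]
  [MeasurableSpace 𝒵] [MeasurableSpace 𝒲] (M : PVModel 𝒰 𝒳 𝒜 𝒵 𝒲)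

/-- The joint law `ν(x) p(u,z,w|x) π(a|x,u,z,w) p(y|u,x,w,a)`. -/
def coreLaw (ν : Measure 𝒳) (π : Kernel (𝒳 × 𝒰 × 𝒵 × 𝒲) 𝒜) : Measure (Core 𝒰 𝒳 𝒜 𝒵 𝒲) :=
  ((ν ⊗ₘ M.κ) ⊗ₘ π) ⊗ₘ
    (M.ρ.comap (fun p : (𝒳 × 𝒰 × 𝒵 × 𝒲) × 𝒜 => (p.1.2.1, p.1.1, p.1.2.2.2, p.2)) (by fun_prop))

/-- Observational law of `(X, (U, Z, W), A, Y)`. -/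
def obsCore : Measure (Core 𝒰 𝒳 𝒜 𝒵 𝒲) :=
  M.coreLaw M.pX
    (M.πob.comap (fun p : 𝒳 × 𝒰 × 𝒵 × 𝒲 => (p.2.1, p.1, p.2.2.1)) (by fun_prop))

/-- Law of `(R_X, R_Z, R_W)` given all the other variables: three independent draws. -/
def missKernel : Kernel (Core 𝒰 𝒳 𝒜 𝒵 𝒲) (Bool × Bool × Bool) :=
  (M.mX.comap (fun c : Core 𝒰 𝒳 𝒜 𝒵 𝒲 => c.1.1.1) (by fun_prop)) ×ₖ
    ((M.mZ.comap (fun c : Core 𝒰 𝒳 𝒜 𝒵 𝒲 => (c.1.1.2.2.1, c.1.1.2.1, c.1.2, c.1.1.1))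
        (by fun_prop)) ×ₖ
      (M.mW.comap (fun c : Core 𝒰 𝒳 𝒜 𝒵 𝒲 => (c.1.1.2.2.2, c.1.1.1, c.1.2)) (by fun_prop)))

/-- The observational law of one trial, including the missingness indicators and an independent
pseudo random treatment `A'`. -/
def law : Measure (Trial 𝒰 𝒳 𝒜 𝒵 𝒲) := (M.obsCore ⊗ₘ M.missKernel).prod M.pseudo

/-- `μ_k`: the law of a trial conditioned on the missingness condition of the `k`-th equation. -/
def μ (k : Fin 4) : Measure (Trial 𝒰 𝒳 𝒜 𝒵 𝒲) := ProbabilityTheory.cond M.law (mask k)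

instance (ν : Measure 𝒳) [IsProbabilityMeasure ν] (π : Kernel (𝒳 × 𝒰 × 𝒵 × 𝒲) 𝒜)
    [IsMarkovKernel π] : IsProbabilityMeasure (M.coreLaw ν π) := by
  unfold coreLaw; infer_instance

instance : IsProbabilityMeasure M.obsCore := by
  unfold obsCore; infer_instance

instance : IsMarkovKernel M.missKernel := by
  unfold missKernel; infer_instance

instance : IsProbabilityMeasure M.law := by
  unfold law; infer_instance

instance (k : Fin 4) : IsFiniteMeasure (M.μ k) := by
  unfold μ; infer_instance

/-- The law of the i.i.d. sample of `T` trials. -/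
def sampleLaw (T : ℕ) : Measure (Fin T → Trial 𝒰 𝒳 𝒜 𝒵 𝒲) := Measure.pi fun _ => M.law

/-- Interventional law of `(X, (U, Z, W), A, Y)` under the policy `π`. -/
def intCore (π : Policy 𝒳 𝒜) : Measure (Core 𝒰 𝒳 𝒜 𝒵 𝒲) :=
  M.coreLaw M.ptilde (π.1.comap Prod.fst measurable_fst)

/-- Average reward `v^π` of the policy `π` in the interventional process. -/
def value (π : Policy 𝒳 𝒜) : ℝ := ∫ c, c.2 ∂(M.intCore π)

/-- The conditional average treatment effect `g*(x,a) = E[Y | X = x, do(A = a)]`. -/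
def cate (p : 𝒳 × 𝒜) : ℝ := ∫ s, (∫ y, y ∂(M.ρ (s.1, p.1, s.2.2, p.2))) ∂(M.κ p.1)

/-- Average reward `v(g, π)` predicted by a candidate CATE `g`. -/
def valueOf (g : 𝒳 × 𝒜 → ℝ) (π : Policy 𝒳 𝒜) : ℝ := ∫ p, g p ∂(M.ptilde ⊗ₘ π.1)

/-- `π` maximizes the average reward over the policy class `Pol`. -/
def IsOptimal (Pol : Set (Policy 𝒳 𝒜)) (π : Policy 𝒳 𝒜) : Prop :=
  π ∈ Pol ∧ ∀ π' ∈ Pol, M.value π' ≤ M.value π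

/-- `𝒯_k h = E_{μ_k}[α_k(h(X), Y_k) | Z_k]`, as a function on trials that is measurable with respect
to `Z_k`. -/
def T (k : Fin 4) (h : Bridge 𝒳 𝒜 𝒵 𝒲) : Trial 𝒰 𝒳 𝒜 𝒵 𝒲 → ℝ :=
  condExp (instAlg k) (M.μ k) (h.resid k)

/-- The projected residual `‖𝒯 h‖_{μ,2}`. -/
def rmse (h : Bridge 𝒳 𝒜 𝒵 𝒲) : ℝ := Real.sqrt (∑ k : Fin 4, ∫ o, (M.T k h o) ^ 2 ∂(M.μ k))

/-- PV completeness: a function `σ` of the confounder (for each `(x,a)`, so jointly a function of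
`(u,x,a)`) whose conditional mean given `(X, A, Z)` and `R_Z = 1` vanishes is a.s. zero, and
conversely. -/
def PVComplete : Prop :=
  ∀ σ : 𝒰 × 𝒳 × 𝒜 → ℝ, Measurable σ →
    Integrable (fun o => σ (vU o, vX o, vA o)) (ProbabilityTheory.cond M.law {o | vRZ o = true}) →
    ((condExp (MeasurableSpace.comap (fun o => (vX o, vA o, vZ o)) inferInstance)
          (ProbabilityTheory.cond M.law {o | vRZ o = true})
          (fun o => σ (vU o, vX o, vA o))
        =ᵐ[ProbabilityTheory.cond M.law {o | vRZ o = true}] 0) ↔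
      (fun o => σ (vU o, vX o, vA o)) =ᵐ[M.law] 0)

/-- Existence of an exact solution (a vector of bridge functions) of the integral equation system
`E_{μ_k}[α_k(h(X), Y_k) | Z_k] = 0`, `k = 1, …, 4`. -/
def BridgeExists : Prop :=
  ∃ h : Bridge 𝒳 𝒜 𝒵 𝒲, h.Meas ∧
    ∀ k, Integrable (h.resid k) (M.μ k) ∧ M.T k h =ᵐ[M.μ k] 0

/-- PV independence: `W ⫫ A | (U, X)` and `Z ⫫ (Y, W) | (A, X, U)` under the observational law. -/
def PVIndep [StandardBorelSpace 𝒰] [StandardBorelSpace 𝒳] [StandardBorelSpace 𝒜]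
    [StandardBorelSpace 𝒵] [StandardBorelSpace 𝒲] : Prop :=
  CondIndepFun (MeasurableSpace.comap (fun o : Trial 𝒰 𝒳 𝒜 𝒵 𝒲 => (vU o, vX o)) inferInstance)
      (Measurable.comap_le (by unfold vU vX; fun_prop)) vW vA M.law ∧
    CondIndepFun
      (MeasurableSpace.comap (fun o : Trial 𝒰 𝒳 𝒜 𝒵 𝒲 => (vA o, vX o, vU o)) inferInstance)
      (Measurable.comap_le (by unfold vA vX vU; fun_prop)) vZ (fun o => (vY o, vW o)) M.law

/-- Realizability of `ℋ` up to `εH`. -/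
def Realizable (ℋ : Set (Bridge 𝒳 𝒜 𝒵 𝒲)) (Pol : Set (Policy 𝒳 𝒜)) (εH : ℝ) : Prop :=
  ∃ h ∈ ℋ, M.rmse h ≤ εH ∧
    ∀ π ∈ Pol, eLpNorm (fun p => h.g p - M.cate p) 2 (M.ptilde ⊗ₘ π.1) ≤ ENNReal.ofReal εH

/-- Compatibility of the test classes up to `εΘ`. -/
def Compatible (ℋ : Set (Bridge 𝒳 𝒜 𝒵 𝒲)) (Θ : DualClass 𝒳 𝒜 𝒵 𝒲) (εΘ : ℝ) : Prop :=
  ∀ h ∈ ℋ, ∀ k, (⨅ θ ∈ Θ.onTrial k, eLpNorm (fun o => θ o - M.T k h o) 2 (M.μ k)) ≤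
    ENNReal.ofReal εΘ

/-- Regularity: the reward is supported in `[-LY, LY]`, the members of `ℋ` and of the test classes
are bounded by `Lh` and `Lθ`, and `Lα` bounds all the integrands `α_k`. -/
structure Regular (ℋ : Set (Bridge 𝒳 𝒜 𝒵 𝒲)) (Θ : DualClass 𝒳 𝒜 𝒵 𝒲) (LY Lh Lθ Lα : ℝ) :
    Prop where
  reward : ∀ p, ∀ᵐ y ∂(M.ρ p), |y| ≤ LY
  bridge : ∀ h ∈ ℋ, (∀ p, |h.h1 p| ≤ Lh) ∧ (∀ p, |h.h2 p| ≤ Lh) ∧ (∀ p, |h.h3 p| ≤ Lh) ∧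
    (∀ p, |h.g p| ≤ Lh)
  test : (∀ θ ∈ Θ.Θ1, ∀ p, |θ p| ≤ Lθ) ∧ (∀ θ ∈ Θ.Θ2, ∀ p, |θ p| ≤ Lθ) ∧
    (∀ θ ∈ Θ.Θ3, ∀ p, |θ p| ≤ Lθ) ∧ (∀ θ ∈ Θ.Θ4, ∀ p, |θ p| ≤ Lθ)
  integrand : ∀ h ∈ ℋ, ∀ k, ∀ o : Trial 𝒰 𝒳 𝒜 𝒵 𝒲, |vY o| ≤ LY → |h.resid k o| ≤ Lα

/-- The measure `p(u|x) p̃(x) π(a|x)` on `(u,x,a)`. -/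
def num1 (π : Policy 𝒳 𝒜) : Measure (𝒰 × 𝒳 × 𝒜) :=
  (M.ptilde ⊗ₘ (M.κ.fst ×ₖ π.1)).map fun p => (p.2.1, p.1, p.2.2)

/-- The measure `p̃(x) π(a'|x) p(a,w | x, R_X = 1)` on `((w,x,a),a')`. -/
def num3 [StandardBorelSpace 𝒜] [Nonempty 𝒜] [StandardBorelSpace 𝒲] [Nonempty 𝒲]
    (π : Policy 𝒳 𝒜) : Measure ((𝒲 × 𝒳 × 𝒜) × 𝒜) :=
  (M.ptilde ⊗ₘ (π.1 ×ₖ condDistrib (fun o => (vA o, vW o)) vX (M.μ 3))).map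
    fun p => ((p.2.2.2, p.1, p.2.2.1), p.2.1)

/-- The law of `(U, X, A)` given `(R_X, R_Z) = 1`. -/
def den1 : Measure (𝒰 × 𝒳 × 𝒜) := (M.μ 0).map fun o => (vU o, vX o, vA o)

/-- The law of `(A, W, X)` given the missingness condition of the `k`-th equation. -/
def lawAWX (k : Fin 4) : Measure (𝒜 × 𝒲 × 𝒳) := (M.μ k).map fun o => (vA o, vW o, vX o)

/-- The measure `p(x,a,w | (R_W,R_X) = 1) u(a')` on `((w,x,a),a')`. -/
def den3 : Measure ((𝒲 × 𝒳 × 𝒜) × 𝒜) := ((M.μ 2).map fun o => (vW o, vX o, vA o)).prod M.pseudo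

/-- The measure `p(x | R_X = 1) u(a')` on `(x,a')`. -/
def den4 : Measure (𝒳 × 𝒜) := ((M.μ 3).map vX).prod M.pseudo

/-- All the density ratios below are genuine: each numerator is absolutely continuous with respect
to the corresponding denominator. -/
structure RatiosExist [StandardBorelSpace 𝒜] [Nonempty 𝒜] [StandardBorelSpace 𝒲] [Nonempty 𝒲]
    (π : Policy 𝒳 𝒜) : Prop where
  ac1 : M.num1 π ≪ M.den1
  ac2 : M.lawAWX 0 ≪ M.lawAWX 1
  ac3 : M.num3 π ≪ M.den3
  ac4 : M.ptilde ⊗ₘ π.1 ≪ M.den4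

/-- `b₁(x,a,z)` is a shift function for `π`:
`E[b₁(X,A,Z) | X, U, A, (R_X,R_Z)=1] = p(u|x) p̃(x) π(a|x) / p(u,x,a | (R_X,R_Z)=1)`. -/
def IsShift (π : Policy 𝒳 𝒜) (b₁ : 𝒳 × 𝒜 × 𝒵 → ℝ) : Prop :=
  Measurable b₁ ∧ Integrable (fun o => b₁ (vX o, vA o, vZ o)) (M.μ 0) ∧
    condExp (MeasurableSpace.comap (fun o => (vX o, vU o, vA o)) inferInstance) (M.μ 0)
        (fun o => b₁ (vX o, vA o, vZ o))
      =ᵐ[M.μ 0] fun o => ((M.num1 π).rnDeriv M.den1 (vU o, vX o, vA o)).toReal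

/-- `b₂(a,w,x,z) = b₁(x,a,z) p(a,w,x | (R_X,R_Z)=1) / p(a,w,x | (R_W,R_X,R_Z)=1)`. -/
def b2 (b₁ : 𝒳 × 𝒜 × 𝒵 → ℝ) (p : 𝒜 × 𝒲 × 𝒳 × 𝒵) : ℝ :=
  b₁ (p.2.2.1, p.1, p.2.2.2) * ((M.lawAWX 0).rnDeriv (M.lawAWX 1) (p.1, p.2.1, p.2.2.1)).toReal

/-- `b₃ = p̃(x) π(a'|x) p(a,w | x, R_X=1) / (u(a') p(x,a,w | (R_W,R_X)=1))`. -/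
def b3 [StandardBorelSpace 𝒜] [Nonempty 𝒜] [StandardBorelSpace 𝒲] [Nonempty 𝒲]
    (π : Policy 𝒳 𝒜) (p : (𝒲 × 𝒳 × 𝒜) × 𝒜) : ℝ := ((M.num3 π).rnDeriv M.den3 p).toReal

/-- `b₄(x,a') = p̃(x) π(a'|x) / (p(x | R_X=1) u(a'))`. -/
def b4 (π : Policy 𝒳 𝒜) (p : 𝒳 × 𝒜) : ℝ := ((M.ptilde ⊗ₘ π.1).rnDeriv M.den4 p).toReal

/-- `∑_k ‖b_k‖_{μ_k,2}`, with value `∞` if one of the norms is infinite. -/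
def shiftNorm [StandardBorelSpace 𝒜] [Nonempty 𝒜] [StandardBorelSpace 𝒲] [Nonempty 𝒲]
    (π : Policy 𝒳 𝒜) (b₁ : 𝒳 × 𝒜 × 𝒵 → ℝ) : ENNReal :=
  eLpNorm (fun o => b₁ (vX o, vA o, vZ o)) 2 (M.μ 0) +
    eLpNorm (fun o => M.b2 b₁ (vA o, vW o, vX o, vZ o)) 2 (M.μ 1) +
    eLpNorm (fun o => M.b3 π ((vW o, vX o, vA o), vA' o)) 2 (M.μ 2) +
    eLpNorm (fun o => M.b4 π (vX o, vA' o)) 2 (M.μ 3)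

end PVModel

section Algorithm

variable {𝒰 𝒳 𝒜 𝒵 𝒲 : Type*} {n : ℕ}

open Classical in
/-- `𝒟_k`: the (indices of the) trials of the data set in which the variables needed by the `k`-th
equation are observed. -/
def sub (d : Fin n → Trial 𝒰 𝒳 𝒜 𝒵 𝒲) (k : Fin 4) : Finset (Fin n) :=
  Finset.univ.filter fun t => d t ∈ mask k

/-- The empirical loss `ℒ_{k,𝒟}(h)`. It only uses the observed variables of the trials in
`𝒟_k`. -/
def lossK (Θ : DualClass 𝒳 𝒜 𝒵 𝒲) (d : Fin n → Trial 𝒰 𝒳 𝒜 𝒵 𝒲) (k : Fin 4)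
    (h : Bridge 𝒳 𝒜 𝒵 𝒲) : ℝ :=
  sSup ((fun θ : Trial 𝒰 𝒳 𝒜 𝒵 𝒲 → ℝ =>
    empMean (sub d k) d (fun o => h.resid k o * θ o) - (1 / 2) * empNorm (sub d k) d θ ^ 2) ''
      Θ.onTrial k)

/-- The empirical loss `ℒ_𝒟(h)`. -/
def loss (Θ : DualClass 𝒳 𝒜 𝒵 𝒲) (d : Fin n → Trial 𝒰 𝒳 𝒜 𝒵 𝒲) (h : Bridge 𝒳 𝒜 𝒵 𝒲) : ℝ :=
  ∑ k : Fin 4, lossK Θ d k h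

/-- The confidence set of bridge vectors with threshold `e`. -/
def confH (ℋ : Set (Bridge 𝒳 𝒜 𝒵 𝒲)) (Θ : DualClass 𝒳 𝒜 𝒵 𝒲) (d : Fin n → Trial 𝒰 𝒳 𝒜 𝒵 𝒲)
    (e : ℝ) : Set (Bridge 𝒳 𝒜 𝒵 𝒲) :=
  {h ∈ ℋ | loss Θ d h ≤ sInf (loss Θ d '' ℋ) + e}

/-- The confidence set for the CATE with threshold `e`. -/
def confG (ℋ : Set (Bridge 𝒳 𝒜 𝒵 𝒲)) (Θ : DualClass 𝒳 𝒜 𝒵 𝒲) (d : Fin n → Trial 𝒰 𝒳 𝒜 𝒵 𝒲)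
    (e : ℝ) : Set (𝒳 × 𝒜 → ℝ) :=
  Bridge.g '' confH ℋ Θ d e

variable [MeasurableSpace 𝒰] [MeasurableSpace 𝒳] [MeasurableSpace 𝒜] [MeasurableSpace 𝒵]
  [MeasurableSpace 𝒲]

/-- The pessimistic value `inf {v(g, π) : g in the confidence set}`. -/
def pessValue (M : PVModel 𝒰 𝒳 𝒜 𝒵 𝒲) (ℋ : Set (Bridge 𝒳 𝒜 𝒵 𝒲)) (Θ : DualClass 𝒳 𝒜 𝒵 𝒲)
    (d : Fin n → Trial 𝒰 𝒳 𝒜 𝒵 𝒲) (e : ℝ) (π : Policy 𝒳 𝒜) : ℝ :=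
  sInf ((fun g => M.valueOf g π) '' confG ℋ Θ d e)

/-- `π` is an output of the CAP algorithm on the data `d` with threshold `e`: it maximizes the
pessimistic value over the policy class. -/
def IsCAP (M : PVModel 𝒰 𝒳 𝒜 𝒵 𝒲) (ℋ : Set (Bridge 𝒳 𝒜 𝒵 𝒲)) (Θ : DualClass 𝒳 𝒜 𝒵 𝒲)
    (Pol : Set (Policy 𝒳 𝒜)) (d : Fin n → Trial 𝒰 𝒳 𝒜 𝒵 𝒲) (e : ℝ) (π : Policy 𝒳 𝒜) : Prop :=
  π ∈ Pol ∧ ∀ π' ∈ Pol, pessValue M ℋ Θ d e π' ≤ pessValue M ℋ Θ d e π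

/-- `η_k` bounds the critical radii of `𝒬_k` and `Θ_k` on `𝒟_k` at confidence level `ξ`, for every
`k`. -/
def BoundsRadii (c₀ c₁ ξ Lθ Lα : ℝ) (ℋ : Set (Bridge 𝒳 𝒜 𝒵 𝒲)) (Θ : DualClass 𝒳 𝒜 𝒵 𝒲)
    (d : Fin n → Trial 𝒰 𝒳 𝒜 𝒵 𝒲) (η : Fin 4 → ℝ) : Prop :=
  ∀ k, BoundsCriticalRadius c₀ c₁ ξ (sub d k) d (prodClass ℋ Θ k) (max 1 (Lα * Lθ)) (η k) ∧
    BoundsCriticalRadius c₀ c₁ ξ (sub d k) d (Θ.onTrial k) (max 1 Lθ) (η k)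

end Algorithm

end CCB

end

/-! The regret bound combines an exact error identity, a least-squares comparison and a
concentration inequality.

Identity. For every bounded measurable bridge vector `f`, whether or not it solves the equations,
`v(g, π*) - v^{π*}` is the sum over the four equations of `E_{μ_k}[b_k α_k(f)]`
(`RatiosExist.sum_integral_weight_mul_resid`). The weights telescope. `b₂` carries the law of the
second equation to that of the first, where `h₁` cancels; `b₃` carries the law of the third to that
of the fourth weighted by `b₄`, where `h₃` cancels. There remain `h₂(A,W,X) - Y` weighted by `b₁`
and `g(X,A') - h₂(A',W,X)` weighted by `b₄`. The shift property together with proxy independence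
makes the first an interventional mean, the definition of `b₄` makes the second one, and then `h₂`
cancels. As `b_k` depends only on the conditioning variables, `α_k` may be replaced by its
projection `T_k f`, and Cauchy–Schwarz bounds the error by the sum of `‖b_k‖ ‖T_k f‖`.

Least squares. When empirical moments are close to population ones, the loss of `f` is, up to
constants and terms of order `η²` and `εΘ²`, the sum of `‖T_k f‖²` (`objective_le`, `le_objective`).
Hence the approximate solution lies in the confidence set, and every member of that set has small
projected residuals. Pessimism then needs the identity at `π*` only: at the chosen policy the
infimum is at most the value predicted by the approximate solution (`Regular.ofReal_subopt_le`).

Concentration. The critical radius is read off the same data that it has to control, and all scales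
are treated on one event. Add a ghost sample and swap the members of each pair at random. The first
radius of a geometric grid at which the complexity of the pairs becomes small is invariant under
swaps, so no union over the grid is paid. At that radius the entropy method bounds the deviation
between the halves (`cubeProb_split_deviation_le`); at the previous radius the complexity of the
pairs is large, and a lower tail for self-bounding functions passes this on to the first half
(`cubeProb_rad_select_clip_le`). An empirical critical radius therefore cannot lie far below the
grid radius. Chebyshev's inequality removes the ghost sample (`measure_pi_exists_deviation_le`).
Missing data are handled by conditioning on which trials are observed, which leaves an i.i.d. sample
of `μ_k` (`measure_pi_subsample_not_uniformlyClose_le`). -/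

noncomputable section

namespace CCB

/-! ### Entropy method on the hypercube: modified log-Sobolev inequality and Herbst's argument. -/

section Hypercube

variable {ι : Type*} [Fintype ι] [DecidableEq ι]

set_option linter.unusedSectionVars false

/-- Average of a function over the Boolean hypercube. -/
def cubeAvg (g : (ι → Bool) → ℝ) : ℝ := (∑ σ, g σ) / (Fintype.card (ι → Bool) : ℝ)

/-- Flip one coordinate of a point of the hypercube. -/
def flipAt (i : ι) (σ : ι → Bool) : ι → Bool := Function.update σ i (!σ i)

lemma flipAt_flipAt (i : ι) (σ : ι → Bool) : flipAt i (flipAt i σ) = σ := by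
  simp [flipAt]

lemma flipAt_involutive (i : ι) : Function.Involutive (flipAt (ι := ι) i) := flipAt_flipAt i

lemma cubeCard_pos : (0 : ℝ) < (Fintype.card (ι → Bool) : ℝ) := by
  exact_mod_cast Fintype.card_pos

lemma cubeAvg_mono {f g : (ι → Bool) → ℝ} (h : ∀ σ, f σ ≤ g σ) : cubeAvg f ≤ cubeAvg g :=
  div_le_div_of_nonneg_right (Finset.sum_le_sum fun σ _ => h σ) cubeCard_pos.le

lemma cubeAvg_add (f g : (ι → Bool) → ℝ) :
    cubeAvg (fun σ => f σ + g σ) = cubeAvg f + cubeAvg g := by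
  simp [cubeAvg, Finset.sum_add_distrib, add_div]

lemma cubeAvg_sub (f g : (ι → Bool) → ℝ) :
    cubeAvg (fun σ => f σ - g σ) = cubeAvg f - cubeAvg g := by
  simp [cubeAvg, Finset.sum_sub_distrib, sub_div]

lemma cubeAvg_const_mul (a : ℝ) (f : (ι → Bool) → ℝ) :
    cubeAvg (fun σ => a * f σ) = a * cubeAvg f := by
  simp [cubeAvg, ← Finset.mul_sum, mul_div_assoc]

lemma cubeAvg_mul_const (f : (ι → Bool) → ℝ) (a : ℝ) :
    cubeAvg (fun σ => f σ * a) = cubeAvg f * a := by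
  simp_rw [mul_comm _ a, cubeAvg_const_mul]

lemma cubeAvg_const (a : ℝ) : cubeAvg (fun _ : ι → Bool => a) = a := by
  have := (cubeCard_pos (ι := ι)).ne'
  simp only [cubeAvg, Finset.sum_const, Finset.card_univ, nsmul_eq_mul]
  field_simp

lemma cubeAvg_sum {κ : Type*} (s : Finset κ) (f : κ → (ι → Bool) → ℝ) :
    cubeAvg (fun σ => ∑ k ∈ s, f k σ) = ∑ k ∈ s, cubeAvg (f k) := by
  simp only [cubeAvg]
  rw [Finset.sum_comm, Finset.sum_div]

lemma cubeAvg_nonneg {f : (ι → Bool) → ℝ} (h : ∀ σ, 0 ≤ f σ) : 0 ≤ cubeAvg f :=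
  div_nonneg (Finset.sum_nonneg fun σ _ => h σ) cubeCard_pos.le

lemma cubeAvg_pos {f : (ι → Bool) → ℝ} (h : ∀ σ, 0 < f σ) : 0 < cubeAvg f :=
  div_pos (Finset.sum_pos (fun σ _ => h σ) Finset.univ_nonempty) cubeCard_pos

lemma cubeAvg_equiv {κ : Type*} [Fintype κ] [DecidableEq κ] (e : (ι → Bool) ≃ (κ → Bool))
    (f : (κ → Bool) → ℝ) : cubeAvg (fun σ => f (e σ)) = cubeAvg f := by
  simp only [cubeAvg]
  rw [Equiv.sum_comp e f, Fintype.card_congr e]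

lemma cubeAvg_comp_flipAt (i : ι) (f : (ι → Bool) → ℝ) :
    cubeAvg (fun σ => f (flipAt i σ)) = cubeAvg f :=
  cubeAvg_equiv (flipAt_involutive i).toPerm f

lemma cubeAvg_comp_not (f : (ι → Bool) → ℝ) :
    cubeAvg (fun σ => f (fun i => !σ i)) = cubeAvg f :=
  cubeAvg_equiv (Equiv.arrowCongr (Equiv.refl ι) Equiv.boolNot) f

/-- Entropy of a function on the hypercube. -/
def cubeEnt (f : (ι → Bool) → ℝ) : ℝ :=
  cubeAvg (fun σ => f σ * Real.log (f σ)) - cubeAvg f * Real.log (cubeAvg f)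

/-- Entropy of a function on a pair of equiprobable points. -/
def pairEnt (x y : ℝ) : ℝ :=
  (x * Real.log x + y * Real.log y) / 2 - (x + y) / 2 * Real.log ((x + y) / 2)

/-- `pairEnt` is convex and positively homogeneous, so it dominates the linear form given by its
gradient at any point. Linearity in `(x, y)` is what lets the inequality be averaged. The proof is
`log t ≤ t - 1` applied once per coordinate. -/
lemma pairEnt_tangent {x y x₀ y₀ : ℝ} (hx : 0 < x) (hy : 0 < y) (hx₀ : 0 < x₀) (hy₀ : 0 < y₀) :
    x / 2 * (Real.log x₀ - Real.log ((x₀ + y₀) / 2)) +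
      y / 2 * (Real.log y₀ - Real.log ((x₀ + y₀) / 2)) ≤ pairEnt x y := by
  set m := (x + y) / 2 with hm
  set m₀ := (x₀ + y₀) / 2 with hm₀
  have hmp : 0 < m := by positivity
  have hmp₀ : 0 < m₀ := by positivity
  have key : ∀ a a₀ : ℝ, 0 < a → 0 < a₀ →
      a - m * a₀ / m₀ ≤ a * (Real.log a - Real.log m - (Real.log a₀ - Real.log m₀)) := by
    intro a a₀ ha ha₀
    have h := Real.log_le_sub_one_of_pos (x := m * a₀ / (m₀ * a)) (by positivity)
    rw [Real.log_div (by positivity) (by positivity), Real.log_mul hmp.ne' ha₀.ne',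
      Real.log_mul hmp₀.ne' ha.ne'] at h
    have h2 := mul_le_mul_of_nonneg_left h ha.le
    have h3 : a * (m * a₀ / (m₀ * a) - 1) = m * a₀ / m₀ - a := by field_simp
    rw [h3] at h2
    nlinarith
  have h1 := key x x₀ hx hx₀
  have h2 := key y y₀ hy hy₀
  have h3 : m * x₀ / m₀ + m * y₀ / m₀ = 2 * m := by
    rw [← add_div, ← mul_add, show x₀ + y₀ = 2 * m₀ by rw [hm₀]; ring]; field_simp
  have h4 : x + y = 2 * m := by rw [hm]; ring
  unfold pairEnt
  rw [← hm]
  have h5 : m * Real.log m = x / 2 * Real.log m + y / 2 * Real.log m := by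
    linear_combination Real.log m * hm
  rw [h5]
  nlinarith

/-- Two-point case of the log-Sobolev inequality. With `b ≤ a`, convexity of `exp` puts the
logarithm of the mean above `(a + b) / 2`, which leaves `(a - b) (exp a - exp b) / 4`; the tangent
line of `exp` at `0` then gives the square. -/
lemma pairEnt_exp_le (a b : ℝ) :
    pairEnt (Real.exp a) (Real.exp b) ≤
      (1 / 2) * ((max (a - b) 0 ^ 2 * Real.exp a + max (b - a) 0 ^ 2 * Real.exp b) / 2) := by
  wlog hab : b ≤ a generalizing a b
  · have := this b a (by linarith)
    unfold pairEnt at this ⊢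
    rw [add_comm (Real.exp b) (Real.exp a)] at this
    linarith
  have hea := Real.exp_pos a
  have heb := Real.exp_pos b
  have hlog : (a + b) / 2 ≤ Real.log ((Real.exp a + Real.exp b) / 2) := by
    rw [Real.le_log_iff_exp_le (by positivity)]
    have h1 : Real.exp a = Real.exp ((a + b) / 2) * Real.exp ((a - b) / 2) := by
      rw [← Real.exp_add]; ring_nf
    have h2 : Real.exp b = Real.exp ((a + b) / 2) * Real.exp (-((a - b) / 2)) := by
      rw [← Real.exp_add]; ring_nf
    have h3 := Real.one_le_cosh ((a - b) / 2)
    rw [Real.cosh_eq] at h3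
    have := Real.exp_pos ((a + b) / 2)
    rw [h1, h2]
    nlinarith
  have hexp : Real.exp a - Real.exp b ≤ (a - b) * Real.exp a := by
    have h1 : Real.exp b = Real.exp a * Real.exp (b - a) := by rw [← Real.exp_add]; ring_nf
    have h2 := Real.add_one_le_exp (b - a)
    rw [h1]; nlinarith
  rw [max_eq_left (by linarith : (0 : ℝ) ≤ a - b), max_eq_right (by linarith : b - a ≤ (0 : ℝ))]
  unfold pairEnt
  rw [Real.log_exp, Real.log_exp]
  have h1 := mul_le_mul_of_nonneg_left hlog (by positivity : 0 ≤ (Real.exp a + Real.exp b) / 2)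
  have h2 := mul_le_mul_of_nonneg_left hexp (by linarith : 0 ≤ a - b)
  nlinarith

lemma cubeAvg_fin_succ {n : ℕ} (f : (Fin (n + 1) → Bool) → ℝ) :
    cubeAvg f = (cubeAvg (fun τ : Fin n → Bool => f (Fin.cons true τ)) +
      cubeAvg (fun τ : Fin n → Bool => f (Fin.cons false τ))) / 2 := by
  simp only [cubeAvg]
  rw [← Equiv.sum_comp (Fin.consEquiv fun _ : Fin (n + 1) => Bool) f, Fintype.sum_prod_type,
    Fintype.sum_bool]
  simp only [Fin.consEquiv, Equiv.coe_fn_mk, Fintype.card_pi, Finset.prod_const, Fintype.card_bool,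
    Finset.card_univ, Fintype.card_fin, Nat.cast_pow, pow_succ]
  push_cast
  field_simp

/-- Jensen's inequality for the convex function `pairEnt`: average the tangent inequality taken at
the mean. -/
lemma pairEnt_cubeAvg_le {f g : (ι → Bool) → ℝ} (hf : ∀ σ, 0 < f σ) (hg : ∀ σ, 0 < g σ) :
    pairEnt (cubeAvg f) (cubeAvg g) ≤ cubeAvg fun σ => pairEnt (f σ) (g σ) := by
  have h := cubeAvg_mono fun σ =>
    pairEnt_tangent (hf σ) (hg σ) (cubeAvg_pos hf) (cubeAvg_pos hg)
  refine le_trans (le_of_eq ?_) h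
  rw [cubeAvg_add, cubeAvg_mul_const, cubeAvg_mul_const]
  simp_rw [div_eq_mul_inv _ (2 : ℝ)]
  rw [cubeAvg_mul_const, cubeAvg_mul_const]
  unfold pairEnt
  ring_nf

/-- Modified logarithmic Sobolev inequality on the hypercube `{0,1}ⁿ`. -/
lemma cubeEnt_exp_le_fin : ∀ {n : ℕ} (g : (Fin n → Bool) → ℝ),
    cubeEnt (fun σ => Real.exp (g σ)) ≤
      (1 / 2) * ∑ i, cubeAvg fun σ => max (g σ - g (flipAt i σ)) 0 ^ 2 * Real.exp (g σ)
  | 0, g => by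
    have : ∀ f : (Fin 0 → Bool) → ℝ, cubeAvg f = f default := by
      intro f
      rw [cubeAvg, Fintype.sum_unique, Fintype.card_unique, Nat.cast_one, div_one]
      exact congrArg f (Subsingleton.elim _ _)
    simp [cubeEnt, this]
  | n + 1, g => by
    have iht := cubeEnt_exp_le_fin fun τ : Fin n → Bool => g (Fin.cons true τ)
    have ihf := cubeEnt_exp_le_fin fun τ : Fin n → Bool => g (Fin.cons false τ)
    -- Chain rule for entropy: the entropy on `n + 1` coordinates is the mean of the entropies on
    -- the two faces plus the two-point entropy of the face means. Induction handles the faces, and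
    -- Jensen with the two-point case handles the new coordinate.
    have h0 := (pairEnt_cubeAvg_le
      (f := fun τ : Fin n → Bool => Real.exp (g (Fin.cons true τ)))
      (g := fun τ : Fin n → Bool => Real.exp (g (Fin.cons false τ)))
      (fun _ => Real.exp_pos _) (fun _ => Real.exp_pos _)).trans
      (cubeAvg_mono fun τ => pairEnt_exp_le _ _)
    rw [cubeAvg_const_mul] at h0
    simp_rw [div_eq_mul_inv _ (2 : ℝ)] at h0
    rw [cubeAvg_mul_const, cubeAvg_add] at h0
    rw [Fin.sum_univ_succ]
    have hs0 : ∀ b (τ : Fin n → Bool), flipAt 0 (Fin.cons b τ : Fin (n + 1) → Bool) =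
        Fin.cons (!b) τ := by
      intro b τ; simp [flipAt, Fin.update_cons_zero]
    have hss : ∀ b (τ : Fin n → Bool) (i : Fin n),
        flipAt i.succ (Fin.cons b τ : Fin (n + 1) → Bool) = Fin.cons b (flipAt i τ) := by
      intro b τ i; simp [flipAt, Fin.cons_update]
    unfold cubeEnt at *
    simp_rw [cubeAvg_fin_succ (n := n), hs0, hss]
    unfold pairEnt at h0
    simp only [Bool.not_true, Bool.not_false]
    rw [← Finset.sum_div, Finset.sum_add_distrib]
    linarith

/-- Modified logarithmic Sobolev inequality on the hypercube. -/
lemma cubeEnt_exp_le (g : (ι → Bool) → ℝ) :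
    cubeEnt (fun σ => Real.exp (g σ)) ≤
      (1 / 2) * ∑ i, cubeAvg fun σ => max (g σ - g (flipAt i σ)) 0 ^ 2 * Real.exp (g σ) := by
  let e := Fintype.equivFin ι
  let E : (ι → Bool) ≃ (Fin (Fintype.card ι) → Bool) := Equiv.arrowCongr e (Equiv.refl _)
  have h := cubeEnt_exp_le_fin fun τ => g (E.symm τ)
  have hE : ∀ f : (ι → Bool) → ℝ, cubeAvg (fun τ => f (E.symm τ)) = cubeAvg f :=
    fun f => cubeAvg_equiv E.symm f
  have hfl : ∀ i τ, E.symm (flipAt i τ) = flipAt (e.symm i) (E.symm τ) := by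
    intro i τ
    funext j
    simp only [E, flipAt, Equiv.arrowCongr_symm, Equiv.arrowCongr_apply, Function.comp,
      Equiv.symm_symm, Function.update_apply, Equiv.refl_symm, Equiv.refl_apply]
    by_cases hj : e j = i
    · subst hj; simp
    · have : ¬ j = e.symm i := fun h => hj (by simp [h])
      simp [hj, this]
  unfold cubeEnt at h ⊢
  simp_rw [hfl] at h
  rw [hE (fun σ => Real.exp (g σ) * Real.log (Real.exp (g σ))), hE (fun σ => Real.exp (g σ)),
    Finset.sum_congr rfl fun i _ => hE (fun σ => max (g σ - g (flipAt (e.symm i) σ)) 0 ^ 2 *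
      Real.exp (g σ)), Equiv.sum_comp e.symm (fun i => cubeAvg fun σ =>
      max (g σ - g (flipAt i σ)) 0 ^ 2 * Real.exp (g σ))] at h
  exact h

/-- Herbst's argument: an entropy bound integrates to a bound on the moment generating function. -/
lemma cubeAvg_exp_le_of_cubeEnt (g : (ι → Bool) → ℝ) {B l₀ : ℝ} (hl₀ : 0 < l₀)
    (h : ∀ l, 0 < l → l ≤ l₀ → cubeEnt (fun σ => Real.exp (l * g σ)) ≤
      B * l ^ 2 * cubeAvg fun σ => Real.exp (l * g σ)) :
    cubeAvg (fun σ => Real.exp (l₀ * g σ)) ≤ Real.exp (l₀ * cubeAvg g + B * l₀ ^ 2) := by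
  set M : ℝ → ℝ := fun l => cubeAvg fun σ => Real.exp (l * g σ) with hM
  have hMpos : ∀ l, 0 < M l := fun l => cubeAvg_pos fun _ => Real.exp_pos _
  have hMd : ∀ l, HasDerivAt M (cubeAvg fun σ => Real.exp (l * g σ) * g σ) l := by
    intro l
    simp only [hM, cubeAvg]
    refine HasDerivAt.div_const (HasDerivAt.fun_sum fun σ _ => ?_) _
    simpa using ((hasDerivAt_id l).mul_const (g σ)).exp
  have hKd : ∀ l, HasDerivAt (fun l => Real.log (M l))
      ((cubeAvg fun σ => Real.exp (l * g σ) * g σ) / M l) l :=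
    fun l => (hMd l).log (hMpos l).ne'
  -- The derivative of `log (M l) / l` is the entropy divided by `l² M l`, so the hypothesis says
  -- exactly that `φ` decreases; its limit at `0` is the mean of `g`.
  set φ : ℝ → ℝ := fun l => Real.log (M l) / l - B * l with hφ
  have hφd : ∀ l, l ≠ 0 → HasDerivAt φ
      (((cubeAvg fun σ => Real.exp (l * g σ) * g σ) / M l * l - Real.log (M l) * 1) / l ^ 2 - B) l :=
    fun l hl => by
      have h1 := ((hKd l).div (hasDerivAt_id l) hl).sub ((hasDerivAt_id l).const_mul B)
      rw [mul_one B] at h1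
      exact h1
  have hanti : AntitoneOn φ (Set.Ioc 0 l₀) := by
    refine antitoneOn_of_deriv_nonpos (convex_Ioc 0 l₀)
      (fun l hl => (hφd l hl.1.ne').continuousAt.continuousWithinAt)
      (fun l hl => (hφd l (interior_subset hl).1.ne').differentiableAt.differentiableWithinAt) ?_
    intro l hl
    have hl' := interior_subset hl
    rw [(hφd l hl'.1.ne').deriv]
    have h1 := h l hl'.1 hl'.2
    unfold cubeEnt at h1
    simp_rw [Real.log_exp] at h1
    have h2 : cubeAvg (fun σ => Real.exp (l * g σ) * (l * g σ)) =
        l * cubeAvg fun σ => Real.exp (l * g σ) * g σ := by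
      rw [← cubeAvg_const_mul]; congr 1; funext σ; ring
    rw [h2] at h1
    change _ - M l * Real.log (M l) ≤ B * l ^ 2 * M l at h1
    have hl2 : 0 < l ^ 2 := by have := hl'.1; positivity
    rw [sub_nonpos, div_le_iff₀ hl2, mul_one, div_mul_eq_mul_div, sub_le_iff_le_add,
      div_le_iff₀ (hMpos l)]
    linarith
  have hM0 : M 0 = 1 := by simp [hM, cubeAvg_const]
  have hlim : Tendsto φ (𝓝[>] 0) (𝓝 (cubeAvg g)) := by
    have h1 := (hKd 0).tendsto_slope_zero_right
    have h2 : Tendsto (fun l : ℝ => B * l) (𝓝[>] 0) (𝓝 0) := by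
      have : Tendsto (fun l : ℝ => B * l) (𝓝 0) (𝓝 (B * 0)) :=
        (continuous_const.mul continuous_id).tendsto 0
      rw [mul_zero] at this
      exact this.mono_left nhdsWithin_le_nhds
    have h3 := h1.sub h2
    simp only [hM0, Real.log_one, zero_add, sub_zero, zero_mul, Real.exp_zero, one_mul, div_one,
      smul_eq_mul] at h3
    refine h3.congr fun l => ?_
    simp only [hφ]; ring
  have hle : φ l₀ ≤ cubeAvg g := by
    refine ge_of_tendsto hlim ?_
    filter_upwards [Ioc_mem_nhdsGT hl₀] with l hl
    exact hanti hl ⟨hl₀, le_rfl⟩ hl.2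
  have h4 : Real.log (M l₀) ≤ l₀ * cubeAvg g + B * l₀ ^ 2 := by
    simp only [hφ] at hle
    rw [sub_le_iff_le_add, div_le_iff₀ hl₀] at hle
    nlinarith
  rw [← Real.log_le_log_iff (hMpos l₀) (Real.exp_pos _), Real.log_exp]
  exact h4

end Hypercube

/-! ### Rademacher complexities: upper tails, self-bounding lower tails, contraction. -/

section Rademacher

variable {ι : Type*} [Fintype ι] [DecidableEq ι]

set_option linter.unusedSectionVars false

open Classical in
/-- Probability of an event under the uniform law on the hypercube. -/
def cubeProb (p : (ι → Bool) → Prop) : ℝ := cubeAvg fun σ => if p σ then 1 else 0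

lemma cubeProb_mono {p q : (ι → Bool) → Prop} (h : ∀ σ, p σ → q σ) : cubeProb p ≤ cubeProb q := by
  refine cubeAvg_mono fun σ => ?_
  by_cases hp : p σ
  · simp [hp, h σ hp]
  · simp only [hp, if_false]; split_ifs <;> norm_num

lemma cubeProb_or_le (p q : (ι → Bool) → Prop) :
    cubeProb (fun σ => p σ ∨ q σ) ≤ cubeProb p + cubeProb q := by
  unfold cubeProb
  rw [← cubeAvg_add]
  refine cubeAvg_mono fun σ => ?_
  by_cases hp : p σ <;> by_cases hq : q σ <;> simp [hp, hq]

lemma cubeProb_comp_not (p : (ι → Bool) → Prop) :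
    cubeProb (fun σ => p fun i => !σ i) = cubeProb p := by
  classical
  exact cubeAvg_comp_not fun σ => if p σ then (1 : ℝ) else 0

/-- Exponential Markov inequality on the hypercube. -/
lemma cubeProb_le_exp (g : (ι → Bool) → ℝ) (t : ℝ) :
    cubeProb (fun σ => t ≤ g σ) ≤ Real.exp (-t) * cubeAvg fun σ => Real.exp (g σ) := by
  rw [← cubeAvg_const_mul]
  refine cubeAvg_mono fun σ => ?_
  rw [← Real.exp_add]
  split_ifs with h
  · exact Real.one_le_exp (by linarith)
  · exact (Real.exp_pos _).le

lemma abs_rsign (b : Bool) : |rsign b| = 1 := by cases b <;> simp [rsign]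

lemma rsign_not (b : Bool) : rsign (!b) = -rsign b := by cases b <;> simp [rsign]

variable {J : Type*}

lemma bddAbove_range_sum {x : J → ι → ℝ} {B : ℝ} (hB : ∀ j k, |x j k| ≤ B) (S : Finset ι)
    (w : ι → ℝ) : BddAbove (Set.range fun j => ∑ k ∈ S, w k * x j k) := by
  refine ⟨∑ k ∈ S, |w k| * B, ?_⟩
  rintro _ ⟨j, rfl⟩
  refine Finset.sum_le_sum fun k _ => (le_abs_self _).trans ?_
  rw [abs_mul]
  exact mul_le_mul_of_nonneg_left (hB j k) (abs_nonneg _)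

/-- Supremum over the family `a` of the Rademacher sums with signs `σ`. -/
def radSup (a : J → ι → ℝ) (σ : ι → Bool) : ℝ := ⨆ j, ∑ k, rsign (σ k) * a j k

/-- Rademacher complexity (without normalization) of a family of vectors. -/
def rad (a : J → ι → ℝ) : ℝ := cubeAvg (radSup a)

lemma le_radSup {a : J → ι → ℝ} {B : ℝ} (hB : ∀ j k, |a j k| ≤ B) (σ : ι → Bool) (j : J) :
    ∑ k, rsign (σ k) * a j k ≤ radSup a σ :=
  le_ciSup (bddAbove_range_sum hB Finset.univ fun k => rsign (σ k)) j

variable [Nonempty J]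

/-- At a maximizer `j` for `σ`, flipping coordinate `i` lowers the sum by at most `2 |a j i|`, and
the same `j` serves all `i`. The supremum need not be attained, hence the near-maximizer and the
limit in `δ`. -/
lemma radSup_sub_flipAt_le {a : J → ι → ℝ} {B : ℝ} (hB : ∀ j k, |a j k| ≤ B) {v : ℝ}
    (hv : ∀ j, ∑ k, a j k ^ 2 ≤ v) (σ : ι → Bool) :
    ∑ i, max (radSup a σ - radSup a (flipAt i σ)) 0 ^ 2 ≤ 4 * v := by
  have hB0 : ∀ k : ι, 0 ≤ B := fun k => (abs_nonneg _).trans (hB (Classical.arbitrary J) k)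
  have key : ∀ δ : ℝ, 0 < δ → ∑ i, max (radSup a σ - radSup a (flipAt i σ)) 0 ^ 2 ≤
      4 * v + (Fintype.card ι : ℝ) * (δ ^ 2 + 4 * δ * B) := by
    intro δ hδ
    obtain ⟨j, hj⟩ := exists_lt_of_lt_ciSup (show radSup a σ - δ < radSup a σ by linarith)
    have h1 : ∀ i, max (radSup a σ - radSup a (flipAt i σ)) 0 ≤ δ + 2 * |a j i| := by
      intro i
      refine max_le ?_ (by positivity)
      have h2 := le_radSup hB (flipAt i σ) j
      have h3 : ∑ k, rsign (σ k) * a j k - ∑ k, rsign (flipAt i σ k) * a j k =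
          2 * (rsign (σ i) * a j i) := by
        rw [← Finset.sum_sub_distrib, Finset.sum_eq_single i]
        · simp [flipAt, rsign_not]; ring
        · intro k _ hk; simp [flipAt, Function.update_of_ne hk]
        · simp
      have h4 : rsign (σ i) * a j i ≤ |a j i| := by
        refine (le_abs_self _).trans ?_
        rw [abs_mul, abs_rsign, one_mul]
      linarith
    calc ∑ i, max (radSup a σ - radSup a (flipAt i σ)) 0 ^ 2
        ≤ ∑ i, (4 * a j i ^ 2 + (δ ^ 2 + 4 * δ * B)) := by
          refine Finset.sum_le_sum fun i _ => ?_
          have h5 := pow_le_pow_left₀ (le_max_right _ _) (h1 i) 2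
          have h6 := mul_le_mul_of_nonneg_left (hB j i) hδ.le
          nlinarith [sq_abs (a j i)]
      _ ≤ _ := by
          rw [Finset.sum_add_distrib, ← Finset.mul_sum, Finset.sum_const, nsmul_eq_mul,
            Finset.card_univ]
          linarith [hv j]
  have hlim : Tendsto (fun δ : ℝ => 4 * v + (Fintype.card ι : ℝ) * (δ ^ 2 + 4 * δ * B)) (𝓝[>] 0)
      (𝓝 (4 * v + (Fintype.card ι : ℝ) * (0 ^ 2 + 4 * 0 * B))) := by
    have hc : Continuous fun δ : ℝ => 4 * v + (Fintype.card ι : ℝ) * (δ ^ 2 + 4 * δ * B) := by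
      fun_prop
    exact (hc.tendsto 0).mono_left nhdsWithin_le_nhds
  have := ge_of_tendsto hlim (eventually_nhdsWithin_of_forall key)
  simpa using this

/-- Sub-Gaussian upper tail of a supremum of Rademacher sums. -/
lemma cubeProb_radSup_le {a : J → ι → ℝ} {B : ℝ} (hB : ∀ j k, |a j k| ≤ B) {v : ℝ} (hv0 : 0 < v)
    (hv : ∀ j, ∑ k, a j k ^ 2 ≤ v) {L t : ℝ} (ht : 0 < t) (hL : 8 * v * L ≤ t ^ 2) :
    cubeProb (fun σ => rad a + t ≤ radSup a σ) ≤ Real.exp (-L) := by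
  -- Minimizer of `-l t + 2 v l²`, with value `-t² / (8 v)`; the factor `2 v` is half of the
  -- variance proxy `4 v`.
  set l := t / (4 * v) with hl
  have hlpos : 0 < l := by positivity
  have hmgf : cubeAvg (fun σ => Real.exp (l * radSup a σ)) ≤
      Real.exp (l * cubeAvg (radSup a) + 2 * v * l ^ 2) := by
    refine cubeAvg_exp_le_of_cubeEnt (radSup a) hlpos fun s hs _ => ?_
    refine (cubeEnt_exp_le _).trans ?_
    rw [← cubeAvg_sum, ← cubeAvg_const_mul, ← cubeAvg_const_mul]
    refine cubeAvg_mono fun σ => ?_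
    have h1 : ∀ i, max (s * radSup a σ - s * radSup a (flipAt i σ)) 0 ^ 2 =
        s ^ 2 * max (radSup a σ - radSup a (flipAt i σ)) 0 ^ 2 := by
      intro i
      rw [← mul_sub, ← mul_pow, mul_max_of_nonneg _ _ hs.le, mul_zero]
    simp_rw [h1]
    rw [← Finset.sum_mul, ← Finset.mul_sum]
    have h2 := radSup_sub_flipAt_le hB hv σ
    have h3 : 0 < s ^ 2 * Real.exp (s * radSup a σ) := by positivity
    nlinarith
  have h := cubeProb_le_exp (fun σ => l * radSup a σ) (l * (rad a + t))
  have h1 : cubeProb (fun σ => rad a + t ≤ radSup a σ) ≤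
      cubeProb (fun σ => l * (rad a + t) ≤ l * radSup a σ) :=
    cubeProb_mono fun σ hσ => mul_le_mul_of_nonneg_left hσ hlpos.le
  refine (h1.trans h).trans ((mul_le_mul_of_nonneg_left hmgf (Real.exp_pos _).le).trans ?_)
  rw [← Real.exp_add, Real.exp_le_exp]
  have h4 : l * t - 2 * v * l ^ 2 = t ^ 2 / (8 * v) := by rw [hl]; field_simp; ring
  have h5 : L ≤ t ^ 2 / (8 * v) := by rw [le_div_iff₀ (by positivity)]; linarith
  unfold rad
  nlinarith

/-- Lower tail of a self-bounding function on the hypercube. -/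
lemma cubeProb_lt_half_le {V : (ι → Bool) → ℝ} {W : ι → (ι → Bool) → ℝ} {c : ℝ} (hc : 0 < c)
    (hW : ∀ i σ, W i (flipAt i σ) = W i σ) (hWV : ∀ i σ, W i σ ≤ V σ)
    (hVW : ∀ i σ, V σ - W i σ ≤ c) (hsum : ∀ σ, ∑ i, (V σ - W i σ) ≤ V σ) :
    cubeProb (fun σ => V σ ≤ cubeAvg V / 2) ≤ Real.exp (-(cubeAvg V / (23 * c))) := by
  have hV0 : ∀ σ, 0 ≤ V σ := fun σ =>
    (Finset.sum_nonneg fun i _ => sub_nonneg.2 (hWV i σ)).trans (hsum σ)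
  have hEV : 0 ≤ cubeAvg V := cubeAvg_nonneg hV0
  -- The constant `1.36` below is `e / 2` rounded up. With this `l` the exponent is the mean over
  -- `c` times `-1/12 + 1.36/36`, which is below `-1/23`.
  set l := 1 / (6 * c) with hl
  have hlpos : 0 < l := by positivity
  have hmgf : cubeAvg (fun σ => Real.exp (l * -V σ)) ≤
      Real.exp (l * cubeAvg (fun σ => -V σ) + (1.36 * c * cubeAvg V) * l ^ 2) := by
    refine cubeAvg_exp_le_of_cubeEnt (fun σ => -V σ) hlpos fun s hs hsl => ?_
    have hsc : s * c ≤ 1 := by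
      have : s * c ≤ l * c := mul_le_mul_of_nonneg_right hsl hc.le
      have h2 : l * c = 1 / 6 := by rw [hl]; field_simp
      linarith
    refine (cubeEnt_exp_le _).trans ?_
    have h1 : ∀ i, cubeAvg (fun σ => max (s * -V σ - s * -V (flipAt i σ)) 0 ^ 2 *
        Real.exp (s * -V σ)) ≤
        cubeAvg fun σ => s ^ 2 * c * Real.exp 1 * ((V σ - W i σ) * Real.exp (s * -V σ)) := by
      intro i
      -- After exchanging `σ` with its flip, the positive increment is bounded by `V σ - W i σ`,
      -- because `W i` ignores coordinate `i`. The price is a factor `exp (s c) ≤ e` in the weight.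
      rw [← cubeAvg_comp_flipAt i]
      refine cubeAvg_mono fun σ => ?_
      rw [flipAt_flipAt]
      have hfl : W i σ ≤ V (flipAt i σ) := (hW i σ) ▸ hWV i (flipAt i σ)
      have hd0 := sub_nonneg.2 (hWV i σ)
      have hm : max (s * -V (flipAt i σ) - s * -V σ) 0 ≤ s * (V σ - W i σ) := by
        refine max_le ?_ (by positivity)
        nlinarith
      have hm2 : max (s * -V (flipAt i σ) - s * -V σ) 0 ^ 2 ≤ s ^ 2 * c * (V σ - W i σ) := by
        refine (pow_le_pow_left₀ (le_max_right _ _) hm 2).trans ?_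
        have := mul_le_mul_of_nonneg_right (hVW i σ) hd0
        have hs2 : 0 < s ^ 2 := by positivity
        nlinarith
      have he : Real.exp (s * -V (flipAt i σ)) ≤ Real.exp 1 * Real.exp (s * -V σ) := by
        rw [← Real.exp_add, Real.exp_le_exp]
        have h3 : s * (V σ - V (flipAt i σ)) ≤ s * c :=
          mul_le_mul_of_nonneg_left (by linarith [hVW i σ]) hs.le
        linarith
      calc _ ≤ s ^ 2 * c * (V σ - W i σ) * (Real.exp 1 * Real.exp (s * -V σ)) :=
            mul_le_mul hm2 he (Real.exp_pos _).le (by positivity)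
        _ = _ := by ring
    have h2 : ∑ i, cubeAvg (fun σ => max (s * -V σ - s * -V (flipAt i σ)) 0 ^ 2 *
        Real.exp (s * -V σ)) ≤
        s ^ 2 * c * Real.exp 1 * cubeAvg fun σ => V σ * Real.exp (s * -V σ) := by
      refine (Finset.sum_le_sum fun i _ => h1 i).trans ?_
      rw [← cubeAvg_sum, ← cubeAvg_const_mul]
      refine cubeAvg_mono fun σ => ?_
      rw [← Finset.mul_sum, ← Finset.sum_mul]
      have := mul_le_mul_of_nonneg_right (hsum σ) (Real.exp_pos (s * -V σ)).le
      exact mul_le_mul_of_nonneg_left this (by positivity)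
    have h3 : cubeAvg (fun σ => V σ * Real.exp (s * -V σ)) ≤
        cubeAvg V * cubeAvg fun σ => Real.exp (s * -V σ) := by
      -- Chebyshev's association inequality: `V` and `exp (-s V)` are oppositely ordered, hence
      -- negatively correlated.
      have hav : Antivary V fun σ => Real.exp (s * -V σ) := by
        intro σ τ h
        rw [Real.exp_lt_exp] at h
        nlinarith
      have h4 := hav.card_mul_sum_le_sum_mul_sum
      unfold cubeAvg
      have hp := cubeCard_pos (ι := ι)
      rw [div_mul_div_comm, div_le_div_iff₀ hp (by positivity)]
      nlinarith
    have he := Real.exp_one_lt_d9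
    have hM : 0 < cubeAvg fun σ => Real.exp (s * -V σ) := cubeAvg_pos fun _ => Real.exp_pos _
    have h5 := mul_le_mul_of_nonneg_left h3 (by positivity : 0 ≤ s ^ 2 * c * Real.exp 1)
    have h6 : 0 ≤ s ^ 2 * c * (cubeAvg V * cubeAvg fun σ => Real.exp (s * -V σ)) := by positivity
    nlinarith
  have h := cubeProb_le_exp (fun σ => l * -V σ) (l * -(cubeAvg V / 2))
  have h1 : cubeProb (fun σ => V σ ≤ cubeAvg V / 2) ≤
      cubeProb (fun σ => l * -(cubeAvg V / 2) ≤ l * -V σ) :=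
    cubeProb_mono fun σ hσ => mul_le_mul_of_nonneg_left (by linarith) hlpos.le
  refine (h1.trans h).trans ((mul_le_mul_of_nonneg_left hmgf (Real.exp_pos _).le).trans ?_)
  rw [← Real.exp_add, Real.exp_le_exp]
  have hneg : cubeAvg (fun σ => -V σ) = -cubeAvg V := by
    have := cubeAvg_const_mul (-1) V
    simpa using this
  rw [hneg]
  have h7 : -(l * -(cubeAvg V / 2)) + (l * -cubeAvg V + 1.36 * c * cubeAvg V * l ^ 2) =
      (cubeAvg V / c) * (-1 / 12 + 1.36 / 36) := by
    rw [hl]; field_simp; ring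
  have h8 : cubeAvg V / (23 * c) = cubeAvg V / c * (1 / 23) := by field_simp
  have h9 : 0 ≤ cubeAvg V / c := by positivity
  rw [h7, h8]
  nlinarith

/-- Contraction in one coordinate, after averaging its sign. For indices `j` and `j'` taken in the
two suprema, `q j - q j'` is at most `|p j - p j'|`; according to the sign of `p j - p j'`, use `j`
and `j'` on the right in this order or exchanged. -/
lemma ciSup_add_le_of_flip {u p q : J → ℝ} (hp : BddAbove (Set.range fun j => u j + p j))
    (hm : BddAbove (Set.range fun j => u j - p j)) (hpq : ∀ j j', |q j - q j'| ≤ |p j - p j'|) :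
    (⨆ j, (u j + q j)) + (⨆ j, (u j - q j)) ≤ (⨆ j, (u j + p j)) + ⨆ j, (u j - p j) := by
  have key : ∀ j j', (u j + q j) + (u j' - q j') ≤ (⨆ j, (u j + p j)) + ⨆ j, (u j - p j) := by
    intro j j'
    have h1 := le_ciSup hp j
    have h2 := le_ciSup hm j'
    have h3 := le_ciSup hp j'
    have h4 := le_ciSup hm j
    have h5 := (le_abs_self _).trans (hpq j j')
    rcases abs_cases (p j - p j') with h | h <;> linarith
  have h1 : ∀ j', (⨆ j, (u j + q j)) ≤
      (⨆ j, (u j + p j)) + (⨆ j, (u j - p j)) - (u j' - q j') :=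
    fun j' => ciSup_le fun j => by linarith [key j j']
  have h2 : (⨆ j, (u j - q j)) ≤
      (⨆ j, (u j + p j)) + (⨆ j, (u j - p j)) - ⨆ j, (u j + q j) :=
    ciSup_le fun j' => by linarith [h1 j']
  linarith

/-- Contraction principle for Rademacher sums. -/
lemma rad_le_rad_of_lipschitz {a b : J → ι → ℝ} {B : ℝ} (ha : ∀ j k, |a j k| ≤ B)
    (hb : ∀ j k, |b j k| ≤ B) (hab : ∀ j j' k, |b j k - b j' k| ≤ |a j k - a j' k|) :
    rad b ≤ rad a := by
  -- The coordinates of `a` are replaced by those of `b` one at a time; at each stage the signs are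
  -- grouped in pairs differing only at the replaced coordinate.
  have key : ∀ S : Finset ι, rad (fun j k => if k ∈ S then b j k else a j k) ≤ rad a := by
    intro S
    induction S using Finset.induction_on with
    | empty => simp
    | insert i S hi ih =>
      refine le_trans ?_ ih
      set x : J → ι → ℝ := fun j k => if k ∈ S then b j k else a j k with hx
      set y : J → ι → ℝ := fun j k => if k ∈ insert i S then b j k else a j k with hy
      have hxB : ∀ j k, |x j k| ≤ B := fun j k => by simp only [hx]; split_ifs <;> simp [ha, hb]
      have hsplit : ∀ (z : J → ι → ℝ) (σ : ι → Bool) j, ∑ k, rsign (σ k) * z j k =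
          (∑ k ∈ Finset.univ.erase i, rsign (σ k) * z j k) + rsign (σ i) * z j i := fun z σ j =>
        (Finset.sum_erase_add _ _ (Finset.mem_univ i)).symm
      have hflip : ∀ (z : J → ι → ℝ) (σ : ι → Bool) j, ∑ k, rsign (flipAt i σ k) * z j k =
          (∑ k ∈ Finset.univ.erase i, rsign (σ k) * z j k) - rsign (σ i) * z j i := by
        intro z σ j
        rw [hsplit]
        have : ∀ k ∈ Finset.univ.erase i, rsign (flipAt i σ k) * z j k = rsign (σ k) * z j k := by
          intro k hk
          rw [flipAt, Function.update_of_ne (Finset.ne_of_mem_erase hk)]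
        rw [Finset.sum_congr rfl this]
        simp [flipAt, rsign_not]; ring
      have hpair : ∀ σ, radSup y σ + radSup y (flipAt i σ) ≤ radSup x σ + radSup x (flipAt i σ) := by
        intro σ
        have hb1 := bddAbove_range_sum hxB Finset.univ fun k => rsign (σ k)
        have hb2 := bddAbove_range_sum hxB Finset.univ fun k => rsign (flipAt i σ k)
        simp only [hsplit x] at hb1
        simp only [hflip x] at hb2
        have hxi : ∀ j, x j i = a j i := fun j => by simp [hx, hi]
        have hyi : ∀ j, y j i = b j i := fun j => by simp [hy]
        have hxy : ∀ j, ∑ k ∈ Finset.univ.erase i, rsign (σ k) * y j k =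
            ∑ k ∈ Finset.univ.erase i, rsign (σ k) * x j k := fun j =>
          Finset.sum_congr rfl fun k hk => by
            simp [hx, hy, Finset.mem_insert, Finset.ne_of_mem_erase hk]
        have h := ciSup_add_le_of_flip (q := fun j => rsign (σ i) * y j i) hb1 hb2
          (fun j j' => by
            rw [← mul_sub, ← mul_sub, abs_mul, abs_mul, hxi, hxi, hyi, hyi]
            exact mul_le_mul_of_nonneg_left (hab j j' i) (abs_nonneg _))
        unfold radSup
        simp only [hflip]
        simp only [hsplit, hxy]
        exact h
      have h := cubeAvg_mono hpair
      rw [cubeAvg_add, cubeAvg_add, cubeAvg_comp_flipAt, cubeAvg_comp_flipAt] at h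
      unfold rad
      linarith
  simpa using key Finset.univ

/-- Deleting one coordinate does not increase the Rademacher complexity. -/
lemma rad_erase_le {a : J → ι → ℝ} {B : ℝ} (ha : ∀ j k, |a j k| ≤ B) (i : ι) :
    rad (fun j k => if k = i then 0 else a j k) ≤ rad a := by
  refine rad_le_rad_of_lipschitz ha (fun j k => ?_) fun j j' k => ?_
  · split_ifs
    · simpa using (abs_nonneg _).trans (ha j k)
    · exact ha j k
  · split_ifs
    · simp
    · exact le_rfl

lemma radSup_add_le {a b : J → ι → ℝ} {B : ℝ} (ha : ∀ j k, |a j k| ≤ B) (hb : ∀ j k, |b j k| ≤ B)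
    (σ : ι → Bool) : radSup (fun j k => a j k + b j k) σ ≤ radSup a σ + radSup b σ := by
  refine ciSup_le fun j => ?_
  simp_rw [mul_add, Finset.sum_add_distrib]
  exact add_le_add (le_radSup ha σ j) (le_radSup hb σ j)

lemma rad_neg (a : J → ι → ℝ) : rad (fun j k => -a j k) = rad a := by
  unfold rad
  rw [← cubeAvg_comp_not (radSup a)]
  congr 1
  funext σ
  simp [radSup, rsign_not]

/-- The supremum of sums is self-bounding under deletion of coordinates. -/
lemma sum_radSup_sub_erase_le {a : J → ι → ℝ} {B : ℝ} (ha : ∀ j k, |a j k| ≤ B) (σ : ι → Bool) :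
    ∑ i, (radSup a σ - radSup (fun j k => if k = i then 0 else a j k) σ) ≤ radSup a σ := by
  have key : ∀ δ : ℝ, 0 < δ →
      ∑ i, (radSup a σ - radSup (fun j k => if k = i then 0 else a j k) σ) ≤
        radSup a σ + (Fintype.card ι : ℝ) * δ := by
    intro δ hδ
    obtain ⟨j, hj⟩ := exists_lt_of_lt_ciSup (show radSup a σ - δ < radSup a σ by linarith)
    have h1 : ∀ i, radSup a σ - radSup (fun j k => if k = i then 0 else a j k) σ ≤
        rsign (σ i) * a j i + δ := by
      intro i
      have hB' : ∀ j k, |(fun j k => if k = i then 0 else a j k) j k| ≤ B := fun j k => by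
        simp only
        split_ifs
        · simpa using (abs_nonneg _).trans (ha j k)
        · exact ha j k
      have h2 := le_radSup hB' σ j
      have h3 : ∑ k, rsign (σ k) * a j k =
          ∑ k, rsign (σ k) * (if k = i then 0 else a j k) + rsign (σ i) * a j i := by
        rw [← sub_eq_iff_eq_add', ← Finset.sum_sub_distrib, Finset.sum_eq_single i]
        · simp
        · intro k _ hk; simp [hk]
        · simp
      linarith
    refine (Finset.sum_le_sum fun i _ => h1 i).trans ?_
    rw [Finset.sum_add_distrib, Finset.sum_const, nsmul_eq_mul, Finset.card_univ]
    linarith [le_radSup ha σ j]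
  have hlim : Tendsto (fun δ : ℝ => radSup a σ + (Fintype.card ι : ℝ) * δ) (𝓝[>] 0)
      (𝓝 (radSup a σ + (Fintype.card ι : ℝ) * 0)) := by
    have hc : Continuous fun δ : ℝ => radSup a σ + (Fintype.card ι : ℝ) * δ := by fun_prop
    exact (hc.tendsto 0).mono_left nhdsWithin_le_nhds
  have := ge_of_tendsto hlim (eventually_nhdsWithin_of_forall key)
  simpa using this

/-- The Rademacher complexity of a random selection, one entry out of each pair, is rarely less than
half of its mean. -/
lemma cubeProb_rad_select_le {p : J → ι → Bool → ℝ} {c : ℝ} (hc : 0 < c)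
    (hp : ∀ j i b, |p j i b| ≤ c) :
    cubeProb (fun σ : ι → Bool => rad (fun j i => p j i (σ i)) ≤
        cubeAvg (fun σ : ι → Bool => rad fun j i => p j i (σ i)) / 2) ≤
      Real.exp (-(cubeAvg (fun σ : ι → Bool => rad fun j i => p j i (σ i)) / (23 * c))) := by
  -- The comparison function `W i` deletes coordinate `i`, so it does not see `σ i`. Deletion lowers
  -- the complexity by contraction, costs at most `c`, and the total cost is self-bounded.
  refine cubeProb_lt_half_le
    (W := fun i σ => rad fun j k => if k = i then 0 else p j k (σ k)) hc ?_ ?_ ?_ ?_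
  · intro i σ
    congr 1
    funext j k
    by_cases hk : k = i
    · simp [hk]
    · simp [hk, flipAt]
  · intro i σ
    exact rad_erase_le (fun j k => hp j k (σ k)) i
  · intro i σ
    rw [rad, rad, ← cubeAvg_sub, ← cubeAvg_const (ι := ι) c]
    refine cubeAvg_mono fun ε => ?_
    have hB' : ∀ j k, |(fun j k => if k = i then 0 else p j k (σ k)) j k| ≤ c := fun j k => by
      simp only
      split_ifs
      · simpa using hc.le
      · exact hp _ _ _
    rw [sub_le_iff_le_add]
    refine ciSup_le fun j => ?_
    have h2 := le_radSup hB' ε j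
    have h3 : ∑ k, rsign (ε k) * p j k (σ k) =
        ∑ k, rsign (ε k) * (if k = i then 0 else p j k (σ k)) + rsign (ε i) * p j i (σ i) := by
      rw [← sub_eq_iff_eq_add', ← Finset.sum_sub_distrib, Finset.sum_eq_single i]
      · simp
      · intro k _ hk; simp [hk]
      · simp
    have h4 : rsign (ε i) * p j i (σ i) ≤ c := by
      refine (le_abs_self _).trans ?_
      rw [abs_mul, abs_rsign, one_mul]
      exact hp _ _ _
    linarith
  · intro σ
    simp only [rad]
    simp_rw [← cubeAvg_sub]
    rw [← cubeAvg_sum]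
    exact cubeAvg_mono fun ε => sum_radSup_sub_erase_le (fun j k => hp j k (σ k)) ε

end Rademacher

/-! ### Marginals of uniform signs. -/

section Marginal

lemma cubeAvg_comp_subtype {κ : Type*} [Fintype κ] [DecidableEq κ] (p : κ → Prop)
    [DecidablePred p] [Fintype {x // p x}] (G : ({x // p x} → Bool) → ℝ) :
    cubeAvg (fun ε : κ → Bool => G fun i => ε i) = cubeAvg G := by
  classical
  let e := Equiv.piEquivPiSubtypeProd p fun _ => Bool
  have h1 : ∑ ε : κ → Bool, G (fun i => ε i) = ∑ x, G (e x).1 := rfl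
  unfold cubeAvg
  rw [h1, Equiv.sum_comp e fun y => G y.1, Fintype.sum_prod_type]
  simp only [Finset.sum_const, Finset.card_univ, nsmul_eq_mul]
  rw [Fintype.card_congr e, Fintype.card_prod, Nat.cast_mul, ← Finset.mul_sum]
  have h2 : (0 : ℝ) < Fintype.card ({x // ¬p x} → Bool) := cubeCard_pos
  have h3 : (0 : ℝ) < Fintype.card ({x // p x} → Bool) := cubeCard_pos
  field_simp

/-- The restriction of uniform signs along an injective map is again a family of uniform signs. -/
lemma cubeAvg_comp_injective {ι κ : Type*} [Fintype ι] [DecidableEq ι] [Fintype κ] [DecidableEq κ]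
    {e : ι → κ} (he : Function.Injective e) (G : (ι → Bool) → ℝ) :
    cubeAvg (fun ε : κ → Bool => G fun i => ε (e i)) = cubeAvg G := by
  classical
  let E : ι ≃ {x // x ∈ Set.range e} := Equiv.ofInjective e he
  let F : ({x // x ∈ Set.range e} → Bool) ≃ (ι → Bool) := Equiv.arrowCongr E.symm (Equiv.refl _)
  exact Eq.trans rfl ((cubeAvg_comp_subtype (fun x => x ∈ Set.range e) fun y => G (F y)).trans
    (cubeAvg_equiv F G))

end Marginal

/-! ### Paired samples: clipping to a ball, random selections, deviations between the two halves. -/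

section Pairs

variable {ι : Type*} [Fintype ι] [DecidableEq ι] {J : Type*}

set_option linter.unusedSectionVars false

lemma rad_comp_equiv {κ : Type*} [Fintype κ] [DecidableEq κ] (e : ι ≃ κ) (a : J → κ → ℝ) :
    rad (fun j i => a j (e i)) = rad a := by
  unfold rad
  rw [← cubeAvg_comp_injective e.injective]
  congr 1
  funext ε
  unfold radSup
  congr 1
  funext j
  exact Equiv.sum_comp e fun k => rsign (ε k) * a j k

lemma rad_const_mul (a : J → ι → ℝ) {s : ℝ} (hs : 0 ≤ s) :
    rad (fun j k => s * a j k) = s * rad a := by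
  unfold rad
  rw [← cubeAvg_const_mul]
  congr 1
  funext σ
  unfold radSup
  rw [Real.mul_iSup_of_nonneg hs]
  congr 1
  funext j
  rw [Finset.mul_sum]
  exact Finset.sum_congr rfl fun k _ => by ring

variable [Nonempty J]

/-- The zero vector makes the supremum nonnegative, so shrinking each member by its own factor in
`[0, 1]` cannot raise it. -/
lemma radSup_mono_of_zero {a b : J → ι → ℝ} {B : ℝ} (ha : ∀ j k, |a j k| ≤ B) {j₀ : J}
    (h0 : ∀ k, a j₀ k = 0) {t : J → ℝ} (ht0 : ∀ j, 0 ≤ t j) (ht1 : ∀ j, t j ≤ 1)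
    (hb : ∀ j k, b j k = t j * a j k) (σ : ι → Bool) : radSup b σ ≤ radSup a σ := by
  have hz : 0 ≤ radSup a σ := by
    have := le_radSup ha σ j₀
    simpa [h0] using this
  refine ciSup_le fun j => ?_
  have h1 : ∑ k, rsign (σ k) * b j k = t j * ∑ k, rsign (σ k) * a j k := by
    rw [Finset.mul_sum]
    exact Finset.sum_congr rfl fun k _ => by rw [hb]; ring
  rw [h1]
  have h2 := mul_le_mul_of_nonneg_left (le_radSup ha σ j) (ht0 j)
  have h3 := mul_le_mul_of_nonneg_right (ht1 j) hz
  linarith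

lemma rad_add_le {a b : J → ι → ℝ} {B : ℝ} (ha : ∀ j k, |a j k| ≤ B) (hb : ∀ j k, |b j k| ≤ B) :
    rad (fun j k => a j k + b j k) ≤ rad a + rad b := by
  unfold rad
  rw [← cubeAvg_add]
  exact cubeAvg_mono (radSup_add_le ha hb)

lemma rad_sub_le {a b : J → ι → ℝ} {B : ℝ} (ha : ∀ j k, |a j k| ≤ B) (hb : ∀ j k, |b j k| ≤ B) :
    rad (fun j k => a j k - b j k) ≤ rad a + rad b := by
  rw [← rad_neg b]
  simp_rw [sub_eq_add_neg]
  exact rad_add_le ha fun j k => by rw [abs_neg]; exact hb j k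

/-- The Rademacher complexity of a family of paired vectors. -/
def pairRad (q : J → ι → Bool → ℝ) : ℝ := rad fun (j : J) (k : ι × Bool) => q j k.1 k.2

/-- Writing a selection as the paired family with the unselected labels set to zero puts both
complexities on the same space of signs, where contraction and subadditivity compare them. -/
lemma rad_mask_select (q : J → ι → Bool → ℝ) (σ : ι → Bool) :
    rad (fun (j : J) (k : ι × Bool) => if k.2 = σ k.1 then q j k.1 k.2 else 0) =
      rad fun j i => q j i (σ i) := by
  unfold rad
  have he : Function.Injective fun i : ι => (i, σ i) := fun i i' h => (Prod.mk.inj h).1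
  rw [← cubeAvg_comp_injective he]
  congr 1
  funext ε
  unfold radSup
  congr 1
  funext j
  rw [Fintype.sum_prod_type]
  refine Finset.sum_congr rfl fun i _ => ?_
  simp

lemma rad_select_le_pairRad {q : J → ι → Bool → ℝ} {c : ℝ} (hq : ∀ j i b, |q j i b| ≤ c)
    (σ : ι → Bool) : rad (fun j i => q j i (σ i)) ≤ pairRad q := by
  rw [← rad_mask_select]
  refine rad_le_rad_of_lipschitz (B := c) (fun j k => hq j k.1 k.2) (fun j k => ?_) fun j j' k => ?_
  · split_ifs
    · exact hq _ _ _
    · simpa using (abs_nonneg _).trans (hq j k.1 k.2)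
  · split_ifs
    · exact le_rfl
    · simp

lemma pairRad_le_select {q : J → ι → Bool → ℝ} {c : ℝ} (hq : ∀ j i b, |q j i b| ≤ c)
    (σ : ι → Bool) :
    pairRad q ≤ rad (fun j i => q j i (σ i)) + rad fun j i => q j i (!σ i) := by
  rw [← rad_mask_select q σ, ← rad_mask_select q fun i => !σ i]
  refine le_trans (le_of_eq ?_) (rad_add_le (B := c) (fun j k => ?_) fun j k => ?_)
  · unfold pairRad
    congr 1
    funext j k
    cases h : σ k.1 <;> cases h' : k.2 <;> simp
  all_goals
    split_ifs
    · exact hq _ _ _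
    · simpa using (abs_nonneg _).trans (hq j k.1 k.2)

/-- A pair splits into a selection and the complementary one, and the two have the same law under
uniform `σ`. -/
lemma pairRad_le_two_mul_cubeAvg {q : J → ι → Bool → ℝ} {c : ℝ} (hq : ∀ j i b, |q j i b| ≤ c) :
    pairRad q ≤ 2 * cubeAvg fun σ : ι → Bool => rad fun j i => q j i (σ i) := by
  have h := cubeAvg_mono (pairRad_le_select hq)
  rw [cubeAvg_const, cubeAvg_add,
    cubeAvg_comp_not fun σ : ι → Bool => rad fun j i => q j i (σ i)] at h
  linarith

/-- Euclidean norm of a paired vector. -/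
def pairNorm (p : ι → Bool → ℝ) : ℝ := Real.sqrt (∑ i, (p i true ^ 2 + p i false ^ 2))

lemma pairNorm_nonneg (p : ι → Bool → ℝ) : 0 ≤ pairNorm p := Real.sqrt_nonneg _

lemma pairNorm_sq (p : ι → Bool → ℝ) : pairNorm p ^ 2 = ∑ i, (p i true ^ 2 + p i false ^ 2) :=
  Real.sq_sqrt (Finset.sum_nonneg fun _ _ => by positivity)

/-- The family `p` radially projected on the ball of radius `ρ`. -/
def clip (ρ : ℝ) (p : J → ι → Bool → ℝ) (j : J) (i : ι) (b : Bool) : ℝ :=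
  ρ / max ρ (pairNorm (p j)) * p j i b

lemma clip_weight {ρ : ℝ} (hρ : 0 < ρ) (p : ι → Bool → ℝ) :
    0 < ρ / max ρ (pairNorm p) ∧ ρ / max ρ (pairNorm p) ≤ 1 ∧
      ρ / max ρ (pairNorm p) * pairNorm p ≤ ρ := by
  have hm : 0 < max ρ (pairNorm p) := lt_max_of_lt_left hρ
  refine ⟨div_pos hρ hm, (div_le_one hm).2 (le_max_left _ _), ?_⟩
  rw [div_mul_eq_mul_div, div_le_iff₀ hm]
  exact mul_le_mul_of_nonneg_left (le_max_right _ _) hρ.le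

lemma abs_clip_le {ρ c : ℝ} (hρ : 0 < ρ) {p : J → ι → Bool → ℝ} (hp : ∀ j i b, |p j i b| ≤ c)
    (j : J) (i : ι) (b : Bool) : |clip ρ p j i b| ≤ c := by
  obtain ⟨h0, h1, -⟩ := clip_weight hρ (p j)
  rw [clip, abs_mul, abs_of_pos h0]
  exact (mul_le_of_le_one_left (abs_nonneg _) h1).trans (hp j i b)

lemma sum_clip_sq_le {ρ : ℝ} (hρ : 0 < ρ) (p : J → ι → Bool → ℝ) (j : J) :
    ∑ i, (clip ρ p j i true ^ 2 + clip ρ p j i false ^ 2) ≤ ρ ^ 2 := by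
  obtain ⟨h0, -, h2⟩ := clip_weight hρ (p j)
  have : ∑ i, (clip ρ p j i true ^ 2 + clip ρ p j i false ^ 2) =
      (ρ / max ρ (pairNorm (p j)) * pairNorm (p j)) ^ 2 := by
    rw [mul_pow, pairNorm_sq, Finset.mul_sum]
    exact Finset.sum_congr rfl fun i _ => by simp only [clip]; ring
  rw [this]
  exact pow_le_pow_left₀ (mul_nonneg h0.le (pairNorm_nonneg _)) h2 2

/-- Clipping at `A ρ` is `A` times clipping at `ρ`, up to a factor at most one. So the complexity
grows at most linearly in the radius, whereas the admissible deviation grows quadratically. -/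
lemma pairRad_clip_scale_le {ρ c A : ℝ} (hρ : 0 < ρ) (hA : 1 ≤ A) {p : J → ι → Bool → ℝ}
    (hp : ∀ j i b, |p j i b| ≤ c) {j₀ : J} (h0 : ∀ i b, p j₀ i b = 0) :
    pairRad (clip (A * ρ) p) ≤ A * pairRad (clip ρ p) := by
  unfold pairRad
  rw [← rad_const_mul _ (by linarith)]
  have hA0 : 0 < A := by linarith
  refine cubeAvg_mono fun σ => radSup_mono_of_zero (B := A * c) (j₀ := j₀)
    (t := fun j => max ρ (pairNorm (p j)) / max (A * ρ) (pairNorm (p j))) ?_ ?_ ?_ ?_ ?_ σ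
  · intro j k
    rw [abs_mul, abs_of_pos hA0]
    exact mul_le_mul_of_nonneg_left (abs_clip_le hρ hp _ _ _) hA0.le
  · intro k; simp [clip, h0]
  · intro j
    have : 0 < max ρ (pairNorm (p j)) := lt_max_of_lt_left hρ
    have : 0 < max (A * ρ) (pairNorm (p j)) := lt_max_of_lt_left (by positivity)
    positivity
  · intro j
    have : 0 < max (A * ρ) (pairNorm (p j)) := lt_max_of_lt_left (by positivity)
    rw [div_le_one this]
    exact max_le_max (by nlinarith) le_rfl
  · intro j k
    have h1 : 0 < max ρ (pairNorm (p j)) := lt_max_of_lt_left hρ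
    have h2 : 0 < max (A * ρ) (pairNorm (p j)) := lt_max_of_lt_left (by positivity)
    simp only [clip]
    field_simp

/-- If the complexity of the pairs is large at radius `ρ`, so is that of most random selections. -/
lemma cubeProb_rad_select_clip_le {ρ c : ℝ} (hρ : 0 < ρ) (hc : 0 < c) {p : J → ι → Bool → ℝ}
    (hp : ∀ j i b, |p j i b| ≤ c) (hV : 5 * ρ ^ 2 / c ≤ pairRad (clip ρ p)) {L : ℝ}
    (hL : 10 * c ^ 2 * L ≤ ρ ^ 2) :
    cubeProb (fun σ : ι → Bool => rad (fun j i => clip ρ p j i (σ i)) ≤ 5 / 4 * (ρ ^ 2 / c)) ≤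
      Real.exp (-L) := by
  have hq : ∀ j i b, |clip ρ p j i b| ≤ c := abs_clip_le hρ hp
  have h1 := pairRad_le_two_mul_cubeAvg hq
  have h2 := cubeProb_rad_select_le hc hq
  have h3 : 5 * ρ ^ 2 / c = 5 * (ρ ^ 2 / c) := by ring
  -- The mean over selections is at least half of `5 ρ² / c`, and half of that mean is the threshold
  -- `5/4 ρ² / c`. The exponent is at least `(5/2) ρ² / (23 c²)`, which the condition `10 c² L ≤ ρ²`
  -- makes at least `L`.
  refine (cubeProb_mono fun σ hσ => ?_).trans (h2.trans ?_)
  · linarith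
  · rw [Real.exp_le_exp, neg_le_neg_iff, le_div_iff₀ (by positivity)]
    have h4 : 10 * c * L ≤ ρ ^ 2 / c := by rw [le_div_iff₀ hc]; nlinarith
    have h5 : 0 ≤ ρ ^ 2 / c := by positivity
    nlinarith

/-- Negating all signs preserves their law and reverses the sums, so two-sided control costs twice
the upper tail. -/
lemma cubeProb_abs_le {a : J → ι → ℝ} {B : ℝ} (hB : ∀ j k, |a j k| ≤ B) {v : ℝ} (hv0 : 0 < v)
    (hv : ∀ j, ∑ k, a j k ^ 2 ≤ v) {L t D : ℝ} (ht : 0 < t) (hL : 8 * v * L ≤ t ^ 2)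
    (hD : rad a + t ≤ D) :
    cubeProb (fun σ => ∃ j, D < |∑ k, rsign (σ k) * a j k|) ≤ 2 * Real.exp (-L) := by
  have h1 := cubeProb_radSup_le hB hv0 hv ht hL
  have h2 : cubeProb (fun σ => rad a + t ≤ radSup a fun i => !σ i) ≤ Real.exp (-L) := by
    rw [cubeProb_comp_not fun σ => rad a + t ≤ radSup a σ]; exact h1
  have h3 := cubeProb_or_le (fun σ => rad a + t ≤ radSup a σ)
    (fun σ => rad a + t ≤ radSup a fun i => !σ i)
  refine (cubeProb_mono ?_).trans (h3.trans (by linarith))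
  rintro σ ⟨j, hj⟩
  rcases lt_abs.1 hj with h | h
  · left
    linarith [le_radSup hB σ j]
  · right
    have h4 := le_radSup hB (fun i => !σ i) j
    have h5 : ∑ k, rsign (!σ k) * a j k = -∑ k, rsign (σ k) * a j k := by
      rw [← Finset.sum_neg_distrib]
      exact Finset.sum_congr rfl fun k _ => by rw [rsign_not]; ring
    linarith

/-- Two-sample deviations: at a radius where the complexity of the pairs is small, the sums over the
two halves of a random splitting of the pairs are uniformly close. -/
lemma cubeProb_split_deviation_le {ρ c L : ℝ} (hρ : 0 < ρ) (hc : 1 ≤ c) {p : J → ι → Bool → ℝ}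
    (hp : ∀ j i b, |p j i b| ≤ c) {j₀ : J} (h0 : ∀ i b, p j₀ i b = 0)
    (hV : pairRad (clip ρ p) ≤ 5 * ρ ^ 2 / c) (hL : 10 * c ^ 2 * L ≤ ρ ^ 2) :
    cubeProb (fun σ : ι → Bool => ∃ j,
        1 / 14 * (168 * ρ * max (168 * ρ) (pairNorm (p j))) <
          |∑ i, (p j i (σ i) - p j i (!σ i))| ∨
        1 / 8 * max (168 * ρ) (pairNorm (p j)) ^ 2 <
          |∑ i, (p j i (σ i) ^ 2 - p j i (!σ i) ^ 2)|) ≤ 4 * Real.exp (-L) := by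
  have hc0 : 0 < c := by linarith
  -- At radius `168 ρ` linear growth bounds the complexity by `840 ρ² / c`. The factor `168` makes
  -- both thresholds exact: `R² / 14 = (2 · 840 + 336) ρ²` for the sums and `R² / 8 = (4 · 840 +
  -- 168) ρ²` for the squares, the last terms being the deviations `t`.
  set R := 168 * ρ with hR
  have hRpos : 0 < R := by positivity
  set q := clip R p with hq
  have hqc : ∀ j i b, |q j i b| ≤ c := abs_clip_le hRpos hp
  have hVR : pairRad q ≤ 840 * (ρ ^ 2 / c) := by
    have := pairRad_clip_scale_le hρ (by norm_num : (1 : ℝ) ≤ 168) hp h0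
    have h3 : 5 * ρ ^ 2 / c = 5 * (ρ ^ 2 / c) := by ring
    linarith
  have hρc : ρ ^ 2 / c ≤ ρ ^ 2 := div_le_self (by positivity) hc
  have ht := rad_select_le_pairRad hqc fun _ => true
  have hf := rad_select_le_pairRad hqc fun _ => false
  have hL' : 10 * L ≤ ρ ^ 2 := by
    rcases le_total 0 L with h | h
    · nlinarith [mul_le_mul_of_nonneg_right (by nlinarith : 1 ≤ c ^ 2) h]
    · nlinarith [sq_nonneg ρ]
  have hsq : ∀ j, ∑ i, (q j i true ^ 2 + q j i false ^ 2) ≤ R ^ 2 := sum_clip_sq_le hRpos p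
  have hm : ∀ j, 0 < max R (pairNorm (p j)) := fun j => lt_max_of_lt_left hRpos
  have h1 : cubeProb (fun σ => ∃ j, 1 / 14 * R ^ 2 <
      |∑ i, rsign (σ i) * (q j i true - q j i false)|) ≤ 2 * Real.exp (-L) := by
    refine cubeProb_abs_le (B := 2 * c) (v := 2 * R ^ 2) (t := 336 * ρ ^ 2) ?_ (by positivity) ?_
      (by positivity) ?_ ?_
    · intro j i
      exact (abs_sub _ _).trans (by linarith [hqc j i true, hqc j i false])
    · intro j
      refine le_trans ?_ (mul_le_mul_of_nonneg_left (hsq j) (by norm_num))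
      rw [Finset.mul_sum]
      exact Finset.sum_le_sum fun i _ => by nlinarith [sq_nonneg (q j i true + q j i false)]
    · rw [hR]
      nlinarith [mul_le_mul_of_nonneg_left hL' (by positivity : 0 ≤ ρ ^ 2), pow_pos hρ 4]
    · have := rad_sub_le (fun j i => hqc j i true) fun j i => hqc j i false
      rw [hR]
      nlinarith
  have h2 : cubeProb (fun σ => ∃ j, 1 / 8 * R ^ 2 <
      |∑ i, rsign (σ i) * (q j i true ^ 2 - q j i false ^ 2)|) ≤ 2 * Real.exp (-L) := by
    have hsqc : ∀ j i b, q j i b ^ 2 ≤ c ^ 2 := fun j i b => sq_le_sq' (by linarith [abs_le.1 (hqc j i b)]) (abs_le.1 (hqc j i b)).2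
    -- Contraction applies because `x ↦ x² / (2 c)` is `1`-Lipschitz on `[-c, c]`.
    have hcontr : ∀ b, rad (fun j i => q j i b ^ 2) ≤ 2 * c * rad fun j i => q j i b := by
      intro b
      have h3 : rad (fun j i => q j i b ^ 2) = 2 * c * rad fun j i => q j i b ^ 2 / (2 * c) := by
        rw [← rad_const_mul _ (by positivity)]
        congr 1
        funext j i
        field_simp
      rw [h3]
      refine mul_le_mul_of_nonneg_left ?_ (by positivity)
      refine rad_le_rad_of_lipschitz (B := c) (fun j i => hqc j i b) (fun j i => ?_) fun j j' i => ?_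
      · rw [abs_of_nonneg (by positivity), div_le_iff₀ (by positivity)]
        nlinarith [hsqc j i b]
      · rw [← sub_div, abs_div, abs_of_pos (by positivity : 0 < 2 * c), div_le_iff₀ (by positivity),
          sq_sub_sq, abs_mul, mul_comm]
        refine mul_le_mul_of_nonneg_left ?_ (abs_nonneg _)
        exact (abs_add_le _ _).trans (by linarith [hqc j i b, hqc j' i b])
    refine cubeProb_abs_le (B := 2 * c ^ 2) (v := c ^ 2 * R ^ 2) (t := 168 * ρ ^ 2) ?_
      (by positivity) ?_ (by positivity) ?_ ?_
    · intro j i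
      refine (abs_sub _ _).trans ?_
      rw [abs_of_nonneg (sq_nonneg _), abs_of_nonneg (sq_nonneg _)]
      linarith [hsqc j i true, hsqc j i false]
    · intro j
      refine le_trans ?_ (mul_le_mul_of_nonneg_left (hsq j) (by positivity))
      rw [Finset.mul_sum]
      refine Finset.sum_le_sum fun i _ => ?_
      have hx := mul_le_mul_of_nonneg_right (hsqc j i true) (sq_nonneg (q j i true))
      have hy := mul_le_mul_of_nonneg_right (hsqc j i false) (sq_nonneg (q j i false))
      nlinarith [mul_nonneg (sq_nonneg (q j i true)) (sq_nonneg (q j i false))]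
    · rw [hR]
      nlinarith [mul_le_mul_of_nonneg_left hL (by positivity : 0 ≤ ρ ^ 2), pow_pos hρ 4]
    · have h4 := rad_sub_le (B := c ^ 2) (a := fun j i => q j i true ^ 2)
        (b := fun j i => q j i false ^ 2)
        (fun j i => by rw [abs_of_nonneg (sq_nonneg _)]; exact hsqc j i true)
        fun j i => by rw [abs_of_nonneg (sq_nonneg _)]; exact hsqc j i false
      have h5 : rad (fun j i => q j i true ^ 2) ≤ 2 * c * (840 * (ρ ^ 2 / c)) :=
        (hcontr true).trans (mul_le_mul_of_nonneg_left (ht.trans hVR) (by positivity))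
      have h6 : rad (fun j i => q j i false ^ 2) ≤ 2 * c * (840 * (ρ ^ 2 / c)) :=
        (hcontr false).trans (mul_le_mul_of_nonneg_left (hf.trans hVR) (by positivity))
      have h7 : c * (ρ ^ 2 / c) = ρ ^ 2 := by field_simp
      rw [hR]
      nlinarith
  have h3 := cubeProb_or_le
    (fun σ => ∃ j, 1 / 14 * R ^ 2 < |∑ i, rsign (σ i) * (q j i true - q j i false)|)
    (fun σ => ∃ j, 1 / 8 * R ^ 2 < |∑ i, rsign (σ i) * (q j i true ^ 2 - q j i false ^ 2)|)
  refine (cubeProb_mono ?_).trans (h3.trans (by linarith))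
  rintro σ ⟨j, hj⟩
  -- Undo the clipping: sums of `q` are sums of `p` times this weight, and sums of squares carry its
  -- square. This is how `max R (pairNorm (p j))` enters the thresholds.
  have hw : 0 < R / max R (pairNorm (p j)) := div_pos hRpos (hm j)
  have hsel : ∀ (g : Bool → ℝ) b, g b - g (!b) = rsign b * (g true - g false) := by
    intro g b; cases b <;> simp [rsign]
  rcases hj with hj | hj
  · left
    refine ⟨j, ?_⟩
    have h4 : ∑ i, rsign (σ i) * (q j i true - q j i false) =
        R / max R (pairNorm (p j)) * ∑ i, (p j i (σ i) - p j i (!σ i)) := by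
      rw [Finset.mul_sum]
      refine Finset.sum_congr rfl fun i _ => ?_
      rw [hsel (p j i)]
      simp only [hq, clip]
      ring
    rw [h4, abs_mul, abs_of_pos hw, div_mul_eq_mul_div R, lt_div_iff₀ (hm j)]
    nlinarith
  · right
    refine ⟨j, ?_⟩
    have h4 : ∑ i, rsign (σ i) * (q j i true ^ 2 - q j i false ^ 2) =
        (R / max R (pairNorm (p j))) ^ 2 * ∑ i, (p j i (σ i) ^ 2 - p j i (!σ i) ^ 2) := by
      rw [Finset.mul_sum]
      refine Finset.sum_congr rfl fun i _ => ?_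
      rw [hsel fun b => p j i b ^ 2]
      simp only [hq, clip]
      ring
    rw [h4, abs_mul, abs_of_pos (by positivity), div_pow, div_mul_eq_mul_div (R ^ 2),
      lt_div_iff₀ (pow_pos (hm j) 2)]
    have := mul_lt_mul_of_pos_left hj (by positivity : 0 < R ^ 2)
    linarith

end Pairs

/-! ### Exceptional splittings of a paired sample. -/

section Splitting

variable {ι : Type*} [Fintype ι] [DecidableEq ι] {J X : Type*}

set_option linter.unusedSectionVars false

/-- Values of the family `f` on a sample of pairs. -/
def pairVals (f : J → X → ℝ) (z : ι → X × X) (j : J) (i : ι) (b : Bool) : ℝ :=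
  f j (if b then (z i).1 else (z i).2)

/-- The grid of radii `2ᵐ c √(10 L)`. -/
def gridRadius (c L : ℝ) (m : ℕ) : ℝ := 2 ^ m * (c * Real.sqrt (10 * L))

/-- The splitting `((z i).1)`, `((z i).2)` of a sample of pairs is exceptional: at the first radius of
the grid where the complexity of the pairs is small, either the two halves deviate from each other,
or the complexity of the first half was too small at the previous radius. -/
def BadSplit (f : J → X → ℝ) (c L : ℝ) (z : ι → X × X) : Prop :=
  ∃ m, (∀ k < m, 5 * gridRadius c L k ^ 2 / c ≤
      pairRad (clip (gridRadius c L k) (pairVals f z))) ∧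
    pairRad (clip (gridRadius c L m) (pairVals f z)) < 5 * gridRadius c L m ^ 2 / c ∧
    ((∃ k, k + 1 = m ∧ rad (fun j i => clip (gridRadius c L k) (pairVals f z) j i true) ≤
        5 / 4 * (gridRadius c L k ^ 2 / c)) ∨
      ∃ j, 1 / 14 * (168 * gridRadius c L m *
            max (168 * gridRadius c L m) (pairNorm (pairVals f z j))) <
          |∑ i, (pairVals f z j i true - pairVals f z j i false)| ∨
        1 / 8 * max (168 * gridRadius c L m) (pairNorm (pairVals f z j)) ^ 2 <
          |∑ i, (pairVals f z j i true ^ 2 - pairVals f z j i false ^ 2)|)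

/-- Exchange the members of the pairs selected by `σ`. -/
def swapPairs (σ : ι → Bool) (z : ι → X × X) (i : ι) : X × X := if σ i then z i else (z i).swap

lemma pairVals_swapPairs (f : J → X → ℝ) (σ : ι → Bool) (z : ι → X × X) (j : J) (i : ι) (b : Bool) :
    pairVals f (swapPairs σ z) j i b = pairVals f z j i (if b then σ i else !σ i) := by
  cases b <;> cases h : σ i <;> simp [pairVals, swapPairs, h]

lemma pairNorm_swapPairs (f : J → X → ℝ) (σ : ι → Bool) (z : ι → X × X) (j : J) :
    pairNorm (pairVals f (swapPairs σ z) j) = pairNorm (pairVals f z j) := by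
  unfold pairNorm
  congr 1
  refine Finset.sum_congr rfl fun i _ => ?_
  rw [pairVals_swapPairs, pairVals_swapPairs]
  cases h : σ i <;> simp [add_comm]

lemma clip_swapPairs (f : J → X → ℝ) (ρ : ℝ) (σ : ι → Bool) (z : ι → X × X) (j : J) (i : ι)
    (b : Bool) : clip ρ (pairVals f (swapPairs σ z)) j i b =
      clip ρ (pairVals f z) j i (if b then σ i else !σ i) := by
  simp only [clip, pairNorm_swapPairs, pairVals_swapPairs]

/-- Exchange of the labels selected by `σ`. -/
def flipEquiv (σ : ι → Bool) : ι × Bool ≃ ι × Bool :=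
  Function.Involutive.toPerm (fun k => (k.1, if σ k.1 then k.2 else !k.2)) fun k => by
    rcases k with ⟨i, b⟩
    cases h : σ i <;> simp [h]

/-- Swapping within pairs permutes the index set `ι × Bool`. Hence the first grid radius at which
the pair complexity is small is the same for all swaps of a given sample. -/
lemma pairRad_clip_swapPairs (f : J → X → ℝ) (ρ : ℝ) (σ : ι → Bool) (z : ι → X × X) :
    pairRad (clip ρ (pairVals f (swapPairs σ z))) = pairRad (clip ρ (pairVals f z)) := by
  unfold pairRad
  rw [← rad_comp_equiv (flipEquiv σ) fun (j : J) (k : ι × Bool) => clip ρ (pairVals f z) j k.1 k.2]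
  congr 1
  funext j k
  rw [clip_swapPairs]
  rcases k with ⟨i, b⟩
  change _ = clip ρ (pairVals f z) j i (if σ i then b else !b)
  cases h : σ i <;> cases b <;> simp

lemma gridRadius_pos {c L : ℝ} (hc : 0 < c) (hL : 0 < L) (m : ℕ) : 0 < gridRadius c L m := by
  have : 0 < Real.sqrt (10 * L) := Real.sqrt_pos.2 (by positivity)
  unfold gridRadius; positivity

/-- The base radius `c √(10 L)` is chosen so that every grid radius meets the condition required by
the upper and the lower tail bounds. -/
lemma le_gridRadius_sq {c L : ℝ} (hL : 0 < L) (m : ℕ) :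
    10 * c ^ 2 * L ≤ gridRadius c L m ^ 2 := by
  have h1 : gridRadius c L m ^ 2 = (2 ^ m) ^ 2 * (10 * c ^ 2 * L) := by
    unfold gridRadius
    rw [mul_pow, mul_pow, Real.sq_sqrt (by positivity)]
    ring
  have h2 : (1 : ℝ) ≤ (2 ^ m) ^ 2 := one_le_pow₀ (one_le_pow₀ (by norm_num))
  rw [h1]
  exact le_mul_of_one_le_left (by positivity) h2

variable [Nonempty J]

/-- For every sample of pairs, a random splitting is rarely exceptional. -/
lemma cubeProb_badSplit_le {f : J → X → ℝ} {c L : ℝ} (hc : 1 ≤ c) (hL : 0 < L)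
    (hf : ∀ j x, |f j x| ≤ c) {j₀ : J} (h0 : ∀ x, f j₀ x = 0) (z : ι → X × X) :
    cubeProb (fun σ => BadSplit f c L (swapPairs σ z)) ≤ 5 * Real.exp (-L) := by
  classical
  have hc0 : 0 < c := by linarith
  by_cases hex : ∃ m, pairRad (clip (gridRadius c L m) (pairVals f z)) < 5 * gridRadius c L m ^ 2 / c
  swap
  · have : ∀ σ, BadSplit f c L (swapPairs σ z) → False := by
      rintro σ ⟨m, -, h, -⟩
      rw [pairRad_clip_swapPairs] at h
      exact hex ⟨m, h⟩
    refine (cubeProb_mono this).trans ?_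
    simp only [cubeProb, if_false, cubeAvg_const]
    positivity
  -- By swap invariance this is the index in `BadSplit` for every `σ`, so a single radius is
  -- treated: `4 exp (-L)` for the deviations there, and `exp (-L)` for the selected complexity at
  -- the previous radius.
  set m := Nat.find hex with hm
  have hmin : ∀ k < m, 5 * gridRadius c L k ^ 2 / c ≤
      pairRad (clip (gridRadius c L k) (pairVals f z)) := fun k hk =>
    not_lt.1 (Nat.find_min hex hk)
  have hspec := Nat.find_spec hex
  rw [← hm] at hspec
  have hp : ∀ j i b, |pairVals f z j i b| ≤ c := fun j i b => hf _ _
  have h1 := cubeProb_split_deviation_le (gridRadius_pos hc0 hL m) hc hp (j₀ := j₀)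
    (fun i b => h0 _) hspec.le (le_gridRadius_sq hL m)
  have h2 : cubeProb (fun σ : ι → Bool => ∃ k, k + 1 = m ∧
      rad (fun j i => clip (gridRadius c L k) (pairVals f z) j i (σ i)) ≤
        5 / 4 * (gridRadius c L k ^ 2 / c)) ≤ Real.exp (-L) := by
    rcases Nat.eq_zero_or_pos m with h | h
    · refine (cubeProb_mono (q := fun _ => False) ?_).trans ?_
      · rintro σ ⟨k, hk, -⟩; omega
      · simp only [cubeProb, if_false, cubeAvg_const]; positivity
    · obtain ⟨k, hk⟩ : ∃ k, k + 1 = m := ⟨m - 1, by omega⟩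
      refine (cubeProb_mono ?_).trans (cubeProb_rad_select_clip_le (gridRadius_pos hc0 hL k) hc0 hp
        (hmin k (by omega)) (le_gridRadius_sq hL k))
      rintro σ ⟨k', hk', h⟩
      obtain rfl : k' = k := by omega
      exact h
  have h3 := (cubeProb_or_le _ _).trans (add_le_add h2 h1)
  refine (cubeProb_mono ?_).trans (h3.trans (by linarith))
  rintro σ ⟨m', hlt, hm', hbad⟩
  simp only [pairRad_clip_swapPairs] at hlt hm'
  have hmm : m' = m := by
    refine le_antisymm (not_lt.1 fun h => ?_) (Nat.find_min' hex hm')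
    exact absurd hspec (not_lt.2 (hlt m h))
  subst hmm
  rcases hbad with ⟨k, hk, h⟩ | ⟨j, h⟩
  · left
    refine ⟨k, hk, ?_⟩
    simpa only [clip_swapPairs, if_true] using h
  · right
    refine ⟨j, ?_⟩
    simpa [pairNorm_swapPairs, pairVals_swapPairs] using h

variable [MeasurableSpace X] [Countable J]

lemma measurable_pairVals {f : J → X → ℝ} (hf : ∀ j, Measurable (f j)) (j : J) (i : ι) (b : Bool) :
    Measurable fun z : ι → X × X => pairVals f z j i b := by
  cases b
  · exact (hf j).comp (by simpa using (measurable_pi_apply i).snd)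
  · exact (hf j).comp (by simpa using (measurable_pi_apply i).fst)

lemma measurable_pairNorm {f : J → X → ℝ} (hf : ∀ j, Measurable (f j)) (j : J) :
    Measurable fun z : ι → X × X => pairNorm (pairVals f z j) :=
  Real.continuous_sqrt.measurable.comp (Finset.measurable_fun_sum _ fun i _ =>
    ((measurable_pairVals hf j i true).pow_const 2).add
      ((measurable_pairVals hf j i false).pow_const 2))

lemma measurable_clip {f : J → X → ℝ} (hf : ∀ j, Measurable (f j)) (ρ : ℝ) (j : J) (i : ι)
    (b : Bool) : Measurable fun z : ι → X × X => clip ρ (pairVals f z) j i b :=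
  (measurable_const.div (measurable_const.max (measurable_pairNorm hf j))).mul
    (measurable_pairVals hf j i b)

lemma measurable_rad {α κ : Type*} [MeasurableSpace α] [Fintype κ] [DecidableEq κ]
    {a : α → J → κ → ℝ} (ha : ∀ j k, Measurable fun x => a x j k) :
    Measurable fun x => rad (a x) := by
  unfold rad cubeAvg
  refine (Finset.measurable_fun_sum _ fun σ _ => ?_).div_const _
  unfold radSup
  exact Measurable.iSup fun j => Finset.measurable_fun_sum _ fun k _ => (ha j k).const_mul _

lemma measurableSet_badSplit {f : J → X → ℝ} (hf : ∀ j, Measurable (f j)) (c L : ℝ) :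
    MeasurableSet {z : ι → X × X | BadSplit f c L z} := by
  have hV : ∀ ρ, Measurable fun z : ι → X × X => pairRad (clip ρ (pairVals f z)) := fun ρ =>
    measurable_rad fun j k => measurable_clip hf ρ j k.1 k.2
  have hR : ∀ ρ, Measurable fun z : ι → X × X =>
      rad fun j i => clip ρ (pairVals f z) j i true := fun ρ =>
    measurable_rad fun j i => measurable_clip hf ρ j i true
  have hN := measurable_pairNorm (ι := ι) hf
  have hS1 : ∀ j, Measurable fun z : ι → X × X =>
      |∑ i, (pairVals f z j i true - pairVals f z j i false)| := fun j =>
    (Finset.measurable_fun_sum _ fun i _ =>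
      (measurable_pairVals hf j i true).sub (measurable_pairVals hf j i false)).abs
  have hS2 : ∀ j, Measurable fun z : ι → X × X =>
      |∑ i, (pairVals f z j i true ^ 2 - pairVals f z j i false ^ 2)| := fun j =>
    (Finset.measurable_fun_sum _ fun i _ =>
      ((measurable_pairVals hf j i true).pow_const 2).sub
        ((measurable_pairVals hf j i false).pow_const 2)).abs
  have hmax : ∀ (s : ℝ) j, Measurable fun z : ι → X × X =>
      max s (pairNorm (pairVals f z j)) := fun s j => measurable_const.max (hN j)
  unfold BadSplit
  simp only [Set.ofPred_exists, Set.ofPred_and, Set.ofPred_or, Set.ofPred_forall]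
  refine MeasurableSet.iUnion fun m => ?_
  refine MeasurableSet.inter ?_ (MeasurableSet.inter ?_ (MeasurableSet.union ?_ ?_))
  · refine MeasurableSet.iInter fun k => MeasurableSet.iInter fun _ => ?_
    exact measurableSet_le measurable_const (hV _)
  · exact measurableSet_lt (hV _) measurable_const
  · refine MeasurableSet.iUnion fun k => MeasurableSet.inter (MeasurableSet.const _) ?_
    exact measurableSet_le (hR _) measurable_const
  · refine MeasurableSet.iUnion fun j => MeasurableSet.union ?_ ?_
    · exact measurableSet_lt (((hmax _ j).const_mul _).const_mul _) (hS1 j)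
    · exact measurableSet_lt (((hmax _ j).pow_const 2).const_mul _) (hS2 j)

lemma measurePreserving_swapPairs (P : Measure X) [IsProbabilityMeasure P] (σ : ι → Bool) :
    MeasurePreserving (swapPairs σ) (Measure.pi fun _ : ι => P.prod P)
      (Measure.pi fun _ : ι => P.prod P) := by
  refine measurePreserving_pi (f := fun i (p : X × X) => if σ i then p else p.swap) _ _ fun i => ?_
  cases h : σ i
  · simpa [h] using Measure.measurePreserving_swap (μ := P) (ν := P)
  · simp only [if_true]
    exact MeasurePreserving.id (P.prod P)

/-- Exceptional splittings are rare for an i.i.d. sample of pairs. -/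
lemma measure_badSplit_le (P : Measure X) [IsProbabilityMeasure P] {f : J → X → ℝ} {c L : ℝ}
    (hc : 1 ≤ c) (hL : 0 < L) (hfm : ∀ j, Measurable (f j)) (hf : ∀ j x, |f j x| ≤ c) {j₀ : J}
    (h0 : ∀ x, f j₀ x = 0) :
    (Measure.pi fun _ : ι => P.prod P) {z | BadSplit f c L z} ≤
      ENNReal.ofReal (5 * Real.exp (-L)) := by
  classical
  set Q := Measure.pi fun _ : ι => P.prod P with hQ
  set B := {z : ι → X × X | BadSplit f c L z} with hB
  have hBm : MeasurableSet B := measurableSet_badSplit hfm c L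
  -- Swaps preserve the law of the paired sample, so the probability equals the mean, over samples
  -- and over `σ`, of the indicator after swapping; for each fixed sample the mean over `σ` is
  -- already bounded.
  have h1 : ∀ σ : ι → Bool, Q B = ∫⁻ z, B.indicator 1 (swapPairs σ z) ∂Q := by
    intro σ
    rw [(measurePreserving_swapPairs P σ).lintegral_comp (measurable_one.indicator hBm),
      lintegral_indicator_one hBm]
  have h2 : (Fintype.card (ι → Bool) : ENNReal) * Q B =
      ∫⁻ z, ∑ σ : ι → Bool, B.indicator 1 (swapPairs σ z) ∂Q := by
    have hm : ∀ σ : ι → Bool, Measurable fun z : ι → X × X =>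
        B.indicator (1 : (ι → X × X) → ENNReal) (swapPairs σ z) := fun σ =>
      (measurable_one.indicator hBm).comp (measurePreserving_swapPairs P σ).measurable
    rw [lintegral_finsetSum _ fun σ _ => hm σ]
    simp_rw [← h1]
    simp
  have h3 : ∀ z, ∑ σ : ι → Bool, B.indicator (1 : (ι → X × X) → ENNReal) (swapPairs σ z) ≤
      (Fintype.card (ι → Bool) : ENNReal) * ENNReal.ofReal (5 * Real.exp (-L)) := by
    intro z
    have h4 := cubeProb_badSplit_le hc hL hf h0 z
    unfold cubeProb cubeAvg at h4
    rw [div_le_iff₀ cubeCard_pos, mul_comm] at h4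
    have h5 : ∑ σ : ι → Bool, B.indicator (1 : (ι → X × X) → ENNReal) (swapPairs σ z) =
        ENNReal.ofReal (∑ σ : ι → Bool, if BadSplit f c L (swapPairs σ z) then (1 : ℝ) else 0) := by
      rw [ENNReal.ofReal_sum_of_nonneg fun σ _ => by split_ifs <;> norm_num]
      refine Finset.sum_congr rfl fun σ _ => ?_
      by_cases h : BadSplit f c L (swapPairs σ z)
      · simp [Set.indicator, hB, h]
      · simp [Set.indicator, hB, h]
    rw [h5]
    refine (ENNReal.ofReal_le_ofReal h4).trans ?_
    rw [ENNReal.ofReal_mul cubeCard_pos.le, ENNReal.ofReal_natCast]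
  have h6 := (h2.le.trans (lintegral_mono h3))
  rw [lintegral_const, measure_univ, mul_one] at h6
  refine (ENNReal.mul_le_mul_iff_right ?_ (ENNReal.natCast_ne_top _)).1 h6
  exact_mod_cast Fintype.card_ne_zero

end Splitting

/-! ### Removing the ghost sample. -/

section Ghost

variable {ι : Type*} [Fintype ι] [DecidableEq ι] {J X : Type*}

set_option linter.unusedSectionVars false

lemma bddAbove_localRad (D : Finset ι) (x : ι → X) {F : Set (X → ℝ)} {c : ℝ}
    (hF : ∀ g ∈ F, ∀ i ∈ D, |g (x i)| ≤ c) (ε : ι → Bool) (r : ℝ) :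
    BddAbove ((fun f : X → ℝ => (∑ i ∈ D, rsign (ε i) * f (x i)) / (D.card : ℝ)) ''
      {f | f ∈ F ∧ empNorm D x f ≤ r}) := by
  refine ⟨(∑ _i ∈ D, c) / (D.card : ℝ), ?_⟩
  rintro _ ⟨f, hf, rfl⟩
  refine div_le_div_of_nonneg_right (Finset.sum_le_sum fun i hi => ?_) (Nat.cast_nonneg _)
  refine (le_abs_self _).trans ?_
  rw [abs_mul, abs_rsign, one_mul]
  exact hF f hf.1 i hi

/-- The clipped family on the first half of a sample of pairs is controlled by the localized
complexity of a star-shaped class containing it, at any smaller radius. -/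
lemma rad_clip_le_localRad [Nonempty ι] [Nonempty J] {F : Set (X → ℝ)} (hstar : StarConvex ℝ 0 F)
    {c : ℝ} (hF : ∀ g ∈ F, ∀ x, |g x| ≤ c) {f : J → X → ℝ} (hf : ∀ j, f j ∈ F) {r ρ : ℝ}
    (hr : 0 < r) (hρ : Real.sqrt (Fintype.card ι) * r ≤ ρ) (z : ι → X × X) :
    rad (fun j i => clip ρ (pairVals f z) j i true) ≤
      ρ * (Real.sqrt (Fintype.card ι) / r * localRad Finset.univ (fun i => (z i).1) F r) := by
  set n : ℝ := (Fintype.card ι : ℝ) with hn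
  have hn0 : 0 < n := by rw [hn]; exact_mod_cast Fintype.card_pos
  have hs0 : 0 < Real.sqrt n := Real.sqrt_pos.2 hn0
  have hss : Real.sqrt n * Real.sqrt n = n := Real.mul_self_sqrt hn0.le
  have hρ0 : 0 < ρ := lt_of_lt_of_le (by positivity) hρ
  rw [localRad, ← cubeAvg, ← cubeAvg_const_mul, ← cubeAvg_const_mul]
  refine cubeAvg_mono fun ε => ciSup_le fun j => ?_
  -- The clipped vector has Euclidean norm at most `ρ`; scaling it by `t ≤ 1` stays in the
  -- star-shaped class and brings the empirical norm below `r`.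
  set t := Real.sqrt n * r / ρ with ht
  have ht0 : 0 < t := by positivity
  have ht1 : t ≤ 1 := (div_le_one hρ0).2 hρ
  obtain ⟨hw0, hw1, -⟩ := clip_weight hρ0 (pairVals f z j)
  set w := ρ / max ρ (pairNorm (pairVals f z j)) with hw
  set g : X → ℝ := fun x => t * w * f j x with hg
  have hgF : g ∈ F := by
    have h1 : 0 ≤ 1 - t * w := by nlinarith
    have := hstar (hf j) h1 (by positivity : 0 ≤ t * w) (by ring)
    simpa [hg, Pi.smul_def] using this
  have hgn : empNorm Finset.univ (fun i => (z i).1) g ≤ r := by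
    rw [empNorm, Real.sqrt_le_left hr.le, empMean, Finset.card_univ, ← hn, div_le_iff₀ hn0]
    have h2 := sum_clip_sq_le hρ0 (pairVals f z) j
    have h3 : ∑ i, g (z i).1 ^ 2 ≤
        t ^ 2 * ∑ i, (clip ρ (pairVals f z) j i true ^ 2 + clip ρ (pairVals f z) j i false ^ 2) := by
      rw [Finset.mul_sum]
      refine Finset.sum_le_sum fun i _ => ?_
      have : g (z i).1 ^ 2 = t ^ 2 * clip ρ (pairVals f z) j i true ^ 2 := by
        simp only [hg, clip, pairVals, if_true, hw]; ring
      rw [this]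
      nlinarith [mul_nonneg (sq_nonneg t) (sq_nonneg (clip ρ (pairVals f z) j i false))]
    refine h3.trans ((mul_le_mul_of_nonneg_left h2 (sq_nonneg t)).trans (le_of_eq ?_))
    have h4 : t * ρ = Real.sqrt n * r := by rw [ht]; field_simp
    calc t ^ 2 * ρ ^ 2 = (t * ρ) ^ 2 := by ring
      _ = r ^ 2 * n := by rw [h4]; linear_combination r ^ 2 * hss
  have h5 := le_csSup (bddAbove_localRad Finset.univ (fun i => (z i).1)
    (fun g hg i _ => hF g hg _) ε r) (Set.mem_image_of_mem _ ⟨hgF, hgn⟩)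
  simp only [Finset.card_univ, ← hn] at h5 ⊢
  have h6 : ∑ k, rsign (ε k) * clip ρ (pairVals f z) j k true =
      ρ * (Real.sqrt n / r * ((∑ i, rsign (ε i) * g (z i).1) / n)) := by
    have h7 : ∑ i, rsign (ε i) * g (z i).1 =
        t * ∑ k, rsign (ε k) * clip ρ (pairVals f z) j k true := by
      rw [Finset.mul_sum]
      refine Finset.sum_congr rfl fun i _ => ?_
      simp only [hg, clip, pairVals, if_true, hw]; ring
    rw [h7, ht]
    generalize ∑ k, rsign (ε k) * clip ρ (pairVals f z) j k true = S
    field_simp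
    rw [sq, hss]
  rw [h6]
  exact mul_le_mul_of_nonneg_left (mul_le_mul_of_nonneg_left h5 (by positivity)) hρ0.le

/-- On unexceptional pairs of samples, any critical radius of the first sample controls the
deviations between the two samples. -/
lemma deviation_le_of_not_badSplit [Nonempty ι] [Nonempty J] {F : Set (X → ℝ)}
    (hstar : StarConvex ℝ 0 F) {c : ℝ} (hc : 1 ≤ c) (hF : ∀ g ∈ F, ∀ x, |g x| ≤ c)
    {f : J → X → ℝ} (hf : ∀ j, f j ∈ F) {L : ℝ} (hL : 0 < L) {z : ι → X × X}
    (hz : ¬ BadSplit f c L z) {r H : ℝ} (hr : 0 < r)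
    (hcrit : localRad Finset.univ (fun i => (z i).1) F r ≤ r ^ 2 / c)
    (hH : 672 * (Real.sqrt (Fintype.card ι) * r + c * Real.sqrt L) ≤ H) (j : J) :
    |∑ i, (pairVals f z j i true - pairVals f z j i false)| ≤
        1 / 14 * (H * max H (pairNorm (pairVals f z j))) ∧
      |∑ i, (pairVals f z j i true ^ 2 - pairVals f z j i false ^ 2)| ≤
        1 / 8 * max H (pairNorm (pairVals f z j)) ^ 2 := by
  classical
  set n : ℝ := (Fintype.card ι : ℝ) with hn
  have hn0 : 0 < n := by rw [hn]; exact_mod_cast Fintype.card_pos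
  have hs0 : 0 < Real.sqrt n := Real.sqrt_pos.2 hn0
  have hss : Real.sqrt n * Real.sqrt n = n := Real.mul_self_sqrt hn0.le
  have hc0 : 0 < c := by linarith
  have hL0 : 0 < Real.sqrt L := Real.sqrt_pos.2 hL
  have hp : ∀ j i b, |pairVals f z j i b| ≤ c := fun j i b => hF _ (hf j) _
  -- The complexity is bounded at all radii, while the threshold grows like `4 ^ m`.
  have hex : ∃ m, pairRad (clip (gridRadius c L m) (pairVals f z)) <
      5 * gridRadius c L m ^ 2 / c := by
    have hbound : ∀ ρ, 0 < ρ → pairRad (clip ρ (pairVals f z)) ≤ (Fintype.card (ι × Bool) : ℝ) * c := by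
      intro ρ hρ
      rw [pairRad, rad, ← cubeAvg_const (ι := ι × Bool) ((Fintype.card (ι × Bool) : ℝ) * c)]
      refine cubeAvg_mono fun ε => ciSup_le fun j => ?_
      refine (Finset.sum_le_sum fun k _ => (le_abs_self _).trans ?_).trans (b := ∑ _k : ι × Bool, c)
        (by simp)
      rw [abs_mul, abs_rsign, one_mul]
      exact abs_clip_le hρ hp _ _ _
    obtain ⟨m, hm⟩ := pow_unbounded_of_one_lt
      ((Fintype.card (ι × Bool) : ℝ) * c / (5 * (10 * c ^ 2 * L) / c)) (by norm_num : (1 : ℝ) < 4)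
    refine ⟨m, (hbound _ (gridRadius_pos hc0 hL m)).trans_lt ?_⟩
    rw [div_lt_iff₀ (by positivity)] at hm
    have h1 : gridRadius c L m ^ 2 = 4 ^ m * (10 * c ^ 2 * L) := by
      unfold gridRadius
      rw [mul_pow, mul_pow, Real.sq_sqrt (by positivity), ← pow_mul, mul_comm m, pow_mul]
      norm_num
      ring
    rw [h1]
    refine hm.trans_le (le_of_eq ?_)
    ring
  set m := Nat.find hex with hm
  have hmin : ∀ k < m, 5 * gridRadius c L k ^ 2 / c ≤
      pairRad (clip (gridRadius c L k) (pairVals f z)) := fun k hk =>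
    not_lt.1 (Nat.find_min hex hk)
  have hspec := Nat.find_spec hex
  rw [← hm] at hspec
  -- Either `m = 0` and `√10 ≤ 4` suffices, or `√n r` exceeds the previous grid radius, which is
  -- half of the current one. Indeed, were `√n r` at most the previous radius `ρ`, the critical
  -- inequality would bound the first-half complexity there by `ρ² / c`, below the `5/4 ρ² / c` that
  -- a good splitting exceeds.
  have hR : 168 * gridRadius c L m ≤ H := by
    rcases Nat.eq_zero_or_pos m with h0 | h0
    · rw [h0, gridRadius]
      have h1 : Real.sqrt (10 * L) ≤ 4 * Real.sqrt L := by
        rw [Real.sqrt_le_left (by positivity), mul_pow, Real.sq_sqrt hL.le]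
        linarith
      have h2 := mul_le_mul_of_nonneg_left h1 hc0.le
      have h3 : 0 < Real.sqrt n * r := by positivity
      simp only [pow_zero, one_mul]
      linarith
    · obtain ⟨k, hk⟩ : ∃ k, k + 1 = m := ⟨m - 1, by omega⟩
      have h1 : ¬ Real.sqrt n * r ≤ gridRadius c L k := by
        intro h
        refine hz ⟨m, hmin, hspec, Or.inl ⟨k, hk, ?_⟩⟩
        have hρ := gridRadius_pos hc0 hL k
        set ρ := gridRadius c L k with hρd
        have h2 := rad_clip_le_localRad hstar hF hf hr h z
        refine h2.trans ?_
        have h3 := mul_le_mul_of_nonneg_left (mul_le_mul_of_nonneg_left hcrit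
          (by positivity : 0 ≤ Real.sqrt n / r)) hρ.le
        refine h3.trans ?_
        have h4 : ρ * (Real.sqrt n / r * (r ^ 2 / c)) = ρ * (Real.sqrt n * r) / c := by
          field_simp
        have h5 : ρ * (Real.sqrt n * r) / c ≤ ρ * ρ / c := by gcongr
        have h6 : ρ * ρ / c = ρ ^ 2 / c := by ring
        have h7 : 0 ≤ ρ ^ 2 / c := by positivity
        rw [h4]
        linarith
      have h2 : gridRadius c L m = 2 * gridRadius c L k := by
        rw [← hk, gridRadius, gridRadius, pow_succ]; ring
      have h3 : 0 < c * Real.sqrt L := by positivity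
      linarith [not_le.1 h1, gridRadius_pos hc0 hL k]
  have hgood : ∀ j, ¬ _ := fun j h => hz ⟨m, hmin, hspec, Or.inr ⟨j, h⟩⟩
  have hj := hgood j
  rw [not_or, not_lt, not_lt] at hj
  have hg := gridRadius_pos hc0 hL m
  have hH0 : 0 ≤ H := by linarith
  refine ⟨hj.1.trans ?_, hj.2.trans ?_⟩ <;> gcongr

/-- Here `S`, `Q` come from the sample, `S'`, `Q'` from the ghost sample, and `p₁`, `s ^ 2` are the
expectations. The deviation of the squares bounds `N` self-consistently by `2 s + H`, after which
both claims are triangle inequalities. -/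
lemma ghost_arithmetic {S S' p₁ Q Q' s H N : ℝ} (hH : 0 ≤ H) (hs : 0 ≤ s)
    (hN2 : N ^ 2 = Q + Q') (hd1 : |S - S'| ≤ 1 / 14 * (H * max H N))
    (hd2 : |Q - Q'| ≤ 1 / 8 * max H N ^ 2) (hc1 : |S' - p₁| < 1 / 4 * (H * s + H ^ 2))
    (hc2 : |Q' - s ^ 2| < 1 / 8 * (s ^ 2 + H ^ 2)) :
    |S - p₁| ≤ 1 / 2 * (H * s + H ^ 2) ∧ |Q - s ^ 2| ≤ 1 / 2 * (s ^ 2 + H ^ 2) := by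
  have hH2 := sq_nonneg H
  have hs2 := sq_nonneg s
  have hHs := mul_nonneg hH hs
  have hmax2 : max H N ^ 2 ≤ H ^ 2 + N ^ 2 := by
    rcases max_cases H N with h | h <;> rw [h.1] <;> linarith [sq_nonneg N]
  obtain ⟨a1, a2⟩ := abs_le.1 hd2
  obtain ⟨b1, b2⟩ := abs_lt.1 hc2
  have hN2' : N ^ 2 ≤ 18 / 7 * s ^ 2 + 3 / 7 * H ^ 2 := by linarith
  have hNle : N ≤ 2 * s + H := by
    refine (abs_le_of_sq_le_sq' ?_ (by positivity)).2
    linarith [show (2 * s + H) ^ 2 = 4 * s ^ 2 + 4 * (H * s) + H ^ 2 by ring]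
  have hmaxle : max H N ≤ 2 * s + H := max_le (by linarith) hNle
  constructor
  · have h7 := abs_sub_le S S' p₁
    have h8 := mul_le_mul_of_nonneg_left hmaxle hH
    linarith [show H * (2 * s + H) = 2 * (H * s) + H ^ 2 by ring]
  · have h7 := abs_sub_le Q Q' (s ^ 2)
    linarith

variable [MeasurableSpace X]

/-- Chebyshev's inequality for a sum over an i.i.d. sample. -/
lemma measure_pi_deviation_le (P : Measure X) [IsProbabilityMeasure P] {g : X → ℝ}
    (hg : Measurable g) {b : ℝ} (hb : ∀ x, |g x| ≤ b) {t : ℝ} (ht : 0 < t) :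
    (Measure.pi fun _ : ι => P) {x | t ≤ |∑ i, g (x i) - Fintype.card ι * ∫ x, g x ∂P|} ≤
      ENNReal.ofReal (Fintype.card ι * (∫ x, g x ^ 2 ∂P) / t ^ 2) := by
  have hm : MemLp g 2 P := MemLp.of_bound hg.aestronglyMeasurable b (ae_of_all _ hb)
  have hsum : (∑ i : ι, fun ω : ι → X => g (ω i)) = fun ω => ∑ i, g (ω i) := by
    funext ω; simp
  have hmi : ∀ i : ι, MemLp (fun ω : ι → X => g (ω i)) 2 (Measure.pi fun _ : ι => P) := fun i =>
    hm.comp_measurePreserving (measurePreserving_eval _ i)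
  have hmem : MemLp (fun ω : ι → X => ∑ i, g (ω i)) 2 (Measure.pi fun _ : ι => P) :=
    memLp_finsetSum _ fun i _ => hmi i
  have h := meas_ge_le_variance_div_sq hmem ht
  have hint : ∫ ω : ι → X, ∑ i, g (ω i) ∂(Measure.pi fun _ : ι => P) =
      Fintype.card ι * ∫ x, g x ∂P := by
    rw [integral_finsetSum _ fun i _ => (hmi i).integrable (by norm_num)]
    have : ∀ i : ι, ∫ ω : ι → X, g (ω i) ∂(Measure.pi fun _ : ι => P) = ∫ x, g x ∂P := fun i =>
      integral_comp_eval (μ := fun _ : ι => P) hg.aestronglyMeasurable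
    simp [this]
  rw [hint, ← hsum, variance_sum_pi fun _ : ι => hm] at h
  refine h.trans (ENNReal.ofReal_le_ofReal ?_)
  simp only [Finset.sum_const, Finset.card_univ, nsmul_eq_mul]
  gcongr
  exact variance_le_expectation_sq hg.aestronglyMeasurable

/-- Uniform deviations over a countable family in terms of the empirical critical radius, for sums
over the sample. -/
lemma measure_pi_exists_deviation_le [Nonempty ι] [Nonempty J] [Countable J] (P : Measure X)
    [IsProbabilityMeasure P] {F : Set (X → ℝ)} (hstar : StarConvex ℝ 0 F) {c : ℝ} (hc : 1 ≤ c)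
    (hF : ∀ g ∈ F, ∀ x, |g x| ≤ c) {f : J → X → ℝ} (hf : ∀ j, f j ∈ F)
    (hfm : ∀ j, Measurable (f j)) {j₀ : J} (h0 : ∀ x, f j₀ x = 0) {ξ : ℝ} (hξ0 : 0 < ξ)
    (hξ1 : ξ < 1) :
    (Measure.pi fun _ : ι => P) {x | ∃ r H, 0 < r ∧ localRad Finset.univ x F r ≤ r ^ 2 / c ∧
        672 * (Real.sqrt (Fintype.card ι) * r + c * Real.sqrt (Real.log (10 / ξ))) ≤ H ∧
        ∃ j, 1 / 2 * (H * Real.sqrt (Fintype.card ι * ∫ x, f j x ^ 2 ∂P) + H ^ 2) <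
            |∑ i, f j (x i) - Fintype.card ι * ∫ x, f j x ∂P| ∨
          1 / 2 * (Fintype.card ι * (∫ x, f j x ^ 2 ∂P) + H ^ 2) <
            |∑ i, f j (x i) ^ 2 - Fintype.card ι * ∫ x, f j x ^ 2 ∂P|} ≤ ENNReal.ofReal ξ := by
  set n : ℝ := (Fintype.card ι : ℝ) with hn
  have hn0 : 0 < n := by rw [hn]; exact_mod_cast Fintype.card_pos
  have hs0 : 0 < Real.sqrt n := Real.sqrt_pos.2 hn0
  -- This makes the probability `5 exp (-L)` of a bad splitting equal to `ξ / 2`; Markov's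
  -- inequality at level `1/2` then doubles it.
  set L := Real.log (10 / ξ) with hLd
  have hexp : Real.exp (-L) = ξ / 10 := by
    rw [hLd, Real.exp_neg, Real.exp_log (by positivity), inv_div]
  have hL1 : 1 ≤ L := by
    rw [hLd, Real.le_log_iff_exp_le (by positivity), le_div_iff₀ hξ0]
    nlinarith [Real.exp_one_lt_d9, Real.exp_pos 1]
  have hL0 : 0 < L := by linarith
  set Q := Measure.pi fun _ : ι => P with hQ
  set B : Set ((ι → X) × (ι → X)) := {p | BadSplit f c L fun i => (p.1 i, p.2 i)} with hB
  have hBpre : {z : ι → X × X | BadSplit f c L z} =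
      (MeasurableEquiv.arrowProdEquivProdArrow X X ι) ⁻¹' B := rfl
  have hmp := measurePreserving_arrowProdEquivProdArrow X X ι (fun _ => P) fun _ => P
  have hBm : MeasurableSet B := by
    have := measurableSet_badSplit (ι := ι) hfm c L
    rwa [hBpre, MeasurableEquiv.measurableSet_preimage] at this
  have hQB : (Q.prod Q) B ≤ ENNReal.ofReal (ξ / 2) := by
    rw [← hmp.measure_preimage hBm.nullMeasurableSet, ← hBpre]
    refine (measure_badSplit_le P hc hL0 hfm (fun j => hF _ (hf j)) h0).trans (le_of_eq ?_)
    rw [hexp]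
    congr 1
    ring
  have hslice : Measurable fun x => Q (Prod.mk x ⁻¹' B) := measurable_measure_prodMk_left hBm
  have hmarkov := mul_meas_ge_le_lintegral₀ (μ := Q) hslice.aemeasurable (2⁻¹ : ENNReal)
  rw [← Measure.prod_apply hBm] at hmarkov
  have hfinal : Q {x | 2⁻¹ ≤ Q (Prod.mk x ⁻¹' B)} ≤ ENNReal.ofReal ξ := by
    have h1 := hmarkov.trans hQB
    have h2 := mul_le_mul_right h1 (2 : ENNReal)
    rw [← mul_assoc, ENNReal.mul_inv_cancel (by norm_num) (by norm_num), one_mul] at h2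
    refine h2.trans (le_of_eq ?_)
    rw [show (2 : ENNReal) = ENNReal.ofReal 2 by simp, ← ENNReal.ofReal_mul (by norm_num)]
    congr 1
    ring
  refine (measure_mono ?_).trans hfinal
  rintro x ⟨r, H, hr, hcrit, hH, j, hj⟩
  -- It remains to see that a deviating sample `x` has a bad slice of mass at least one half. Only
  -- the one witness `j` matters, so Chebyshev's inequality for the ghost sample is enough. Since
  -- `H` is at least `672 c`, each of the two Chebyshev bounds is at most `1/4`, and where both hold
  -- the splitting must be bad.
  have hH1 : 672 * c ≤ H := by
    have h1 : 1 ≤ Real.sqrt L := Real.one_le_sqrt.2 hL1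
    have h2 : 0 < Real.sqrt n * r := by positivity
    nlinarith
  have hH0 : 0 < H := by linarith
  set p2 := n * ∫ x, f j x ^ 2 ∂P with hp2
  have hp20 : 0 ≤ p2 := mul_nonneg hn0.le (integral_nonneg fun _ => sq_nonneg _)
  have hsp : Real.sqrt p2 ^ 2 = p2 := Real.sq_sqrt hp20
  have hsp0 := Real.sqrt_nonneg p2
  have hbd := hF _ (hf j)
  set t1 := 1 / 4 * (H * Real.sqrt p2 + H ^ 2) with ht1
  set t2 := 1 / 8 * (p2 + H ^ 2) with ht2
  have ht1p : 0 < t1 := by positivity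
  have ht2p : 0 < t2 := by positivity
  have hdev1 := measure_pi_deviation_le (ι := ι) P (hfm j) hbd ht1p
  have hdev2 := measure_pi_deviation_le (ι := ι) P ((hfm j).pow_const 2) (b := c ^ 2)
    (fun x => by
      rw [abs_of_nonneg (sq_nonneg _)]
      exact sq_le_sq' (by linarith [abs_le.1 (hbd x)]) (abs_le.1 (hbd x)).2) ht2p
  rw [← hn] at hdev1 hdev2
  rw [← hp2] at hdev1
  have hint : ∀ k : ℕ, Integrable (fun x => f j x ^ k) P := fun k =>
    Integrable.of_bound ((hfm j).pow_const k).aestronglyMeasurable (c ^ k) (ae_of_all _ fun x => by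
      rw [Real.norm_eq_abs, abs_pow]
      exact pow_le_pow_left₀ (abs_nonneg _) (hbd x) k)
  -- Boundedness trades the fourth moment for the second, so the squares too are controlled at the
  -- scale of `p2`.
  have h4 : n * ∫ x, (f j x ^ 2) ^ 2 ∂P ≤ c ^ 2 * p2 := by
    rw [hp2, mul_left_comm, ← integral_const_mul (c ^ 2)]
    refine mul_le_mul_of_nonneg_left (integral_mono ?_ ((hint 2).const_mul _) fun x => ?_) hn0.le
    · simpa only [← pow_mul] using hint 4
    · have : f j x ^ 2 ≤ c ^ 2 := sq_le_sq' (by linarith [abs_le.1 (hbd x)]) (abs_le.1 (hbd x)).2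
      simp only
      nlinarith [sq_nonneg (f j x)]
  have hq1 : p2 / t1 ^ 2 ≤ 1 / 4 := by
    rw [div_le_iff₀ (by positivity)]
    have h5 : 2 * Real.sqrt p2 ≤ t1 := by rw [ht1]; nlinarith
    have h6 := pow_le_pow_left₀ (by positivity) h5 2
    nlinarith
  have hq2 : n * (∫ x, (f j x ^ 2) ^ 2 ∂P) / t2 ^ 2 ≤ 1 / 4 := by
    rw [div_le_iff₀ (by positivity)]
    have h5 : 2 * (c * Real.sqrt p2) ≤ t2 := by
      rw [ht2]
      have h6 : c * Real.sqrt p2 ≤ H * Real.sqrt p2 / 672 := by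
        rw [le_div_iff₀ (by norm_num)]
        nlinarith
      nlinarith [sq_nonneg (H - Real.sqrt p2)]
    have h6 := pow_le_pow_left₀ (by positivity) h5 2
    rw [mul_pow, mul_pow, hsp] at h6
    linarith
  have hsub : (Prod.mk x ⁻¹' B)ᶜ ⊆ {x' | t1 ≤ |∑ i, f j (x' i) - n * ∫ x, f j x ∂P|} ∪
      {x' | t2 ≤ |∑ i, f j (x' i) ^ 2 - n * ∫ x, f j x ^ 2 ∂P|} := by
    intro x' hx'
    by_contra hcon
    rw [Set.mem_union, not_or] at hcon
    have hc1 : |∑ i, f j (x' i) - n * ∫ x, f j x ∂P| < t1 := not_le.1 hcon.1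
    have hc2 : |∑ i, f j (x' i) ^ 2 - p2| < t2 := not_le.1 hcon.2
    obtain ⟨hd1, hd2⟩ := deviation_le_of_not_badSplit hstar hc hF hf hL0
      (z := fun i => (x i, x' i)) hx' hr hcrit hH j
    set N := pairNorm (pairVals f (fun i => (x i, x' i)) j) with hN
    have hN2 : N ^ 2 = ∑ i, f j (x i) ^ 2 + ∑ i, f j (x' i) ^ 2 := by
      rw [hN, pairNorm_sq, ← Finset.sum_add_distrib]
      rfl
    have hd1' : |∑ i, f j (x i) - ∑ i, f j (x' i)| ≤ 1 / 14 * (H * max H N) := by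
      rw [← Finset.sum_sub_distrib]; exact hd1
    have hd2' : |∑ i, f j (x i) ^ 2 - ∑ i, f j (x' i) ^ 2| ≤ 1 / 8 * max H N ^ 2 := by
      rw [← Finset.sum_sub_distrib]; exact hd2
    obtain ⟨e1, e2⟩ := ghost_arithmetic hH0.le hsp0 hN2 hd1' hd2' (by rwa [ht1] at hc1)
      (by rw [ht2] at hc2; rwa [hsp])
    rcases hj with hj | hj
    · exact absurd hj (not_lt.2 e1)
    · exact absurd hj (not_lt.2 (by rwa [hsp] at e2))
  have hhalf : Q (Prod.mk x ⁻¹' B)ᶜ ≤ 2⁻¹ := by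
    refine (measure_mono hsub).trans ((measure_union_le _ _).trans ?_)
    refine (add_le_add (hdev1.trans (ENNReal.ofReal_le_ofReal hq1))
      (hdev2.trans (ENNReal.ofReal_le_ofReal hq2))).trans (le_of_eq ?_)
    rw [← ENNReal.ofReal_add (by norm_num) (by norm_num), show (2⁻¹ : ENNReal) =
      ENNReal.ofReal (2⁻¹) by rw [ENNReal.ofReal_inv_of_pos (by norm_num)]; simp]
    norm_num
  have hBx : MeasurableSet (Prod.mk x ⁻¹' B) := measurable_prodMk_left hBm
  rw [prob_compl_eq_one_sub hBx, tsub_le_iff_left] at hhalf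
  change 2⁻¹ ≤ Q (Prod.mk x ⁻¹' B)
  have h10 : (1 : ENNReal) = 2⁻¹ + 2⁻¹ := ENNReal.inv_two_add_inv_two.symm
  rw [h10] at hhalf
  exact (ENNReal.add_le_add_iff_right (by norm_num)).1 hhalf

end Ghost

/-! ### Uniform deviations for an i.i.d. sample. -/

section Uniform

variable {ι : Type*} {X : Type*} [MeasurableSpace X]

set_option linter.unusedSectionVars false

/-- Empirical means over the class `F` and its squares are close to their expectations, at
scale `η`. -/
def UniformlyClose (P : Measure X) (D : Finset ι) (x : ι → X) (F : Set (X → ℝ)) (η : ℝ) : Prop :=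
  ∀ f ∈ F, |empMean D x f - ∫ x, f x ∂P| ≤ 1 / 2 * (η * Real.sqrt (∫ x, f x ^ 2 ∂P) + η ^ 2) ∧
    |empMean D x (fun a => f a ^ 2) - ∫ x, f x ^ 2 ∂P| ≤ 1 / 2 * ((∫ x, f x ^ 2 ∂P) + η ^ 2)

/-- Both bounds are non-strict and every term passes to the limit under bounded pointwise
convergence. This reduces a class to a countable one, where suprema are measurable. -/
lemma uniformlyClose_of_dense {P : Measure X} [IsFiniteMeasure P] {D : Finset ι} {x : ι → X}
    {F F₀ : Set (X → ℝ)} {c η : ℝ} (hF₀ : ∀ f ∈ F₀, Measurable f) (hb : ∀ f ∈ F₀, ∀ x, |f x| ≤ c)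
    (hd : ∀ f ∈ F, ∃ s : ℕ → X → ℝ, (∀ n, s n ∈ F₀) ∧
      ∀ a, Tendsto (fun n => s n a) atTop (𝓝 (f a)))
    (h : UniformlyClose P D x F₀ η) : UniformlyClose P D x F η := by
  intro f hf
  obtain ⟨s, hs, hlim⟩ := hd f hf
  have h1 : Tendsto (fun n => ∫ x, s n x ∂P) atTop (𝓝 (∫ x, f x ∂P)) :=
    tendsto_integral_of_dominated_convergence (fun _ => c)
      (fun n => (hF₀ _ (hs n)).aestronglyMeasurable) (integrable_const _)
      (fun n => ae_of_all _ (hb _ (hs n))) (ae_of_all _ hlim)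
  have h2 : Tendsto (fun n => ∫ x, s n x ^ 2 ∂P) atTop (𝓝 (∫ x, f x ^ 2 ∂P)) :=
    tendsto_integral_of_dominated_convergence (fun _ => c ^ 2)
      (fun n => ((hF₀ _ (hs n)).pow_const 2).aestronglyMeasurable) (integrable_const _)
      (fun n => ae_of_all _ fun x => by
        rw [Real.norm_eq_abs, abs_pow]
        exact pow_le_pow_left₀ (abs_nonneg _) (hb _ (hs n) x) 2)
      (ae_of_all _ fun a => (hlim a).pow 2)
  have h3 : Tendsto (fun n => empMean D x (s n)) atTop (𝓝 (empMean D x f)) :=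
    (tendsto_finsetSum _ fun i _ => hlim (x i)).div_const _
  have h4 : Tendsto (fun n => empMean D x fun a => s n a ^ 2) atTop
      (𝓝 (empMean D x fun a => f a ^ 2)) :=
    (tendsto_finsetSum _ fun i _ => (hlim (x i)).pow 2).div_const _
  have h5 := (Real.continuous_sqrt.tendsto _).comp h2
  refine ⟨le_of_tendsto_of_tendsto' (h3.sub h1).abs
    (((h5.const_mul η).add_const (η ^ 2)).const_mul (1 / 2)) fun n => (h _ (hs n)).1,
    le_of_tendsto_of_tendsto' (h4.sub h2).abs ((h2.add_const (η ^ 2)).const_mul (1 / 2))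
      fun n => (h _ (hs n)).2⟩

/-- Uniform deviations over a star-shaped class in terms of its empirical critical radius, for an
i.i.d. sample. -/
lemma measure_pi_not_uniformlyClose_le [Fintype ι] [DecidableEq ι] [Nonempty ι] (P : Measure X)
    [IsProbabilityMeasure P] {F : Set (X → ℝ)} (hne : F.Nonempty) (hstar : StarConvex ℝ 0 F)
    (hmeas : PointwiseMeasurable F) {c : ℝ} (hc : 1 ≤ c) (hF : ∀ g ∈ F, ∀ x, |g x| ≤ c) {ξ : ℝ}
    (hξ0 : 0 < ξ) (hξ1 : ξ < 1) :
    (Measure.pi fun _ : ι => P) {x | ∃ η, BoundsCriticalRadius 672 10 ξ Finset.univ x F c η ∧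
      ¬ UniformlyClose P Finset.univ x F η} ≤ ENNReal.ofReal ξ := by
  obtain ⟨hFm, F₀, hF₀, hcount, hd⟩ := hmeas
  have h0F : (0 : X → ℝ) ∈ F := by
    obtain ⟨f, hf⟩ := hne
    simpa using hstar hf zero_le_one le_rfl (by norm_num)
  -- The zero function is adjoined because scaling the clipping radius needs it in the family.
  have hins : insert 0 F₀ ⊆ F := Set.insert_subset h0F hF₀
  have : Countable ↥(insert (0 : X → ℝ) F₀) := (hcount.insert 0).to_subtype
  have : Nonempty ↥(insert (0 : X → ℝ) F₀) := ⟨⟨0, Set.mem_insert _ _⟩⟩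
  refine (measure_mono ?_).trans (measure_pi_exists_deviation_le (ι := ι)
    (J := ↥(insert (0 : X → ℝ) F₀)) P hstar hc hF (f := Subtype.val) (fun j => hins j.2)
    (fun j => hFm _ (hins j.2)) (j₀ := ⟨0, Set.mem_insert _ _⟩) (fun _ => rfl) hξ0 hξ1)
  rintro x ⟨η, ⟨-, r, ⟨hr, hcrit⟩, hη⟩, hnot⟩
  set n : ℝ := (Fintype.card ι : ℝ) with hn
  have hn0 : 0 < n := by rw [hn]; exact_mod_cast Fintype.card_pos
  have hs0 : 0 < Real.sqrt n := Real.sqrt_pos.2 hn0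
  have hss : Real.sqrt n ^ 2 = n := Real.sq_sqrt hn0.le
  rw [Finset.card_univ, ← hn] at hη
  -- The scale for sums is `√n` times the scale for means; dividing the sum inequalities by `n`
  -- gives the stated ones.
  refine ⟨r, Real.sqrt n * η, hr, hcrit, ?_, ?_⟩
  · have h1 := mul_le_mul_of_nonneg_left hη hs0.le
    rw [Real.sqrt_div' _ hn0.le] at h1
    refine le_trans (le_of_eq ?_) h1
    field_simp
  · by_contra hcon
    refine hnot (uniformlyClose_of_dense (F₀ := insert 0 F₀) (fun f hf => hFm f (hins hf))
      (fun f hf => hF f (hins hf)) (fun f hf => ?_) fun f hf => ?_)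
    · obtain ⟨s, hs, hl⟩ := hd f hf
      exact ⟨s, fun n => Set.mem_insert_of_mem _ (hs n), hl⟩
    · push Not at hcon
      obtain ⟨h1, h2⟩ := hcon ⟨f, hf⟩
      simp only at h1 h2
      have hm : ∀ g : X → ℝ, ∑ i, g (x i) = n * empMean Finset.univ x g := by
        intro g
        rw [empMean, Finset.card_univ, ← hn]
        field_simp
      rw [hm f, ← mul_sub, abs_mul, abs_of_pos hn0, Real.sqrt_mul hn0.le] at h1
      rw [hm fun a => f a ^ 2, ← mul_sub, abs_mul, abs_of_pos hn0] at h2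
      refine ⟨le_of_mul_le_mul_left (h1.trans (le_of_eq ?_)) hn0,
        le_of_mul_le_mul_left (h2.trans (le_of_eq ?_)) hn0⟩
      · linear_combination (1 / 2 * (η * Real.sqrt (∫ x, f x ^ 2 ∂P)) + 1 / 2 * η ^ 2) * hss
      · linear_combination (1 / 2 * η ^ 2) * hss

end Uniform

/-! ### Sub-samples selected by the data. -/

section SubSample

variable {ι : Type*} [Fintype ι] [DecidableEq ι] {X : Type*}

set_option linter.unusedSectionVars false

lemma empMean_subtype (D : Finset ι) (x : ι → X) (f : X → ℝ) :
    empMean (Finset.univ : Finset D) (fun t : D => x t) f = empMean D x f := by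
  unfold empMean
  rw [Finset.card_univ, Fintype.card_coe, Finset.sum_coe_sort D fun t => f (x t)]

lemma empNorm_subtype (D : Finset ι) (x : ι → X) (f : X → ℝ) :
    empNorm (Finset.univ : Finset D) (fun t : D => x t) f = empNorm D x f := by
  unfold empNorm
  rw [empMean_subtype]

/-- Signs of trials outside `D` do not enter the sums, so averaging over them changes nothing. -/
lemma localRad_subtype (D : Finset ι) (x : ι → X) (F : Set (X → ℝ)) (r : ℝ) :
    localRad (Finset.univ : Finset D) (fun t : D => x t) F r = localRad D x F r := by
  unfold localRad
  simp only [empNorm_subtype, Finset.card_univ, Fintype.card_coe]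
  have h : ∀ (ε : ι → Bool) (f : X → ℝ), ∑ i ∈ D, rsign (ε i) * f (x i) =
      ∑ i : D, rsign (ε i) * f (x i) := fun ε f =>
    (Finset.sum_coe_sort D fun t => rsign (ε t) * f (x t)).symm
  simp only [h]
  exact (cubeAvg_comp_subtype (fun t => t ∈ D) fun ε : D → Bool =>
    sSup ((fun f : X → ℝ => (∑ i : D, rsign (ε i) * f (x i)) / (D.card : ℝ)) ''
        {f | f ∈ F ∧ empNorm D x f ≤ r})).symm

lemma boundsCriticalRadius_subtype {c₀ c₁ ξ : ℝ} {D : Finset ι} {x : ι → X} {F : Set (X → ℝ)}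
    {c η : ℝ} (h : BoundsCriticalRadius c₀ c₁ ξ D x F c η) :
    BoundsCriticalRadius c₀ c₁ ξ (Finset.univ : Finset D) (fun t : D => x t) F c η := by
  obtain ⟨h1, r, ⟨h2, h3⟩, h4⟩ := h
  refine ⟨by simpa using h1, r, ⟨h2, by rwa [localRad_subtype]⟩, ?_⟩
  rwa [Finset.card_univ, Fintype.card_coe]

/-- Truncation to a set carrying the data leaves empirical quantities unchanged. It serves to
replace a class bounded only on such a set by one bounded everywhere. -/
lemma localRad_image_indicator {D : Finset ι} {x : ι → X} {G : Set X} (hG : ∀ t ∈ D, x t ∈ G)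
    (F : Set (X → ℝ)) (r : ℝ) :
    localRad D x (G.indicator '' F) r = localRad D x F r := by
  have h1 : ∀ f : X → ℝ, empNorm D x (G.indicator f) = empNorm D x f := by
    intro f
    unfold empNorm empMean
    congr 2
    exact Finset.sum_congr rfl fun t ht => by simp only [Set.indicator_of_mem (hG t ht)]
  have h2 : {f | f ∈ G.indicator '' F ∧ empNorm D x f ≤ r} =
      G.indicator '' {f | f ∈ F ∧ empNorm D x f ≤ r} := by
    ext f
    constructor
    · rintro ⟨⟨g, hg, rfl⟩, hn⟩
      exact ⟨g, ⟨hg, by rwa [h1] at hn⟩, rfl⟩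
    · rintro ⟨g, ⟨hg, hn⟩, rfl⟩
      exact ⟨⟨g, hg, rfl⟩, by rwa [h1]⟩
  unfold localRad
  simp only [h2, Set.image_image]
  congr 1
  refine Finset.sum_congr rfl fun ε _ => ?_
  congr 1
  refine Set.image_congr fun f _ => ?_
  congr 1
  exact Finset.sum_congr rfl fun t ht => by rw [Set.indicator_of_mem (hG t ht)]

variable [MeasurableSpace X]

lemma pi_smul_measure {κ : Type*} [Fintype κ] (a : ENNReal) (ha : a ≠ ⊤) (P : Measure X)
    [IsFiniteMeasure P] :
    (Measure.pi fun _ : κ => a • P) = a ^ Fintype.card κ • Measure.pi fun _ : κ => P := by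
  have : IsFiniteMeasure (a • P) := P.smul_finite ha
  refine Measure.pi_eq fun s _ => ?_
  rw [Measure.smul_apply, Measure.pi_pi]
  simp [Finset.prod_mul_distrib]

open Classical in
/-- The part of the sample that falls into `A`, given which indices it occupies, is an i.i.d. sample
of the conditional law. -/
lemma measure_pi_subsample_le (P : Measure X) [IsProbabilityMeasure P] {A : Set X}
    (hA : MeasurableSet A) (S : Finset ι) (hS : S.Nonempty) {B : Set (S → X)} {b : ENNReal}
    (hB : MeasurableSet B)
    (hb : P A ≠ 0 → (Measure.pi fun _ : S => ProbabilityTheory.cond P A) B ≤ b) :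
    (Measure.pi fun _ : ι => P) {d | (∀ t, d t ∈ A ↔ t ∈ S) ∧ (fun t : S => d t) ∈ B} ≤
      P A ^ S.card * P Aᶜ ^ (Fintype.card ι - S.card) * b := by
  have hmp := measurePreserving_piEquivPiSubtypeProd (fun _ : ι => P) fun t => t ∈ S
  set e := MeasurableEquiv.piEquivPiSubtypeProd (fun _ : ι => X) fun t => t ∈ S with he
  have hset : {d : ι → X | (∀ t, d t ∈ A ↔ t ∈ S) ∧ (fun t : S => d t) ∈ B} =
      e ⁻¹' ((B ∩ Set.univ.pi fun _ => A) ×ˢ (Set.univ.pi fun _ => Aᶜ)) := by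
    ext d
    simp only [he, MeasurableEquiv.piEquivPiSubtypeProd, Set.mem_preimage, Set.mem_prod,
      Set.mem_inter_iff, Set.mem_pi, Set.mem_univ, true_implies, Set.mem_ofPred_eq,
      MeasurableEquiv.coe_mk, Equiv.piEquivPiSubtypeProd, Equiv.coe_fn_mk, Set.mem_compl_iff,
      Subtype.forall]
    constructor
    · rintro ⟨h1, h2⟩
      exact ⟨⟨h2, fun t ht => (h1 t).2 ht⟩, fun t ht h => ht ((h1 t).1 h)⟩
    · rintro ⟨⟨h1, h2⟩, h3⟩
      exact ⟨fun t => ⟨fun h => by_contra fun ht => h3 t ht h, fun h => h2 t h⟩, h1⟩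
  rw [hset, hmp.measure_preimage
    ((hB.inter (MeasurableSet.univ_pi fun _ => hA)).prod
      (MeasurableSet.univ_pi fun _ => hA.compl)).nullMeasurableSet, Measure.prod_prod,
    Measure.pi_pi]
  have hcard : Fintype.card {t // t ∉ S} = Fintype.card ι - S.card := by
    rw [Fintype.card_subtype_compl, Fintype.card_coe]
  rw [Finset.prod_const, Finset.card_univ, hcard, mul_right_comm]
  gcongr
  suffices h : (Measure.pi fun _ : S => P) (B ∩ Set.univ.pi fun _ => A) ≤ P A ^ S.card * b by
    have hi : ∀ i₁ i₂ : Fintype S, @Measure.pi S (fun _ => X) i₁ _ (fun _ => P) =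
        @Measure.pi S (fun _ => X) i₂ _ fun _ => P := fun i₁ i₂ => by rw [Subsingleton.elim i₁ i₂]
    rw [hi _ (Finset.Subtype.fintype S)]
    exact h
  rw [← Measure.restrict_apply hB, Measure.restrict_pi_pi]
  rcases eq_or_ne (P A) 0 with h0 | h0
  · have : (Measure.pi fun _ : S => P.restrict A) B ≤ 0 := by
      refine (measure_mono (Set.subset_univ _)).trans (le_of_eq ?_)
      rw [Measure.pi_univ]
      obtain ⟨t, ht⟩ := hS
      exact Finset.prod_eq_zero (Finset.mem_univ ⟨t, ht⟩) (by simp [h0])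
    exact this.trans zero_le
  -- The restriction is `P A` times the conditional law; each index in `S` contributes one such
  -- factor to the product measure.
  · have hr : P.restrict A = P A • ProbabilityTheory.cond P A := by
      rw [ProbabilityTheory.cond, smul_smul, ENNReal.mul_inv_cancel h0 (measure_ne_top _ _),
        one_smul]
    simp only [hr]
    rw [pi_smul_measure _ (measure_ne_top _ _), Measure.smul_apply, smul_eq_mul,
      Fintype.card_coe]
    gcongr
    exact hb h0

open Classical in
/-- Uniform deviations over a star-shaped class in terms of its empirical critical radius, on the
sub-sample of the observations that fall into `A`. -/
lemma measure_pi_subsample_not_uniformlyClose_le (P : Measure X) [IsProbabilityMeasure P]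
    {A G : Set X} (hA : MeasurableSet A) (hG : MeasurableSet G) (hGP : ∀ᵐ x ∂P, x ∈ G)
    {F : Set (X → ℝ)} (hstar : StarConvex ℝ 0 F) (hmeas : PointwiseMeasurable F) {c : ℝ}
    (hc : 1 ≤ c) (hF : ∀ g ∈ F, ∀ x ∈ G, |g x| ≤ c) {ξ : ℝ} (hξ0 : 0 < ξ) (hξ1 : ξ < 1) :
    (Measure.pi fun _ : ι => P) {d | ∃ η,
      BoundsCriticalRadius 672 10 ξ (Finset.univ.filter fun t => d t ∈ A) d F c η ∧
      ¬ UniformlyClose (ProbabilityTheory.cond P A) (Finset.univ.filter fun t => d t ∈ A) d F η} ≤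
      ENNReal.ofReal ξ := by
  rcases F.eq_empty_or_nonempty with rfl | hne
  · simp [UniformlyClose]
  set F' := G.indicator '' F with hF'
  have hne' : F'.Nonempty := hne.image _
  have hstar' : StarConvex ℝ 0 F' := by
    rintro _ ⟨f, hf, rfl⟩ a b ha hb hab
    refine ⟨_, hstar hf ha hb hab, ?_⟩
    funext x
    by_cases hx : x ∈ G <;> simp [hx]
  have hmeas' : PointwiseMeasurable F' := by
    obtain ⟨h1, F₀, h2, h3, h4⟩ := hmeas
    refine ⟨?_, G.indicator '' F₀, Set.image_mono h2, h3.image _, ?_⟩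
    · rintro _ ⟨f, hf, rfl⟩
      exact (h1 f hf).indicator hG
    · rintro _ ⟨f, hf, rfl⟩
      obtain ⟨s, hs, hl⟩ := h4 f hf
      refine ⟨fun n => G.indicator (s n), fun n => ⟨_, hs n, rfl⟩, fun a => ?_⟩
      by_cases ha : a ∈ G <;> simp [ha, hl]
  have hFc' : ∀ g ∈ F', ∀ x, |g x| ≤ c := by
    rintro _ ⟨f, hf, rfl⟩ x
    by_cases hx : x ∈ G
    · simpa [hx] using hF f hf x hx
    · simpa [hx] using by linarith
  set bad : ∀ S : Finset ι, Set (S → X) := fun S => {x | ∃ η,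
    BoundsCriticalRadius 672 10 ξ Finset.univ x F' c η ∧
      ¬ UniformlyClose (ProbabilityTheory.cond P A) Finset.univ x F' η} with hbad
  -- The bad event quantifies over all scales and over an uncountable class, so a measurable hull of
  -- the same measure stands in for it.
  set B : ∀ S : Finset ι, Set (S → X) := fun S =>
    toMeasurable (Measure.pi fun _ : S => ProbabilityTheory.cond P A) (bad S) with hB
  have hBS : ∀ S : Finset ι, S.Nonempty → P A ≠ 0 →
      (Measure.pi fun _ : S => ProbabilityTheory.cond P A) (B S) ≤ ENNReal.ofReal ξ := by
    intro S hS hPA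
    have := ProbabilityTheory.cond_isProbabilityMeasure (μ := P) hPA
    have : Nonempty S := hS.to_subtype
    rw [hB, measure_toMeasurable]
    exact measure_pi_not_uniformlyClose_le _ hne' hstar' hmeas' hc hFc' hξ0 hξ1
  have hnull : (Measure.pi fun _ : ι => P) {d | ¬ ∀ t, d t ∈ G} = 0 := by
    rw [← ae_iff, ae_all_iff]
    intro t
    exact (measurePreserving_eval (fun _ : ι => P) t).quasiMeasurePreserving.ae hGP
  have hsub : {d : ι → X | ∃ η,
      BoundsCriticalRadius 672 10 ξ (Finset.univ.filter fun t => d t ∈ A) d F c η ∧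
      ¬ UniformlyClose (ProbabilityTheory.cond P A) (Finset.univ.filter fun t => d t ∈ A) d F η} ⊆
      {d | ¬ ∀ t, d t ∈ G} ∪ ⋃ S ∈ (Finset.univ.filter fun S : Finset ι => S.Nonempty),
        {d | (∀ t, d t ∈ A ↔ t ∈ S) ∧ (fun t : S => d t) ∈ B S} := by
    rintro d ⟨η, hη, hnot⟩
    by_cases hdG : ∀ t, d t ∈ G
    swap
    · exact Or.inl hdG
    right
    set S := Finset.univ.filter fun t => d t ∈ A with hS
    simp only [Set.mem_iUnion, Finset.mem_filter, Finset.mem_univ, true_and]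
    refine ⟨S, Finset.card_pos.1 hη.1, fun t => by simp [hS], subset_toMeasurable _ _ ?_⟩
    refine ⟨η, ?_, fun hcl => hnot fun f hf => ?_⟩
    · refine boundsCriticalRadius_subtype ?_
      obtain ⟨h1, r, ⟨h2, h3⟩, h4⟩ := hη
      exact ⟨h1, r, ⟨h2, by rwa [hF', localRad_image_indicator fun t _ => hdG t]⟩, h4⟩
    · have h1 := hcl _ ⟨f, hf, rfl⟩
      rw [empMean_subtype, empMean_subtype] at h1
      have hae : ∀ᵐ x ∂(ProbabilityTheory.cond P A), G.indicator f x = f x :=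
        ProbabilityTheory.cond_absolutelyContinuous.ae_le
          (hGP.mono fun x hx => Set.indicator_of_mem hx f)
      have e1 : ∫ x, G.indicator f x ∂(ProbabilityTheory.cond P A) =
          ∫ x, f x ∂(ProbabilityTheory.cond P A) := integral_congr_ae hae
      have e2 : ∫ x, G.indicator f x ^ 2 ∂(ProbabilityTheory.cond P A) =
          ∫ x, f x ^ 2 ∂(ProbabilityTheory.cond P A) :=
        integral_congr_ae (hae.mono fun x hx => by simp only [hx])
      have e3 : empMean S d (G.indicator f) = empMean S d f := by
        unfold empMean
        simp only [Set.indicator_of_mem (hdG _)]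
      have e4 : empMean S d (fun a => G.indicator f a ^ 2) = empMean S d fun a => f a ^ 2 := by
        unfold empMean
        simp only [Set.indicator_of_mem (hdG _)]
      rwa [e1, e2, e3, e4] at h1
  refine (measure_mono hsub).trans ((measure_union_le _ _).trans ?_)
  rw [hnull, zero_add]
  refine (measure_biUnion_finset_le _ _).trans ?_
  -- The events indexed by `S` are weighted by the probability that exactly the trials in `S` fall
  -- into `A`. These weights sum to one by the binomial formula, so the decomposition costs nothing.
  calc _ ≤ ∑ S ∈ (Finset.univ.filter fun S : Finset ι => S.Nonempty),
        P A ^ S.card * P Aᶜ ^ (Fintype.card ι - S.card) * ENNReal.ofReal ξ := by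
        refine Finset.sum_le_sum fun S hS => ?_
        have hS' := (Finset.mem_filter.1 hS).2
        exact measure_pi_subsample_le P hA S hS' (measurableSet_toMeasurable _ _) (hBS S hS')
    _ ≤ ∑ S : Finset ι, P A ^ S.card * P Aᶜ ^ (Fintype.card ι - S.card) * ENNReal.ofReal ξ :=
        Finset.sum_le_sum_of_subset (Finset.filter_subset _ _)
    _ = ENNReal.ofReal ξ := by
        rw [← Finset.sum_mul, Fintype.sum_pow_mul_eq_add_pow, prob_add_prob_compl hA, one_pow,
          one_mul]

end SubSample

/-! ### Change of measure through image laws. -/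

section Reweighting

variable {α β : Type*} [MeasurableSpace α] [MeasurableSpace β]

lemma map_withDensity_comp (μ : Measure α) {τ : α → β} (hτ : Measurable τ) {u : β → ENNReal}
    (hu : Measurable u) :
    (μ.withDensity fun p => u (τ p)).map τ = (μ.map τ).withDensity u := by
  refine Measure.ext_of_lintegral _ fun F hF => ?_
  have hFc : Measurable fun p => F (τ p) := hF.comp hτ
  have huc : Measurable fun p => u (τ p) := hu.comp hτ
  rw [lintegral_map hF hτ, lintegral_withDensity_eq_lintegral_mul _ huc hFc,
    lintegral_withDensity_eq_lintegral_mul _ hu hF, lintegral_map (hu.mul hF) hτ]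
  rfl

/-- Change of measure by a Radon-Nikodym derivative of image laws, when the base measure itself is
reweighted by a function of the image variable. -/
lemma integral_rnDeriv_comp_withDensity (μ : Measure α) [IsFiniteMeasure μ] {τ : α → β}
    (hτ : Measurable τ) {u v : β → ENNReal} (hu : Measurable u) (hv : Measurable v)
    {ν : Measure α} [IsFiniteMeasure ν] (hν : ν = μ.withDensity fun p => u (τ p))
    {N : Measure β} [IsFiniteMeasure N] (hN : N = (μ.map τ).withDensity v) (hac : N ≪ ν.map τ)
    (F : α → ℝ) :
    ∫ p, (N.rnDeriv (ν.map τ) (τ p)).toReal * F p ∂ν = ∫ p, (v (τ p)).toReal * F p ∂μ := by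
  have hmap : ν.map τ = (μ.map τ).withDensity u := by rw [hν, map_withDensity_comp μ hτ hu]
  have hr : Measurable (N.rnDeriv (ν.map τ)) := Measure.measurable_rnDeriv _ _
  -- Both sides are `N`, so `u` times the derivative equals `v` almost everywhere. This form avoids
  -- dividing by `u`, which may vanish.
  have h1 : (μ.map τ).withDensity (u * N.rnDeriv (ν.map τ)) = (μ.map τ).withDensity v := by
    rw [withDensity_mul _ hu hr, ← hmap, Measure.withDensity_rnDeriv_eq _ _ hac, hN]
  have hfin : ∫⁻ y, (u * N.rnDeriv (ν.map τ)) y ∂(μ.map τ) ≠ ⊤ := by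
    rw [← setLIntegral_univ, ← withDensity_apply _ MeasurableSet.univ, h1, ← hN]
    exact measure_ne_top _ _
  have h2 := (withDensity_eq_iff (hu.mul hr).aemeasurable hv.aemeasurable hfin).1 h1
  have h3 := ae_of_ae_map hτ.aemeasurable h2
  have hut : ∀ᵐ p ∂μ, u (τ p) < ⊤ := by
    refine ae_lt_top (hu.comp hτ) ?_
    rw [← setLIntegral_univ, ← withDensity_apply _ MeasurableSet.univ, ← hν]
    exact measure_ne_top _ _
  have huc : Measurable fun p => u (τ p) := hu.comp hτ
  generalize N.rnDeriv (ν.map τ) = r at *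
  rw [hν, integral_withDensity_eq_integral_toReal_smul huc hut]
  refine integral_congr_ae ?_
  filter_upwards [h3] with p hp
  simp only [Pi.mul_apply] at hp
  rw [← hp, ENNReal.toReal_mul, smul_eq_mul, mul_assoc]

end Reweighting

/-! ### Missingness as a reweighting of the complete data. -/

section Observed

variable {𝒰 𝒳 𝒜 𝒵 𝒲 : Type*}

/-- The trial without the missingness indicators. -/
def forget (o : Trial 𝒰 𝒳 𝒜 𝒵 𝒲) : Core 𝒰 𝒳 𝒜 𝒵 𝒲 × 𝒜 := (o.1.1, o.2)

/-- The missingness conditions as events of the indicators. -/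
def maskBool : Fin 4 → Set (Bool × Bool × Bool) :=
  ![{true} ×ˢ {true} ×ˢ Set.univ, {true} ×ˢ {true} ×ˢ {true}, {true} ×ˢ Set.univ ×ˢ {true},
    {true} ×ˢ Set.univ ×ˢ Set.univ]

lemma mem_mask_iff (k : Fin 4) (o : Trial 𝒰 𝒳 𝒜 𝒵 𝒲) : o ∈ mask k ↔ o.1.2 ∈ maskBool k := by
  obtain ⟨⟨c, rx, rz, rw'⟩, a⟩ := o
  fin_cases k <;>
    simp [mask, maskBool, vRX, vRZ, vRW] <;> tauto

variable [MeasurableSpace 𝒰] [MeasurableSpace 𝒳] [MeasurableSpace 𝒜] [MeasurableSpace 𝒵]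
  [MeasurableSpace 𝒲]

lemma measurable_forget : Measurable (forget : Trial 𝒰 𝒳 𝒜 𝒵 𝒲 → _) := by
  unfold forget; fun_prop

lemma measurableSet_maskBool (k : Fin 4) : MeasurableSet (maskBool k) := (Set.toFinite _).measurableSet

lemma measurableSet_mask (k : Fin 4) : MeasurableSet (mask k : Set (Trial 𝒰 𝒳 𝒜 𝒵 𝒲)) := by
  have : (mask k : Set (Trial 𝒰 𝒳 𝒜 𝒵 𝒲)) = (fun o => o.1.2) ⁻¹' maskBool k := by
    ext o; exact mem_mask_iff k o
  rw [this]
  exact (measurable_fst.snd) (measurableSet_maskBool k)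

variable (M : PVModel 𝒰 𝒳 𝒜 𝒵 𝒲)

/-- Conditional probability of the `k`-th missingness condition given the other variables. -/
def PVModel.obsProb (k : Fin 4) (c : Core 𝒰 𝒳 𝒜 𝒵 𝒲) : ENNReal := M.missKernel c (maskBool k)

lemma PVModel.measurable_obsProb (k : Fin 4) : Measurable (M.obsProb k) :=
  Kernel.measurable_coe _ (measurableSet_maskBool k)

/-- Conditional probability of observing the outcome proxy. -/
def PVModel.obsProbW (p : 𝒲 × 𝒳 × 𝒜) : ENNReal := M.mW p {true}

lemma PVModel.measurable_obsProbW : Measurable M.obsProbW :=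
  Kernel.measurable_coe _ (measurableSet_singleton _)

lemma PVModel.obsProb_zero (c : Core 𝒰 𝒳 𝒜 𝒵 𝒲) : M.obsProb 0 c =
    M.mX c.1.1.1 {true} * M.mZ (c.1.1.2.2.1, c.1.1.2.1, c.1.2, c.1.1.1) {true} := by
  change M.missKernel c ({true} ×ˢ {true} ×ˢ Set.univ) = _
  simp only [PVModel.missKernel, Kernel.prod_apply_prod, Kernel.comap_apply, measure_univ, mul_one]

lemma PVModel.obsProb_three (c : Core 𝒰 𝒳 𝒜 𝒵 𝒲) :
    M.obsProb 3 c = M.mX c.1.1.1 {true} := by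
  change M.missKernel c ({true} ×ˢ Set.univ ×ˢ Set.univ) = _
  simp only [PVModel.missKernel, Kernel.prod_apply_prod, Kernel.comap_apply, measure_univ, mul_one]

/-- Given the core, `R_W` is independent of the other indicators and its law depends on `(W, X, A)`
only. The passage between the two conditions is thus a density in variables that the ratio in `b2`
sees. -/
lemma PVModel.obsProb_one (c : Core 𝒰 𝒳 𝒜 𝒵 𝒲) :
    M.obsProb 1 c = M.obsProb 0 c * M.obsProbW (c.1.1.2.2.2, c.1.1.1, c.1.2) := by
  rw [M.obsProb_zero]
  change M.missKernel c ({true} ×ˢ {true} ×ˢ {true}) = _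
  simp only [PVModel.obsProbW, PVModel.missKernel, Kernel.prod_apply_prod, Kernel.comap_apply,
    mul_assoc]

/-- The same factorization, now between the laws linked by `b3`. -/
lemma PVModel.obsProb_two (c : Core 𝒰 𝒳 𝒜 𝒵 𝒲) :
    M.obsProb 2 c = M.obsProb 3 c * M.obsProbW (c.1.1.2.2.2, c.1.1.1, c.1.2) := by
  rw [M.obsProb_three]
  change M.missKernel c ({true} ×ˢ Set.univ ×ˢ {true}) = _
  simp only [PVModel.obsProbW, PVModel.missKernel, Kernel.prod_apply_prod, Kernel.comap_apply,
    measure_univ, one_mul]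

lemma PVModel.lintegral_law {F : Trial 𝒰 𝒳 𝒜 𝒵 𝒲 → ENNReal} (hF : Measurable F) :
    ∫⁻ o, F o ∂M.law = ∫⁻ c, ∫⁻ a', ∫⁻ m, F ((c, m), a') ∂(M.missKernel c) ∂M.pseudo ∂M.obsCore := by
  rw [PVModel.law, lintegral_prod_symm' _ hF]
  have h1 : ∀ a', ∫⁻ x, F (x, a') ∂(M.obsCore ⊗ₘ M.missKernel) =
      ∫⁻ c, ∫⁻ m, F ((c, m), a') ∂(M.missKernel c) ∂M.obsCore := fun a' =>
    Measure.lintegral_compProd (hF.comp (by fun_prop))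
  simp_rw [h1]
  rw [lintegral_lintegral_swap]
  have h2 : Measurable fun q : (𝒜 × Core 𝒰 𝒳 𝒜 𝒵 𝒲) × (Bool × Bool × Bool) =>
      F ((q.1.2, q.2), q.1.1) := hF.comp (by fun_prop)
  exact (Measurable.lintegral_kernel_prod_right' (κ := M.missKernel.comap Prod.snd measurable_snd)
    h2).aemeasurable

/-- The law of the trial without its missingness indicators. -/
lemma PVModel.map_forget_law : M.law.map forget = M.obsCore.prod M.pseudo := by
  refine Measure.ext_of_lintegral _ fun F hF => ?_
  have hFf : Measurable fun o : Trial 𝒰 𝒳 𝒜 𝒵 𝒲 => F (forget o) := hF.comp measurable_forget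
  rw [lintegral_map hF measurable_forget, M.lintegral_law hFf,
    lintegral_prod _ hF.aemeasurable]
  simp [forget]

/-- Conditioning on a missingness condition amounts to a reweighting. -/
lemma PVModel.map_forget_μ (k : Fin 4) (h0 : M.law (mask k) ≠ 0) : (M.μ k).map forget =
    (M.obsCore.prod M.pseudo).withDensity fun p => (M.law (mask k))⁻¹ * M.obsProb k p.1 := by
  refine Measure.ext_of_lintegral _ fun F hF => ?_
  have hm := measurableSet_mask (𝒰 := 𝒰) (𝒳 := 𝒳) (𝒜 := 𝒜) (𝒵 := 𝒵) (𝒲 := 𝒲) k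
  have hFf : Measurable fun o : Trial 𝒰 𝒳 𝒜 𝒵 𝒲 => F (forget o) := hF.comp measurable_forget
  have hw : Measurable fun p : Core 𝒰 𝒳 𝒜 𝒵 𝒲 × 𝒜 => (M.law (mask k))⁻¹ * M.obsProb k p.1 :=
    ((M.measurable_obsProb k).comp measurable_fst).const_mul _
  rw [lintegral_map hF measurable_forget, lintegral_withDensity_eq_lintegral_mul _ hw hF,
    lintegral_prod _ (hw.mul hF).aemeasurable, PVModel.μ, ProbabilityTheory.cond,
    lintegral_smul_measure, ← lintegral_indicator hm, M.lintegral_law (hFf.indicator hm),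
    smul_eq_mul, ← lintegral_const_mul' _ _ (ENNReal.inv_ne_top.2 h0)]
  refine lintegral_congr fun c => ?_
  rw [← lintegral_const_mul' _ _ (ENNReal.inv_ne_top.2 h0)]
  refine lintegral_congr fun a' => ?_
  have h1 : ∀ m, (mask k).indicator (fun o : Trial 𝒰 𝒳 𝒜 𝒵 𝒲 => F (forget o)) ((c, m), a') =
      (maskBool k).indicator (fun _ => F (c, a')) m := by
    intro m
    by_cases hmk : m ∈ maskBool k
    · rw [Set.indicator_of_mem hmk, Set.indicator_of_mem ((mem_mask_iff k _).2 hmk)]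
      rfl
    · rw [Set.indicator_of_notMem hmk, Set.indicator_of_notMem fun h => hmk ((mem_mask_iff k _).1 h)]
  simp_rw [h1]
  rw [lintegral_indicator_const (measurableSet_maskBool k)]
  simp only [Pi.mul_apply, PVModel.obsProb]
  ring

end Observed

lemma ne_zero_of_isProbabilityMeasure_of_absolutelyContinuous {β : Type*} [MeasurableSpace β]
    {N D : Measure β} (hND : N ≪ D) (hN : IsProbabilityMeasure N) : D ≠ 0 := fun hD => by
  rw [hD, Measure.absolutelyContinuous_zero_iff] at hND
  exact hN.ne_zero _ hND

/-! ### The conditional laws `μ_k` and the weights `b₂`, `b₃`. -/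

namespace PVModel

variable {𝒰 𝒳 𝒜 𝒵 𝒲 : Type*} [MeasurableSpace 𝒰] [MeasurableSpace 𝒳] [MeasurableSpace 𝒜]
  [MeasurableSpace 𝒵] [MeasurableSpace 𝒲] (M : PVModel 𝒰 𝒳 𝒜 𝒵 𝒲)

instance (k : Fin 4) : IsFiniteMeasure (M.lawAWX k) := by unfold lawAWX; infer_instance

instance : IsFiniteMeasure M.den1 := by unfold den1; infer_instance

instance : IsFiniteMeasure M.den4 := by unfold den4; infer_instance

instance (π : Policy 𝒳 𝒜) : IsProbabilityMeasure (M.num1 π) :=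
  Measure.isProbabilityMeasure_map (by fun_prop)

/-- The kernel `p(y | u, x, w, a)` in the coordinates of the core. -/
def rewardKernel : Kernel ((𝒳 × 𝒰 × 𝒵 × 𝒲) × 𝒜) ℝ :=
  M.ρ.comap (fun p : (𝒳 × 𝒰 × 𝒵 × 𝒲) × 𝒜 => (p.1.2.1, p.1.1, p.1.2.2.2, p.2)) (by fun_prop)

instance : IsMarkovKernel M.rewardKernel := by unfold rewardKernel; infer_instance

lemma lintegral_coreLaw (ν : Measure 𝒳) [SFinite ν] (π : Kernel (𝒳 × 𝒰 × 𝒵 × 𝒲) 𝒜)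
    [IsSFiniteKernel π] {F : Core 𝒰 𝒳 𝒜 𝒵 𝒲 → ENNReal} (hF : Measurable F) :
    ∫⁻ c, F c ∂(M.coreLaw ν π) = ∫⁻ x, ∫⁻ s, ∫⁻ a, ∫⁻ y, F (((x, s), a), y)
      ∂(M.ρ (s.1, x, s.2.2, a)) ∂(π (x, s)) ∂(M.κ x) ∂ν := by
  have h1 : Measurable fun p : (𝒳 × 𝒰 × 𝒵 × 𝒲) × 𝒜 => ∫⁻ y, F (p, y) ∂(M.rewardKernel p) :=
    hF.lintegral_kernel_prod_right'
  have h2 : Measurable fun p : 𝒳 × 𝒰 × 𝒵 × 𝒲 =>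
      ∫⁻ a, ∫⁻ y, F ((p, a), y) ∂(M.rewardKernel (p, a)) ∂(π p) :=
    h1.lintegral_kernel_prod_right'
  change ∫⁻ c, F c ∂(((ν ⊗ₘ M.κ) ⊗ₘ π) ⊗ₘ M.rewardKernel) = _
  rw [Measure.lintegral_compProd hF, Measure.lintegral_compProd h1, Measure.lintegral_compProd h2]
  rfl

lemma lintegral_obsCore_context {F : 𝒳 × 𝒰 × 𝒵 × 𝒲 → ENNReal} (hF : Measurable F) :
    ∫⁻ c, F c.1.1 ∂M.obsCore = ∫⁻ x, ∫⁻ s, F (x, s) ∂(M.κ x) ∂M.pX := by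
  rw [obsCore, M.lintegral_coreLaw _ _ (F := fun c => F c.1.1) (by fun_prop)]
  simp

/-- The law of the core given the `k`-th missingness condition. -/
def coreμ (k : Fin 4) : Measure (Core 𝒰 𝒳 𝒜 𝒵 𝒲) :=
  M.obsCore.withDensity fun c => (M.law (mask k))⁻¹ * M.obsProb k c

lemma map_forget_μ_eq_prod {k : Fin 4} (h0 : M.law (mask k) ≠ 0) :
    (M.μ k).map forget = (M.coreμ k).prod M.pseudo := by
  rw [M.map_forget_μ k h0, coreμ, prod_withDensity_left]
  exact (M.measurable_obsProb k).const_mul _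

lemma isProbabilityMeasure_μ {k : Fin 4} (h0 : M.law (mask k) ≠ 0) :
    IsProbabilityMeasure (M.μ k) := cond_isProbabilityMeasure h0

lemma map_core_μ {k : Fin 4} (h0 : M.law (mask k) ≠ 0) {β : Type*} [MeasurableSpace β]
    {f : Core 𝒰 𝒳 𝒜 𝒵 𝒲 → β} (hf : Measurable f) :
    (M.μ k).map (fun o => f o.1.1) = (M.coreμ k).map f := by
  have h := congrArg (fun ν => Measure.map f (Measure.map Prod.fst ν)) (M.map_forget_μ_eq_prod h0)
  simp only [Measure.map_fst_prod, measure_univ, one_smul] at h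
  rw [← h, Measure.map_map measurable_fst measurable_forget, Measure.map_map hf (by fun_prop)]
  rfl

lemma isProbabilityMeasure_coreμ {k : Fin 4} (h0 : M.law (mask k) ≠ 0) :
    IsProbabilityMeasure (M.coreμ k) := by
  have := M.isProbabilityMeasure_μ h0
  have h := M.map_core_μ h0 measurable_id
  rw [Measure.map_id] at h
  rw [← h]
  exact Measure.isProbabilityMeasure_map (by fun_prop)

/-- `R_X` depends on `X` alone, so conditioning on `R_X = 1` changes the law of the context but not
that of `(U, Z, W)` given `X`. -/
lemma lintegral_coreμ_three_context {F : 𝒳 × 𝒰 × 𝒵 × 𝒲 → ENNReal} (hF : Measurable F) :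
    ∫⁻ c, F c.1.1 ∂(M.coreμ 3) = ∫⁻ x, ∫⁻ s, F (x, s) ∂(M.κ x) ∂((M.coreμ 3).map fun c => c.1.1.1) := by
  have hm : Measurable fun x => (M.law (mask 3))⁻¹ * M.mX x {true} :=
    (Kernel.measurable_coe _ (measurableSet_singleton _)).const_mul _
  have hd : M.coreμ 3 = M.obsCore.withDensity fun c => (M.law (mask 3))⁻¹ * M.mX c.1.1.1 {true} := by
    simp only [coreμ, obsProb_three]
  have key : ∀ {G : 𝒳 × 𝒰 × 𝒵 × 𝒲 → ENNReal}, Measurable G → ∫⁻ c, G c.1.1 ∂(M.coreμ 3) =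
      ∫⁻ x, ((M.law (mask 3))⁻¹ * M.mX x {true}) * ∫⁻ s, G (x, s) ∂(M.κ x) ∂M.pX := by
    intro G hG
    have hGc : Measurable fun c : Core 𝒰 𝒳 𝒜 𝒵 𝒲 => G c.1.1 := hG.comp (by fun_prop)
    have hmc : Measurable fun c : Core 𝒰 𝒳 𝒜 𝒵 𝒲 => (M.law (mask 3))⁻¹ * M.mX c.1.1.1 {true} :=
      hm.comp (by fun_prop)
    rw [hd, lintegral_withDensity_eq_lintegral_mul _ hmc hGc]
    have h := M.lintegral_obsCore_context ((hm.comp measurable_fst).mul hG)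
    simp only [Pi.mul_apply, Function.comp_apply] at h ⊢
    rw [h]
    refine lintegral_congr fun x => ?_
    rw [lintegral_const_mul _ (by fun_prop)]
  have hi : Measurable fun x => ∫⁻ s, F (x, s) ∂(M.κ x) := hF.lintegral_kernel_prod_right'
  have hF1 : Measurable fun p : 𝒳 × 𝒰 × 𝒵 × 𝒲 => ∫⁻ s, F (p.1, s) ∂(M.κ p.1) :=
    hi.comp measurable_fst
  rw [key hF, lintegral_map hi (by fun_prop)]
  have h := key hF1
  simp only [lintegral_const, measure_univ, mul_one] at h
  exact h.symm

lemma integral_μ_eq {k : Fin 4} {F : Core 𝒰 𝒳 𝒜 𝒵 𝒲 × 𝒜 → ℝ} (hF : Measurable F) :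
    ∫ o, F (forget o) ∂(M.μ k) = ∫ p, F p ∂((M.μ k).map forget) :=
  (integral_map measurable_forget.aemeasurable hF.aestronglyMeasurable).symm

/-- The law given the `k`-th missingness condition is obtained from the law given the `j`-th one
when the former asks in addition for the outcome proxy. -/
lemma coreμ_reweight {j k : Fin 4} (hj : M.law (mask j) ≠ 0)
    (hjk : ∀ c, M.obsProb k c = M.obsProb j c * M.obsProbW (c.1.1.2.2.2, c.1.1.1, c.1.2)) :
    M.coreμ k = (M.coreμ j).withDensity fun c => M.law (mask j) * (M.law (mask k))⁻¹ *
      M.obsProbW (c.1.1.2.2.2, c.1.1.1, c.1.2) := by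
  have h1 : Measurable fun c : Core 𝒰 𝒳 𝒜 𝒵 𝒲 => M.obsProbW (c.1.1.2.2.2, c.1.1.1, c.1.2) :=
    M.measurable_obsProbW.comp (by fun_prop)
  rw [coreμ, coreμ, ← withDensity_mul _ ((M.measurable_obsProb j).const_mul _) (h1.const_mul _)]
  congr 1
  ext c
  simp only [Pi.mul_apply, hjk]
  have h2 : (M.law (mask j))⁻¹ * M.law (mask j) = 1 :=
    ENNReal.inv_mul_cancel hj (measure_ne_top _ _)
  calc (M.law (mask k))⁻¹ * (M.obsProb j c * M.obsProbW (c.1.1.2.2.2, c.1.1.1, c.1.2))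
      = 1 * (M.law (mask k))⁻¹ * (M.obsProb j c * M.obsProbW (c.1.1.2.2.2, c.1.1.1, c.1.2)) := by
        rw [one_mul]
    _ = _ := by rw [← h2]; ring

lemma map_forget_reweight {j k : Fin 4} (hj : M.law (mask j) ≠ 0) (hk : M.law (mask k) ≠ 0)
    (hjk : ∀ c, M.obsProb k c = M.obsProb j c * M.obsProbW (c.1.1.2.2.2, c.1.1.1, c.1.2)) :
    (M.μ k).map forget = ((M.μ j).map forget).withDensity fun p =>
      M.law (mask j) * (M.law (mask k))⁻¹ * M.obsProbW (p.1.1.1.2.2.2, p.1.1.1.1, p.1.1.2) := by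
  have h1 : Measurable fun c : Core 𝒰 𝒳 𝒜 𝒵 𝒲 => M.obsProbW (c.1.1.2.2.2, c.1.1.1, c.1.2) :=
    M.measurable_obsProbW.comp (by fun_prop)
  rw [M.map_forget_μ_eq_prod hk, M.map_forget_μ_eq_prod hj, M.coreμ_reweight hj hjk,
    prod_withDensity_left (h1.const_mul _)]

section Ratios

variable [StandardBorelSpace 𝒜] [Nonempty 𝒜] [StandardBorelSpace 𝒲] [Nonempty 𝒲]
  {M} {π : Policy 𝒳 𝒜}

/-- Conditioning on a null event yields the zero measure, and a probability measure cannot be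
absolutely continuous with respect to zero. -/
lemma RatiosExist.law_mask_ne_zero (h : M.RatiosExist π) (k : Fin 4) : M.law (mask k) ≠ 0 := by
  have hz : ∀ k, M.law (mask k) = 0 → M.μ k = 0 := fun k hk => cond_eq_zero_of_meas_eq_zero hk
  have h0 : M.law (mask 0) ≠ 0 := fun h0 => by
    refine ne_zero_of_isProbabilityMeasure_of_absolutelyContinuous h.ac1 ?_ (by rw [den1, hz 0 h0, Measure.map_zero])
    exact Measure.isProbabilityMeasure_map (by fun_prop)
  fin_cases k
  · exact h0
  · intro h1
    have := M.isProbabilityMeasure_μ h0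
    refine ne_zero_of_isProbabilityMeasure_of_absolutelyContinuous h.ac2 ?_ (by rw [lawAWX, hz 1 h1, Measure.map_zero])
    exact Measure.isProbabilityMeasure_map (by unfold vA vW vX; fun_prop)
  · intro h2
    refine ne_zero_of_isProbabilityMeasure_of_absolutelyContinuous h.ac3 ?_ (by rw [den3, hz 2 h2, Measure.map_zero, Measure.zero_prod])
    exact Measure.isProbabilityMeasure_map (by fun_prop)
  · intro h3
    exact ne_zero_of_isProbabilityMeasure_of_absolutelyContinuous h.ac4 inferInstance (by rw [den4, hz 3 h3, Measure.map_zero, Measure.zero_prod])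

/-- The weight `b₂` moves the law given `(R_W,R_X,R_Z) = 1` to the law given `(R_X,R_Z) = 1`. -/
lemma RatiosExist.integral_b2_mul (h : M.RatiosExist π) {b₁ : 𝒳 × 𝒜 × 𝒵 → ℝ} (hb : Measurable b₁)
    {F : Core 𝒰 𝒳 𝒜 𝒵 𝒲 × 𝒜 → ℝ} (hF : Measurable F) :
    ∫ o, M.b2 b₁ (vA o, vW o, vX o, vZ o) * F (forget o) ∂(M.μ 1) =
      ∫ o, b₁ (vX o, vA o, vZ o) * F (forget o) ∂(M.μ 0) := by
  have h0 := h.law_mask_ne_zero 0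
  have h1 := h.law_mask_ne_zero 1
  let τ : Core 𝒰 𝒳 𝒜 𝒵 𝒲 × 𝒜 → 𝒜 × 𝒲 × 𝒳 := fun p => (p.1.1.2, p.1.1.1.2.2.2, p.1.1.1.1)
  have hτ : Measurable τ := by fun_prop
  have hmap : ∀ k, M.lawAWX k = ((M.μ k).map forget).map τ := fun k => by
    rw [Measure.map_map hτ measurable_forget]; rfl
  have hb' : Measurable fun p : Core 𝒰 𝒳 𝒜 𝒵 𝒲 × 𝒜 => b₁ (p.1.1.1.1, p.1.1.2, p.1.1.1.2.2.1) :=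
    hb.comp (by fun_prop)
  have hr : Measurable fun p : Core 𝒰 𝒳 𝒜 𝒵 𝒲 × 𝒜 =>
      ((M.lawAWX 0).rnDeriv (M.lawAWX 1) (τ p)).toReal :=
    ((Measure.measurable_rnDeriv _ _).comp hτ).ennreal_toReal
  -- Here `v = 1`: the target is the image of the base measure itself, so the ratio in `b2` exactly
  -- undoes the selection by `R_W`.
  have key := integral_rnDeriv_comp_withDensity ((M.μ 0).map forget) hτ
    (u := fun q => M.law (mask 0) * (M.law (mask 1))⁻¹ * M.obsProbW (q.2.1, q.2.2, q.1)) (v := 1)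
    ((M.measurable_obsProbW.comp (by fun_prop)).const_mul _) measurable_one
    (M.map_forget_reweight h0 h1 M.obsProb_one) (N := M.lawAWX 0)
    (by rw [withDensity_one, hmap]) (by rw [← hmap]; exact h.ac2)
    (fun p => b₁ (p.1.1.1.1, p.1.1.2, p.1.1.1.2.2.1) * F p)
  rw [← hmap] at key
  simp only [Pi.one_apply, ENNReal.toReal_one, one_mul] at key
  have e0 := M.integral_μ_eq (k := 0) (hb'.mul hF)
  have e1 := M.integral_μ_eq (k := 1) (hr.mul (hb'.mul hF))
  simp only [Pi.mul_apply] at e0 e1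
  rw [← e0, ← e1] at key
  refine Eq.trans (integral_congr_ae (ae_of_all _ fun o => ?_)) key
  change b₁ (vX o, vA o, vZ o) * _ * F (forget o) = _ * (b₁ (vX o, vA o, vZ o) * F (forget o))
  rw [mul_comm (b₁ _), mul_assoc]
  rfl

lemma RatiosExist.lintegral_ptilde_compProd (h : M.RatiosExist π) {H : 𝒳 × 𝒜 → ENNReal}
    (hH : Measurable H) : ∫⁻ x, ∫⁻ a, H (x, a) ∂(π.1 x) ∂M.ptilde =
      ∫⁻ x, ∫⁻ a, (M.ptilde ⊗ₘ π.1).rnDeriv M.den4 (x, a) * H (x, a) ∂M.pseudo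
        ∂((M.μ 3).map vX) := by
  have hr : Measurable ((M.ptilde ⊗ₘ π.1).rnDeriv M.den4) := Measure.measurable_rnDeriv _ _
  have h1 := lintegral_prod (μ := (M.μ 3).map vX) (ν := M.pseudo) _ (hr.mul hH).aemeasurable
  rw [← Measure.lintegral_compProd hH]
  conv_lhs => rw [← Measure.withDensity_rnDeriv_eq _ _ h.ac4,
    lintegral_withDensity_eq_lintegral_mul _ hr hH]
  exact h1

/-- The measure `num3` in terms of the law given `R_X = 1`. -/
lemma RatiosExist.num3_eq (h : M.RatiosExist π) :
    M.num3 π = (((M.μ 3).map forget).map fun p : Core 𝒰 𝒳 𝒜 𝒵 𝒲 × 𝒜 =>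
      ((p.1.1.1.2.2.2, p.1.1.1.1, p.1.1.2), p.2)).withDensity fun q =>
        (M.ptilde ⊗ₘ π.1).rnDeriv M.den4 (q.1.2.1, q.2) := by
  have h3 := h.law_mask_ne_zero 3
  have := M.isProbabilityMeasure_coreμ h3
  have hr : Measurable ((M.ptilde ⊗ₘ π.1).rnDeriv M.den4) := Measure.measurable_rnDeriv _ _
  refine Measure.ext_of_lintegral _ fun F hF => ?_
  have hvw : Measurable fun q : (𝒲 × 𝒳 × 𝒜) × 𝒜 =>
      (M.ptilde ⊗ₘ π.1).rnDeriv M.den4 (q.1.2.1, q.2) := hr.comp (by fun_prop)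
  set cd := condDistrib (fun o => (vA o, vW o)) vX (M.μ 3) with hcd
  have hG : Measurable fun p : 𝒳 × 𝒜 × 𝒜 × 𝒲 => F ((p.2.2.2, p.1, p.2.2.1), p.2.1) :=
    hF.comp (by fun_prop)
  have hH : Measurable fun p : 𝒳 × 𝒜 => ∫⁻ q, F ((q.2, p.1, q.1), p.2) ∂(cd p.1) := by
    have : Measurable fun r : (𝒳 × 𝒜) × (𝒜 × 𝒲) => F ((r.2.2, r.1.1, r.2.1), r.1.2) :=
      hF.comp (by fun_prop)
    exact this.lintegral_kernel_prod_right' (κ := cd.comap Prod.fst measurable_fst)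
  rw [num3, ← hcd, lintegral_map hF (by fun_prop), Measure.lintegral_compProd hG,
    lintegral_withDensity_eq_lintegral_mul _ hvw hF, lintegral_map (hvw.mul hF) (by fun_prop),
    M.map_forget_μ_eq_prod h3]
  have e1 : ∀ x, ∫⁻ b, F ((b.2.2, x, b.2.1), b.1) ∂((π.1 ×ₖ cd) x) =
      ∫⁻ a, ∫⁻ q, F ((q.2, x, q.1), a) ∂(cd x) ∂(π.1 x) := fun x => by
    have : Measurable fun b : 𝒜 × 𝒜 × 𝒲 => F ((b.2.2, x, b.2.1), b.1) := by fun_prop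
    rw [Kernel.prod_apply, lintegral_prod _ this.aemeasurable]
  have hL : Measurable fun p : Core 𝒰 𝒳 𝒜 𝒵 𝒲 × 𝒜 =>
      (M.ptilde ⊗ₘ π.1).rnDeriv M.den4 (p.1.1.1.1, p.2) *
        F ((p.1.1.1.2.2.2, p.1.1.1.1, p.1.1.2), p.2) := by fun_prop
  have e0 := lintegral_prod_symm (μ := M.coreμ 3) (ν := M.pseudo) _ hL.aemeasurable
  simp only [e1]
  rw [h.lintegral_ptilde_compProd hH, lintegral_lintegral_swap]
  · refine Eq.trans ?_ e0.symm
    refine lintegral_congr fun a' => ?_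
    have hK : Measurable fun p : 𝒳 × 𝒜 × 𝒲 => (M.ptilde ⊗ₘ π.1).rnDeriv M.den4 (p.1, a') *
      F ((p.2.2, p.1, p.2.1), a') := (hr.comp (by fun_prop)).mul (hF.comp (by fun_prop))
    -- The regular conditional law of `(A, W)` given `X` in the definition of `num3`, recombined
    -- with the law of `X` under the same conditioning, gives back the joint law.
    have e2 := compProd_map_condDistrib (mβ := inferInstance) (X := vX) (Y := fun o => (vA o, vW o)) (μ := M.μ 3)
      (by unfold vA vW; fun_prop)
    have e3 : (M.μ 3).map (fun o => (vX o, (vA o, vW o))) = (M.coreμ 3).map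
        fun c => (c.1.1.1, c.1.2, c.1.1.2.2.2) :=
      M.map_core_μ h3 (f := fun c => (c.1.1.1, c.1.2, c.1.1.2.2.2)) (by fun_prop)
    have e4 := congrArg (fun ν => ∫⁻ p, (M.ptilde ⊗ₘ π.1).rnDeriv M.den4 (p.1, a') *
      F ((p.2.2, p.1, p.2.1), a') ∂ν) (e2.trans e3)
    rw [Measure.lintegral_compProd hK, lintegral_map hK (by fun_prop)] at e4
    rw [← e4]
    refine lintegral_congr fun x => ?_
    exact (lintegral_const_mul _ (by fun_prop)).symm
  · exact (hr.mul hH).aemeasurable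

/-- The weight `b₃` moves the law given `(R_W,R_X) = 1` to the law given `R_X = 1` weighted by
`b₄`. -/
lemma RatiosExist.integral_b3_mul (h : M.RatiosExist π)
    {F : Core 𝒰 𝒳 𝒜 𝒵 𝒲 × 𝒜 → ℝ} (hF : Measurable F) :
    ∫ o, M.b3 π ((vW o, vX o, vA o), vA' o) * F (forget o) ∂(M.μ 2) =
      ∫ o, M.b4 π (vX o, vA' o) * F (forget o) ∂(M.μ 3) := by
  have h2 := h.law_mask_ne_zero 2
  have h3 := h.law_mask_ne_zero 3
  let τ : Core 𝒰 𝒳 𝒜 𝒵 𝒲 × 𝒜 → (𝒲 × 𝒳 × 𝒜) × 𝒜 :=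
    fun p => ((p.1.1.1.2.2.2, p.1.1.1.1, p.1.1.2), p.2)
  have hτ : Measurable τ := by fun_prop
  have := M.isProbabilityMeasure_coreμ h2
  have hden : M.den3 = ((M.μ 2).map forget).map τ := by
    have e1 : (M.μ 2).map (fun o => (vW o, vX o, vA o)) = (M.coreμ 2).map
        fun c => (c.1.1.2.2.2, c.1.1.1, c.1.2) :=
      M.map_core_μ h2 (f := fun c => (c.1.1.2.2.2, c.1.1.1, c.1.2)) (by fun_prop)
    rw [den3, M.map_forget_μ_eq_prod h2, e1]
    conv_lhs => rw [← Measure.map_id (μ := M.pseudo)]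
    rw [Measure.map_prod_map _ _ (by fun_prop) measurable_id]
    rfl
  have hr : Measurable fun p : Core 𝒰 𝒳 𝒜 𝒵 𝒲 × 𝒜 =>
      ((M.num3 π).rnDeriv M.den3 (τ p)).toReal :=
    ((Measure.measurable_rnDeriv _ _).comp hτ).ennreal_toReal
  have hr4 : Measurable ((M.ptilde ⊗ₘ π.1).rnDeriv M.den4) := Measure.measurable_rnDeriv _ _
  have hr4' : Measurable fun p : Core 𝒰 𝒳 𝒜 𝒵 𝒲 × 𝒜 =>
      ((M.ptilde ⊗ₘ π.1).rnDeriv M.den4 ((τ p).1.2.1, (τ p).2)).toReal :=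
    (hr4.comp (by fun_prop)).ennreal_toReal
  have : IsFiniteMeasure (M.num3 π) := by unfold num3; infer_instance
  -- By `num3_eq` the target is the law given `R_X = 1` with the density `b4`; the base is
  -- reweighted by the observation probability of `W`.
  have key := integral_rnDeriv_comp_withDensity ((M.μ 3).map forget) hτ
    (u := fun q => M.law (mask 3) * (M.law (mask 2))⁻¹ * M.obsProbW q.1)
    (v := fun q => (M.ptilde ⊗ₘ π.1).rnDeriv M.den4 (q.1.2.1, q.2))
    ((M.measurable_obsProbW.comp (by fun_prop)).const_mul _) (hr4.comp (by fun_prop))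
    (M.map_forget_reweight h3 h2 M.obsProb_two) (N := M.num3 π)
    h.num3_eq (by rw [← hden]; exact h.ac3) F
  have e2 := M.integral_μ_eq (k := 2) (hr.mul hF)
  have e3 := M.integral_μ_eq (k := 3) (hr4'.mul hF)
  simp only [Pi.mul_apply] at e2 e3
  rw [← hden, ← e2, ← e3] at key
  exact key

end Ratios

end PVModel

/-! ### Disintegrations under proxy independence; the weight `b₄`. -/

lemma withDensity_fst_compProd {α β : Type*} [MeasurableSpace α] [MeasurableSpace β]
    (μ : Measure α) [SFinite μ] (κ : Kernel α β) [IsSFiniteKernel κ] {f : α → ENNReal}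
    (hf : Measurable f) [SFinite (μ.withDensity f)] :
    (μ.withDensity f) ⊗ₘ κ = (μ ⊗ₘ κ).withDensity fun p => f p.1 := by
  have hf' : Measurable fun p : α × β => f p.1 := by fun_prop
  refine Measure.ext_of_lintegral _ fun F hF => ?_
  rw [Measure.lintegral_compProd hF, lintegral_withDensity_eq_lintegral_mul _ hf
    hF.lintegral_kernel_prod_right', lintegral_withDensity_eq_lintegral_mul _ hf' hF,
    Measure.lintegral_compProd (hf'.mul hF)]
  refine lintegral_congr fun a => ?_
  simp only [Pi.mul_apply]
  rw [lintegral_const_mul _ (by fun_prop)]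

/-- A conditional independence lets the larger conditioning be dropped from a disintegration. -/
lemma map_eq_compProd_prodMkRight_of_condIndepFun {Ω α β γ : Type*} [MeasurableSpace Ω]
    [StandardBorelSpace Ω] [MeasurableSpace α] [StandardBorelSpace α] [Nonempty α]
    [MeasurableSpace β] [StandardBorelSpace β] [Nonempty β] [MeasurableSpace γ]
    {P : Measure Ω} [IsFiniteMeasure P] {f : Ω → α} {g : Ω → β} {k : Ω → γ} (hf : Measurable f)
    (hg : Measurable g) (hk : Measurable k)
    (h : CondIndepFun (MeasurableSpace.comap k inferInstance) hk.comap_le g f P)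
    {κ : Kernel γ α} [IsFiniteKernel κ]
    (hκ : P.map (fun ω => (k ω, f ω)) = P.map k ⊗ₘ κ) :
    P.map (fun ω => ((k ω, g ω), f ω)) = P.map (fun ω => (k ω, g ω)) ⊗ₘ κ.prodMkRight β := by
  have h1 := condDistrib_ae_eq_of_measure_eq_compProd k hf.aemeasurable hκ
  have h2 := (condIndepFun_iff_condDistrib_prod_ae_eq_prodMkRight hf hg hk).1 h
  have hfst : P.map k = (P.map fun ω => (k ω, g ω)).map Prod.fst := by
    rw [Measure.map_map measurable_fst (hk.prodMk hg)]
    rfl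
  rw [hfst] at h1
  have h3 : (condDistrib f k P).prodMkRight β =ᵐ[P.map fun ω => (k ω, g ω)] κ.prodMkRight β :=
    ae_of_ae_map measurable_fst.aemeasurable h1
  rw [← compProd_map_condDistrib hf.aemeasurable]
  exact Measure.compProd_congr (h2.trans h3)

namespace PVModel

variable {𝒰 𝒳 𝒜 𝒵 𝒲 : Type*} [MeasurableSpace 𝒰] [MeasurableSpace 𝒳] [MeasurableSpace 𝒜]
  [MeasurableSpace 𝒵] [MeasurableSpace 𝒲] (M : PVModel 𝒰 𝒳 𝒜 𝒵 𝒲)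

lemma map_core_law {β : Type*} [MeasurableSpace β] {f : Core 𝒰 𝒳 𝒜 𝒵 𝒲 → β} (hf : Measurable f) :
    M.law.map (fun o => f o.1.1) = M.obsCore.map f := by
  have h := congrArg (fun ν => Measure.map f (Measure.map Prod.fst ν)) M.map_forget_law
  simp only [Measure.map_fst_prod, measure_univ, one_smul] at h
  rw [← h, Measure.map_map measurable_fst measurable_forget, Measure.map_map hf (by fun_prop)]
  rfl

lemma map_context_law : M.law.map vX = M.pX := by
  have h := M.map_core_law (f := fun c => c.1.1.1) (by fun_prop)
  refine Eq.trans h (Measure.ext_of_lintegral _ fun F hF => ?_)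
  rw [lintegral_map hF (by fun_prop)]
  refine (M.lintegral_obsCore_context (F := fun p => F p.1) (by fun_prop)).trans ?_
  simp

lemma lintegral_intCore {π : Policy 𝒳 𝒜} {F : Core 𝒰 𝒳 𝒜 𝒵 𝒲 → ENNReal} (hF : Measurable F) :
    ∫⁻ c, F c ∂(M.intCore π) = ∫⁻ x, ∫⁻ s, ∫⁻ a, ∫⁻ y, F (((x, s), a), y)
      ∂(M.ρ (s.1, x, s.2.2, a)) ∂(π.1 x) ∂(M.κ x) ∂M.ptilde := by
  rw [intCore, M.lintegral_coreLaw _ _ hF]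
  rfl

section Ratios

variable [StandardBorelSpace 𝒜] [Nonempty 𝒜] [StandardBorelSpace 𝒲] [Nonempty 𝒲]
  {M} {π : Policy 𝒳 𝒜}

/-- Context marginal of the absolute continuity behind `b4`. It carries identities known for almost
every observational context over to `ptilde`. -/
lemma RatiosExist.ptilde_absolutelyContinuous (h : M.RatiosExist π) : M.ptilde ≪ M.pX := by
  have h1 := h.ac4.map measurable_fst
  rw [← Measure.fst, Measure.fst_compProd, den4, Measure.map_fst_prod, measure_univ, one_smul] at h1
  rw [← M.map_context_law]
  exact h1.trans (cond_absolutelyContinuous.map (by unfold vX; fun_prop))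

/-- The density gives `(X, A')` the law of `(X, A)` under the policy. In both processes the
treatment is independent of `W` given `X`, and `W` given `X` follows `κ`, so the triples agree. -/
lemma RatiosExist.map_withDensity_rnDeriv (h : M.RatiosExist π) :
    (((M.μ 3).map forget).withDensity fun p =>
      (M.ptilde ⊗ₘ π.1).rnDeriv M.den4 (p.1.1.1.1, p.2)).map
        (fun p : Core 𝒰 𝒳 𝒜 𝒵 𝒲 × 𝒜 => (p.1.1.1.1, p.2, p.1.1.1.2.2.2)) =
      (M.intCore π).map fun c => (c.1.1.1, c.1.2, c.1.1.2.2.2) := by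
  have h3 := h.law_mask_ne_zero 3
  have := M.isProbabilityMeasure_coreμ h3
  have hr : Measurable ((M.ptilde ⊗ₘ π.1).rnDeriv M.den4) := Measure.measurable_rnDeriv _ _
  refine Measure.ext_of_lintegral _ fun F hF => ?_
  have hr' : Measurable fun p : Core 𝒰 𝒳 𝒜 𝒵 𝒲 × 𝒜 =>
    (M.ptilde ⊗ₘ π.1).rnDeriv M.den4 (p.1.1.1.1, p.2) := by fun_prop
  have hF' : Measurable fun p : Core 𝒰 𝒳 𝒜 𝒵 𝒲 × 𝒜 => F (p.1.1.1.1, p.2, p.1.1.1.2.2.2) := by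
    fun_prop
  have hX : (M.μ 3).map vX = (M.coreμ 3).map fun c => c.1.1.1 :=
    M.map_core_μ h3 (f := fun c => c.1.1.1) (by fun_prop)
  have hH : Measurable fun p : 𝒳 × 𝒜 => ∫⁻ s, F (p.1, p.2, s.2.2) ∂(M.κ p.1) := by
    have : Measurable fun r : (𝒳 × 𝒜) × (𝒰 × 𝒵 × 𝒲) => F (r.1.1, r.1.2, r.2.2.2) := by fun_prop
    exact this.lintegral_kernel_prod_right' (κ := M.κ.comap Prod.fst measurable_fst)
  rw [lintegral_map hF (by fun_prop), lintegral_map hF (by fun_prop),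
    lintegral_withDensity_eq_lintegral_mul _ hr' hF', M.map_forget_μ_eq_prod h3,
    lintegral_prod_symm _ (hr'.mul hF').aemeasurable, M.lintegral_intCore (by fun_prop)]
  simp only [Pi.mul_apply]
  have e1 : ∀ a', ∫⁻ c, (M.ptilde ⊗ₘ π.1).rnDeriv M.den4 (c.1.1.1, a') *
      F (c.1.1.1, a', c.1.1.2.2.2) ∂(M.coreμ 3) =
      ∫⁻ x, (M.ptilde ⊗ₘ π.1).rnDeriv M.den4 (x, a') * ∫⁻ s, F (x, a', s.2.2) ∂(M.κ x)
        ∂((M.μ 3).map vX) := fun a' => by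
    rw [M.lintegral_coreμ_three_context (F := fun p => (M.ptilde ⊗ₘ π.1).rnDeriv M.den4 (p.1, a') *
      F (p.1, a', p.2.2.2)) (by fun_prop), hX]
    refine lintegral_congr fun x => ?_
    exact lintegral_const_mul (μ := M.κ x) ((M.ptilde ⊗ₘ π.1).rnDeriv M.den4 (x, a'))
      (f := fun s => F (x, a', s.2.2)) (by fun_prop)
  simp only [e1]
  rw [lintegral_lintegral_swap]
  · refine (h.lintegral_ptilde_compProd hH).symm.trans (lintegral_congr fun x => ?_)
    simp only [lintegral_const, measure_univ, mul_one]
    rw [lintegral_lintegral_swap]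
    have : Measurable fun p : 𝒜 × 𝒰 × 𝒵 × 𝒲 => F (x, p.1, p.2.2.2) := by fun_prop
    exact this.aemeasurable
  · have : Measurable fun p : 𝒜 × 𝒳 => (M.ptilde ⊗ₘ π.1).rnDeriv M.den4 (p.2, p.1) *
      ∫⁻ s, F (p.2, p.1, s.2.2) ∂(M.κ p.2) :=
      (by fun_prop : Measurable fun p : 𝒜 × 𝒳 => (M.ptilde ⊗ₘ π.1).rnDeriv M.den4 (p.2, p.1)).mul
        (hH.comp measurable_swap)
    exact this.aemeasurable

lemma RatiosExist.den4_eq_map (h : M.RatiosExist π) :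
    M.den4 = ((M.μ 3).map forget).map fun p : Core 𝒰 𝒳 𝒜 𝒵 𝒲 × 𝒜 => (p.1.1.1.1, p.2) := by
  have h3 := h.law_mask_ne_zero 3
  have := M.isProbabilityMeasure_coreμ h3
  have hX : (M.μ 3).map vX = (M.coreμ 3).map fun c => c.1.1.1 :=
    M.map_core_μ h3 (f := fun c => c.1.1.1) (by fun_prop)
  rw [den4, M.map_forget_μ_eq_prod h3, hX]
  conv_lhs => rw [← Measure.map_id (μ := M.pseudo)]
  rw [Measure.map_prod_map _ _ (by fun_prop) measurable_id]
  rfl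

lemma RatiosExist.rnDeriv_den4_lt_top (h : M.RatiosExist π) :
    ∀ᵐ p ∂((M.μ 3).map forget), (M.ptilde ⊗ₘ π.1).rnDeriv M.den4 (p.1.1.1.1, p.2) < ⊤ := by
  have hlt := (M.ptilde ⊗ₘ π.1).rnDeriv_lt_top M.den4
  conv at hlt => enter [2]; rw [h.den4_eq_map]
  exact ae_of_ae_map (f := fun p : Core 𝒰 𝒳 𝒜 𝒵 𝒲 × 𝒜 => (p.1.1.1.1, p.2)) (by fun_prop) hlt

/-- The weight `b₄` moves the law given `R_X = 1` to the interventional law. -/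
lemma RatiosExist.integral_b4_mul (h : M.RatiosExist π) {G : 𝒳 × 𝒜 × 𝒲 → ℝ} (hG : Measurable G) :
    ∫ o, M.b4 π (vX o, vA' o) * G (vX o, vA' o, vW o) ∂(M.μ 3) =
      ∫ c, G (c.1.1.1, c.1.2, c.1.1.2.2.2) ∂(M.intCore π) := by
  have hr : Measurable ((M.ptilde ⊗ₘ π.1).rnDeriv M.den4) := Measure.measurable_rnDeriv _ _
  have hr' : Measurable fun p : Core 𝒰 𝒳 𝒜 𝒵 𝒲 × 𝒜 =>
    (M.ptilde ⊗ₘ π.1).rnDeriv M.den4 (p.1.1.1.1, p.2) := by fun_prop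
  rw [← integral_map (φ := fun c : Core 𝒰 𝒳 𝒜 𝒵 𝒲 => (c.1.1.1, c.1.2, c.1.1.2.2.2)) (by fun_prop)
    hG.aestronglyMeasurable, ← h.map_withDensity_rnDeriv,
    integral_map (by fun_prop) hG.aestronglyMeasurable,
    integral_withDensity_eq_integral_toReal_smul hr' h.rnDeriv_den4_lt_top,
    ← M.integral_μ_eq (F := fun p => ((M.ptilde ⊗ₘ π.1).rnDeriv M.den4 (p.1.1.1.1, p.2)).toReal •
      G (p.1.1.1.1, p.2, p.1.1.1.2.2.2)) (by fun_prop)]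
  rfl

end Ratios

section ProxyReward

variable [StandardBorelSpace 𝒲] [Nonempty 𝒲]

/-- The conditional law of the outcome proxy given the confounder and the context. -/
def proxyKernel : Kernel (𝒰 × 𝒳) 𝒲 := condDistrib vW (fun o => (vU o, vX o)) M.law

instance : IsMarkovKernel M.proxyKernel := by unfold proxyKernel; infer_instance

/-- The conditional law of `(Y, W)` given `(A, X, U)`. -/
def proxyRewardKernel : Kernel (𝒜 × 𝒳 × 𝒰) (ℝ × 𝒲) :=
  ((M.proxyKernel.comap (fun s : 𝒜 × 𝒳 × 𝒰 => (s.2.2, s.2.1)) (by fun_prop)) ⊗ₖ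
    (M.ρ.comap (fun p : (𝒜 × 𝒳 × 𝒰) × 𝒲 => (p.1.2.2, p.1.2.1, p.2, p.1.1)) (by fun_prop))).map
      Prod.swap

instance : IsMarkovKernel M.proxyRewardKernel :=
  Kernel.IsMarkovKernel.map _ measurable_swap

lemma lintegral_proxyRewardKernel (s : 𝒜 × 𝒳 × 𝒰) {F : ℝ × 𝒲 → ENNReal} (hF : Measurable F) :
    ∫⁻ v, F v ∂(M.proxyRewardKernel s) = ∫⁻ w, ∫⁻ y, F (y, w) ∂(M.ρ (s.2.2, s.2.1, w, s.1))
      ∂(M.proxyKernel (s.2.2, s.2.1)) := by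
  rw [proxyRewardKernel, Kernel.map_apply _ measurable_swap, lintegral_map hF measurable_swap,
    Kernel.lintegral_compProd _ _ _ (f := fun q : 𝒲 × ℝ => F q.swap) (by fun_prop)]
  rfl

lemma map_proxy_law :
    M.law.map (fun o => ((vU o, vX o), vW o)) = M.law.map (fun o => (vU o, vX o)) ⊗ₘ M.proxyKernel :=
  (compProd_map_condDistrib (by unfold vW; fun_prop)).symm

variable {M} [StandardBorelSpace 𝒰] [StandardBorelSpace 𝒳] [StandardBorelSpace 𝒜]
  [StandardBorelSpace 𝒵] [Nonempty 𝒜]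

/-- By the first independence, `W` given `(A, X, U)` has the law of `W` given `(U, X)`; then `Y` is
drawn from `(U, X, W, A)`, without reference to `Z`. -/
lemma PVIndep.map_proxyReward_law (h : M.PVIndep) :
    M.law.map (fun o => ((vA o, vX o, vU o), (vY o, vW o))) =
      M.law.map (fun o => (vA o, vX o, vU o)) ⊗ₘ M.proxyRewardKernel := by
  have h1 := map_eq_compProd_prodMkRight_of_condIndepFun (P := M.law) (f := vW) (g := vA)
    (k := fun o => (vU o, vX o)) (by unfold vW; fun_prop) (by unfold vA; fun_prop)
    (by unfold vU vX; fun_prop) h.1.symm M.map_proxy_law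
  refine Measure.ext_of_lintegral _ fun F hF => ?_
  have hρ : Measurable fun q : ((𝒰 × 𝒳) × 𝒜) × 𝒲 =>
      ∫⁻ y, F ((q.1.2, q.1.1.2, q.1.1.1), (y, q.2)) ∂(M.ρ (q.1.1.1, q.1.1.2, q.2, q.1.2)) := by
    have : Measurable fun r : (((𝒰 × 𝒳) × 𝒜) × 𝒲) × ℝ =>
      F ((r.1.1.2, r.1.1.1.2, r.1.1.1.1), (r.2, r.1.2)) := by fun_prop
    exact this.lintegral_kernel_prod_right' (κ := M.ρ.comap
      (fun q : ((𝒰 × 𝒳) × 𝒜) × 𝒲 => (q.1.1.1, q.1.1.2, q.2, q.1.2)) (by fun_prop))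
  have e0 : M.law.map (fun o => ((vA o, vX o, vU o), (vY o, vW o))) = M.obsCore.map
      fun c => ((c.1.2, c.1.1.1, c.1.1.2.1), (c.2, c.1.1.2.2.2)) :=
    M.map_core_law (f := fun c => ((c.1.2, c.1.1.1, c.1.1.2.1), (c.2, c.1.1.2.2.2))) (by fun_prop)
  have e1 : M.law.map (fun o => (((vU o, vX o), vA o), vW o)) = M.obsCore.map
      fun c => (((c.1.1.2.1, c.1.1.1), c.1.2), c.1.1.2.2.2) :=
    M.map_core_law (f := fun c => (((c.1.1.2.1, c.1.1.1), c.1.2), c.1.1.2.2.2)) (by fun_prop)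
  have e2 : ∫⁻ q, F q ∂(M.law.map (fun o => ((vA o, vX o, vU o), (vY o, vW o)))) =
      ∫⁻ q, ∫⁻ y, F ((q.1.2, q.1.1.2, q.1.1.1), (y, q.2)) ∂(M.ρ (q.1.1.1, q.1.1.2, q.2, q.1.2))
        ∂(M.law.map (fun o => (((vU o, vX o), vA o), vW o))) := by
    rw [e0, e1, lintegral_map hF (by fun_prop), lintegral_map hρ (by fun_prop), obsCore]
    refine (M.lintegral_coreLaw _ _
      (F := fun c => F ((c.1.2, c.1.1.1, c.1.1.2.1), (c.2, c.1.1.2.2.2))) (by fun_prop)).trans ?_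
    have e3 := M.lintegral_coreLaw M.pX
      (M.πob.comap (fun p : 𝒳 × 𝒰 × 𝒵 × 𝒲 => (p.2.1, p.1, p.2.2.1)) (by fun_prop))
      (hρ.comp (by fun_prop :
        Measurable fun c : Core 𝒰 𝒳 𝒜 𝒵 𝒲 => (((c.1.1.2.1, c.1.1.1), c.1.2), c.1.1.2.2.2)))
    simp only [Function.comp_apply, lintegral_const, measure_univ, mul_one] at e3
    exact e3.symm
  have hκ : Measurable fun s : 𝒜 × 𝒳 × 𝒰 => ∫⁻ v, F (s, v) ∂(M.proxyRewardKernel s) :=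
    hF.lintegral_kernel_prod_right'
  rw [e2, h1, Measure.lintegral_compProd hρ, Measure.lintegral_compProd hF,
    lintegral_map hκ (by unfold vA vX vU; fun_prop),
    lintegral_map hρ.lintegral_kernel_prod_right' (by unfold vA vX vU; fun_prop)]
  refine lintegral_congr fun o => ?_
  rw [M.lintegral_proxyRewardKernel _ (by fun_prop)]
  rfl

/-- The second independence allows `Z` to join the conditioning without changing the law of `(Y,
W)`. -/
lemma PVIndep.map_treatmentProxy_law (h : M.PVIndep) :
    M.law.map (fun o => (((vA o, vX o, vU o), vZ o), (vY o, vW o))) =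
      M.law.map (fun o => ((vA o, vX o, vU o), vZ o)) ⊗ₘ M.proxyRewardKernel.prodMkRight 𝒵 := by
  have hne : Nonempty (Trial 𝒰 𝒳 𝒜 𝒵 𝒲) := nonempty_of_isProbabilityMeasure M.law
  have : Nonempty 𝒵 := hne.map vZ
  exact map_eq_compProd_prodMkRight_of_condIndepFun (by unfold vY vW; fun_prop)
    (by unfold vZ; fun_prop) (by unfold vA vX vU; fun_prop) h.2 h.map_proxyReward_law

/-- Conditioning on `(R_X, R_Z) = 1` multiplies the law by a function of `(A, X, U, Z)`, that is, of
the conditioning variables, so the conditional law of `(Y, W)` survives. -/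
lemma PVIndep.map_μ_zero (h : M.PVIndep) (h0 : M.law (mask 0) ≠ 0) :
    (M.μ 0).map (fun o => (((vA o, vX o, vU o), vZ o), (vY o, vW o))) =
      (M.μ 0).map (fun o => ((vA o, vX o, vU o), vZ o)) ⊗ₘ M.proxyRewardKernel.prodMkRight 𝒵 := by
  let q : (𝒜 × 𝒳 × 𝒰) × 𝒵 → ENNReal := fun r => (M.law (mask 0))⁻¹ *
    (M.mX r.1.2.1 {true} * M.mZ (r.2, r.1.2.2, r.1.1, r.1.2.1) {true})
  have hq : Measurable q := by
    have h1 : Measurable fun x => M.mX x {true} := Kernel.measurable_coe _ (measurableSet_singleton _)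
    have h2 : Measurable fun x => M.mZ x {true} := Kernel.measurable_coe _ (measurableSet_singleton _)
    exact ((h1.comp (by fun_prop)).mul (h2.comp (by fun_prop))).const_mul _
  let f : Core 𝒰 𝒳 𝒜 𝒵 𝒲 → ((𝒜 × 𝒳 × 𝒰) × 𝒵) × (ℝ × 𝒲) :=
    fun c => (((c.1.2, c.1.1.1, c.1.1.2.1), c.1.1.2.2.1), (c.2, c.1.1.2.2.2))
  have hf : Measurable f := by fun_prop
  have hd : M.coreμ 0 = M.obsCore.withDensity fun c => q (f c).1 := by
    simp only [coreμ, obsProb_zero]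
    rfl
  have hd' : M.coreμ 0 = M.obsCore.withDensity fun c => (fun r => q r.1) (f c) := hd
  have e1 : (M.μ 0).map (fun o => (((vA o, vX o, vU o), vZ o), (vY o, vW o))) = (M.coreμ 0).map f :=
    M.map_core_μ h0 hf
  have e2 : (M.μ 0).map (fun o => ((vA o, vX o, vU o), vZ o)) = (M.coreμ 0).map fun c => (f c).1 :=
    M.map_core_μ h0 hf.fst
  have e3 : M.law.map (fun o => (((vA o, vX o, vU o), vZ o), (vY o, vW o))) = M.obsCore.map f :=
    M.map_core_law hf
  have e4 : M.law.map (fun o => ((vA o, vX o, vU o), vZ o)) = M.obsCore.map fun c => (f c).1 :=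
    M.map_core_law hf.fst
  have := M.isProbabilityMeasure_coreμ h0
  have h3 : (M.coreμ 0).map (fun c => (f c).1) = (M.obsCore.map fun c => (f c).1).withDensity q := by
    rw [hd, map_withDensity_comp _ hf.fst hq]
  have : SFinite ((M.obsCore.map fun c => (f c).1).withDensity q) := by rw [← h3]; infer_instance
  rw [e1, e2, h3, withDensity_fst_compProd _ _ hq, ← e4, ← h.map_treatmentProxy_law, e3, hd',
    map_withDensity_comp (u := fun r => q r.1) _ hf (by fun_prop)]

end ProxyReward

end PVModel

/-! ### The shift function `b₁` and the interventional law. -/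

namespace PVModel

variable {𝒰 𝒳 𝒜 𝒵 𝒲 : Type*} [MeasurableSpace 𝒰] [MeasurableSpace 𝒳] [MeasurableSpace 𝒜]
  [MeasurableSpace 𝒵] [MeasurableSpace 𝒲] {M : PVModel 𝒰 𝒳 𝒜 𝒵 𝒲} {π : Policy 𝒳 𝒜}

section Kernels

variable [StandardBorelSpace 𝒜] [Nonempty 𝒜] [StandardBorelSpace 𝒲] [Nonempty 𝒲]

/-- The conditional law of the outcome proxy is also the right one under the interventional law
of the context. -/
lemma RatiosExist.lintegral_proxyKernel (h : M.RatiosExist π) {H : 𝒳 × 𝒰 × 𝒲 → ENNReal}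
    (hH : Measurable H) :
    ∫⁻ x, ∫⁻ u, ∫⁻ w, H (x, u, w) ∂(M.proxyKernel (u, x)) ∂(M.κ.fst x) ∂M.ptilde =
      ∫⁻ x, ∫⁻ s, H (x, s.1, s.2.2) ∂(M.κ x) ∂M.ptilde := by
  have hac := h.ptilde_absolutelyContinuous
  have hr : Measurable (M.ptilde.rnDeriv M.pX) := Measure.measurable_rnDeriv _ _
  have hK : Measurable fun p : 𝒳 × 𝒰 => ∫⁻ w, H (p.1, p.2, w) ∂(M.proxyKernel (p.2, p.1)) := by
    have : Measurable fun r : (𝒳 × 𝒰) × 𝒲 => H (r.1.1, r.1.2, r.2) := by fun_prop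
    exact this.lintegral_kernel_prod_right' (κ := M.proxyKernel.comap Prod.swap measurable_swap)
  have hI : Measurable fun x => ∫⁻ u, ∫⁻ w, H (x, u, w) ∂(M.proxyKernel (u, x)) ∂(M.κ.fst x) :=
    hK.lintegral_kernel_prod_right'
  have hJ : Measurable fun x => ∫⁻ s, H (x, s.1, s.2.2) ∂(M.κ x) := by
    have : Measurable fun r : 𝒳 × 𝒰 × 𝒵 × 𝒲 => H (r.1, r.2.1, r.2.2.2) := by fun_prop
    exact this.lintegral_kernel_prod_right'
  have e0 : M.law.map (fun o => (vU o, vX o)) = M.obsCore.map fun c => (c.1.1.2.1, c.1.1.1) :=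
    M.map_core_law (f := fun c => (c.1.1.2.1, c.1.1.1)) (by fun_prop)
  have e1 : M.law.map (fun o => ((vU o, vX o), vW o)) = M.obsCore.map
      fun c => ((c.1.1.2.1, c.1.1.1), c.1.1.2.2.2) :=
    M.map_core_law (f := fun c => ((c.1.1.2.1, c.1.1.1), c.1.1.2.2.2)) (by fun_prop)
  have hm := M.map_proxy_law
  rw [e0, e1] at hm
  -- The density of `ptilde` with respect to `pX` is put into the integrand, so that the
  -- observational disintegration of `W` can be used.
  have hG : Measurable fun q : (𝒰 × 𝒳) × 𝒲 =>
    M.ptilde.rnDeriv M.pX q.1.2 * H (q.1.2, q.1.1, q.2) := by fun_prop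
  have e2 : ∫⁻ q, M.ptilde.rnDeriv M.pX q.1.2 * H (q.1.2, q.1.1, q.2)
      ∂(M.obsCore.map fun c => ((c.1.1.2.1, c.1.1.1), c.1.1.2.2.2)) =
      ∫⁻ x, ∫⁻ s, M.ptilde.rnDeriv M.pX x * H (x, s.1, s.2.2) ∂(M.κ x) ∂M.pX := by
    rw [lintegral_map hG (by fun_prop)]
    exact M.lintegral_obsCore_context
      (F := fun p => M.ptilde.rnDeriv M.pX p.1 * H (p.1, p.2.1, p.2.2.2)) (by fun_prop)
  have e3 : ∫⁻ q, M.ptilde.rnDeriv M.pX q.1.2 * H (q.1.2, q.1.1, q.2)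
      ∂((M.obsCore.map fun c => (c.1.1.2.1, c.1.1.1)) ⊗ₘ M.proxyKernel) =
      ∫⁻ x, ∫⁻ s, M.ptilde.rnDeriv M.pX x * ∫⁻ w, H (x, s.1, w) ∂(M.proxyKernel (s.1, x))
        ∂(M.κ x) ∂M.pX := by
    have hL : Measurable fun p : 𝒳 × 𝒰 × 𝒵 × 𝒲 => M.ptilde.rnDeriv M.pX p.1 *
        ∫⁻ w, H (p.1, p.2.1, w) ∂(M.proxyKernel (p.2.1, p.1)) :=
      (hr.comp measurable_fst).mul (hK.comp (by fun_prop :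
        Measurable fun p : 𝒳 × 𝒰 × 𝒵 × 𝒲 => (p.1, p.2.1)))
    rw [Measure.lintegral_compProd hG, lintegral_map hG.lintegral_kernel_prod_right' (by fun_prop),
      ← M.lintegral_obsCore_context hL]
    refine lintegral_congr fun c => ?_
    exact lintegral_const_mul (μ := M.proxyKernel (c.1.1.2.1, c.1.1.1))
      (M.ptilde.rnDeriv M.pX c.1.1.1) (f := fun w => H (c.1.1.1, c.1.1.2.1, w)) (by fun_prop)
  rw [hm, e3] at e2
  rw [← Measure.withDensity_rnDeriv_eq _ _ hac, lintegral_withDensity_eq_lintegral_mul _ hr hI,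
    lintegral_withDensity_eq_lintegral_mul _ hr hJ]
  refine Eq.trans (lintegral_congr fun x => ?_) (e2.trans (lintegral_congr fun x => ?_))
  · have hKx : Measurable fun u => ∫⁻ w, H (x, u, w) ∂(M.proxyKernel (u, x)) :=
      hK.comp (by fun_prop : Measurable fun u : 𝒰 => (x, u))
    simp only [Pi.mul_apply]
    rw [Kernel.lintegral_fst _ _ hKx]
    exact (lintegral_const_mul _ (hKx.comp measurable_fst)).symm
  · exact lintegral_const_mul _ (f := fun s : 𝒰 × 𝒵 × 𝒲 => H (x, s.1, s.2.2)) (by fun_prop)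

/-- Under the interventional law, `(Y, W)` has the observational conditional law given
`(A, X, U)`. -/
lemma RatiosExist.num1_compProd (h : M.RatiosExist π) :
    ((M.num1 π).map fun q => (q.2.2, q.2.1, q.1)) ⊗ₘ M.proxyRewardKernel =
      (M.intCore π).map fun c => ((c.1.2, c.1.1.1, c.1.1.2.1), (c.2, c.1.1.2.2.2)) := by
  refine Measure.ext_of_lintegral _ fun F hF => ?_
  have hκ : Measurable fun s : 𝒜 × 𝒳 × 𝒰 => ∫⁻ v, F (s, v) ∂(M.proxyRewardKernel s) :=
    hF.lintegral_kernel_prod_right'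
  have hR : Measurable fun r : ((𝒳 × 𝒰 × 𝒲) × 𝒜) => ∫⁻ y, F ((r.2, r.1.1, r.1.2.1), (y, r.1.2.2))
      ∂(M.ρ (r.1.2.1, r.1.1, r.1.2.2, r.2)) := by
    have : Measurable fun q : ((𝒳 × 𝒰 × 𝒲) × 𝒜) × ℝ =>
      F ((q.1.2, q.1.1.1, q.1.1.2.1), (q.2, q.1.1.2.2)) := by fun_prop
    exact this.lintegral_kernel_prod_right' (κ := M.ρ.comap
      (fun r : (𝒳 × 𝒰 × 𝒲) × 𝒜 => (r.1.2.1, r.1.1, r.1.2.2, r.2)) (by fun_prop))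
  have hH : Measurable fun p : 𝒳 × 𝒰 × 𝒲 => ∫⁻ a, ∫⁻ y, F ((a, p.1, p.2.1), (y, p.2.2))
      ∂(M.ρ (p.2.1, p.1, p.2.2, a)) ∂(π.1 p.1) :=
    hR.lintegral_kernel_prod_right' (κ := π.1.comap Prod.fst measurable_fst)
  have hκ' : Measurable fun q : 𝒰 × 𝒳 × 𝒜 =>
      ∫⁻ v, F ((q.2.2, q.2.1, q.1), v) ∂(M.proxyRewardKernel (q.2.2, q.2.1, q.1)) :=
    hκ.comp (by fun_prop : Measurable fun q : 𝒰 × 𝒳 × 𝒜 => (q.2.2, q.2.1, q.1))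
  have hκ'' : Measurable fun p : 𝒳 × 𝒰 × 𝒜 =>
      ∫⁻ v, F ((p.2.2, p.1, p.2.1), v) ∂(M.proxyRewardKernel (p.2.2, p.1, p.2.1)) :=
    hκ.comp (by fun_prop : Measurable fun p : 𝒳 × 𝒰 × 𝒜 => (p.2.2, p.1, p.2.1))
  rw [Measure.lintegral_compProd hF, lintegral_map hκ (by fun_prop), num1,
    lintegral_map hκ' (by fun_prop), Measure.lintegral_compProd hκ'',
    lintegral_map hF (by fun_prop), M.lintegral_intCore (by fun_prop)]
  refine Eq.trans (lintegral_congr fun x => ?_) (h.lintegral_proxyKernel hH)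
  rw [Kernel.prod_apply]
  refine (lintegral_prod _ (hκ''.comp
    (by fun_prop : Measurable fun p : 𝒰 × 𝒜 => (x, p.1, p.2))).aemeasurable).trans ?_
  refine lintegral_congr fun u => ?_
  have e1 : ∀ a, ∫⁻ v, F ((a, x, u), v) ∂(M.proxyRewardKernel (a, x, u)) =
      ∫⁻ w, ∫⁻ y, F ((a, x, u), (y, w)) ∂(M.ρ (u, x, w, a)) ∂(M.proxyKernel (u, x)) := fun a =>
    M.lintegral_proxyRewardKernel (a, x, u) (F := fun v => F ((a, x, u), v)) (by fun_prop)
  simp only [Function.comp_apply, e1]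
  exact lintegral_lintegral_swap
    (hR.comp (by fun_prop : Measurable fun p : 𝒜 × 𝒲 => ((x, u, p.2), p.1))).aemeasurable

end Kernels

variable [StandardBorelSpace 𝒰] [StandardBorelSpace 𝒳] [StandardBorelSpace 𝒜]
  [StandardBorelSpace 𝒵] [StandardBorelSpace 𝒲] [Nonempty 𝒜] [Nonempty 𝒲]

/-- The shift function `b₁` moves the law given `(R_X,R_Z) = 1` to the interventional law, for
functions of `(Y,W,A,X,U)`. -/
lemma RatiosExist.integral_b1_mul (h : M.RatiosExist π) (hI : M.PVIndep) {b₁ : 𝒳 × 𝒜 × 𝒵 → ℝ}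
    (hb : M.IsShift π b₁) {ψ : (𝒜 × 𝒳 × 𝒰) × (ℝ × 𝒲) → ℝ} (hψ : Measurable ψ) {B : ℝ}
    (hB : ∀ p, |ψ p| ≤ B) :
    ∫ o, b₁ (vX o, vA o, vZ o) * ψ ((vA o, vX o, vU o), (vY o, vW o)) ∂(M.μ 0) =
      ∫ c, ψ ((c.1.2, c.1.1.1, c.1.1.2.1), (c.2, c.1.1.2.2.2)) ∂(M.intCore π) := by
  have h0 := h.law_mask_ne_zero 0
  have := M.isProbabilityMeasure_μ h0
  obtain ⟨hb1, hb2, hb3⟩ := hb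
  set ψb : 𝒜 × 𝒳 × 𝒰 → ℝ := fun s => ∫ v, ψ (s, v) ∂(M.proxyRewardKernel s) with hψb
  have hψbm : Measurable ψb :=
    (hψ.stronglyMeasurable.integral_kernel_prod_right' (κ := M.proxyRewardKernel)).measurable
  have hψbB : ∀ s, |ψb s| ≤ B := fun s => by
    refine (norm_integral_le_integral_norm (μ := M.proxyRewardKernel s) fun v => ψ (s, v)).trans ?_
    refine (integral_mono_of_nonneg (ae_of_all _ fun _ => norm_nonneg _) (integrable_const B)
      (ae_of_all _ fun v => hB (s, v))).trans ?_
    simp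
  have hS : Measurable fun o : Trial 𝒰 𝒳 𝒜 𝒵 𝒲 => (vA o, vX o, vU o) := by
    unfold vA vX vU; fun_prop
  have hSZ : Measurable fun o : Trial 𝒰 𝒳 𝒜 𝒵 𝒲 => ((vA o, vX o, vU o), vZ o) := by
    unfold vA vX vU vZ; fun_prop
  have hSZV : Measurable fun o : Trial 𝒰 𝒳 𝒜 𝒵 𝒲 =>
    (((vA o, vX o, vU o), vZ o), (vY o, vW o)) := by unfold vA vX vU vZ vY vW; fun_prop
  have hXUA : Measurable fun o : Trial 𝒰 𝒳 𝒜 𝒵 𝒲 => (vX o, vU o, vA o) := by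
    unfold vA vX vU; fun_prop
  have hUXA : Measurable fun o : Trial 𝒰 𝒳 𝒜 𝒵 𝒲 => (vU o, vX o, vA o) := by
    unfold vA vX vU; fun_prop
  -- integrate out `(Y, W)`
  have e1 : ∫ o, b₁ (vX o, vA o, vZ o) * ψ ((vA o, vX o, vU o), (vY o, vW o)) ∂(M.μ 0) =
      ∫ o, b₁ (vX o, vA o, vZ o) * ψb (vA o, vX o, vU o) ∂(M.μ 0) := by
    have hG : Measurable fun r : ((𝒜 × 𝒳 × 𝒰) × 𝒵) × (ℝ × 𝒲) =>
        b₁ (r.1.1.2.1, r.1.1.1, r.1.2) * ψ (r.1.1, r.2) :=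
      (hb1.comp (by fun_prop)).mul (by fun_prop)
    have hG' : Measurable fun r : (𝒜 × 𝒳 × 𝒰) × 𝒵 => b₁ (r.1.2.1, r.1.1, r.2) * ψb r.1 :=
      (hb1.comp (by fun_prop)).mul (by fun_prop)
    have hint : Integrable (fun r : ((𝒜 × 𝒳 × 𝒰) × 𝒵) × (ℝ × 𝒲) =>
        b₁ (r.1.1.2.1, r.1.1.1, r.1.2) * ψ (r.1.1, r.2))
        ((M.μ 0).map fun o => (((vA o, vX o, vU o), vZ o), (vY o, vW o))) := by
      refine (integrable_map_measure hG.aestronglyMeasurable hSZV.aemeasurable).2 ?_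
      exact Integrable.mul_bdd (c := B) hb2 (hψ.comp (by fun_prop : Measurable
        fun r : ((𝒜 × 𝒳 × 𝒰) × 𝒵) × (ℝ × 𝒲) => (r.1.1, r.2)) |>.comp hSZV).aestronglyMeasurable
        (ae_of_all _ fun o => hB _)
    calc _ = ∫ r, b₁ (r.1.1.2.1, r.1.1.1, r.1.2) * ψ (r.1.1, r.2)
          ∂((M.μ 0).map fun o => (((vA o, vX o, vU o), vZ o), (vY o, vW o))) :=
          (integral_map hSZV.aemeasurable hG.aestronglyMeasurable).symm
      _ = ∫ r, b₁ (r.1.2.1, r.1.1, r.2) * ψb r.1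
          ∂((M.μ 0).map fun o => ((vA o, vX o, vU o), vZ o)) := by
          rw [hI.map_μ_zero h0] at hint ⊢
          rw [Measure.integral_compProd hint]
          refine integral_congr_ae (ae_of_all _ fun r => ?_)
          exact integral_const_mul (μ := M.proxyRewardKernel r.1) (b₁ (r.1.2.1, r.1.1, r.2))
            fun v => ψ (r.1, v)
      _ = _ := integral_map hSZ.aemeasurable hG'.aestronglyMeasurable
  -- project `b₁` on `(X, U, A)`
  have e2 : ∫ o, b₁ (vX o, vA o, vZ o) * ψb (vA o, vX o, vU o) ∂(M.μ 0) =
      ∫ o, ((M.num1 π).rnDeriv M.den1 (vU o, vX o, vA o)).toReal * ψb (vA o, vX o, vU o)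
        ∂(M.μ 0) := by
    have hsm : StronglyMeasurable[MeasurableSpace.comap
        (fun o : Trial 𝒰 𝒳 𝒜 𝒵 𝒲 => (vX o, vU o, vA o)) inferInstance]
        fun o => ψb (vA o, vX o, vU o) := by
      have h1 : Measurable fun t : 𝒳 × 𝒰 × 𝒜 => ψb (t.2.2, t.1, t.2.1) := by fun_prop
      exact (h1.comp (comap_measurable _)).stronglyMeasurable
    have hpull := condExp_mul_of_stronglyMeasurable_right hsm
      (Integrable.mul_bdd (c := B) hb2 (hψbm.comp hS).aestronglyMeasurable (ae_of_all _ fun o => hψbB _)) hb2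
    rw [← integral_condExp hXUA.comap_le]
    refine integral_congr_ae ?_
    filter_upwards [hpull, hb3] with o ho1 ho2
    exact ho1.trans (by rw [Pi.mul_apply, ho2])
  -- The projected weight is the density of the interventional law of `(U, X, A)`; `num1_compProd`
  -- afterwards restores `(Y, W)` with the same conditional law.
  have e3 : ∫ o, ((M.num1 π).rnDeriv M.den1 (vU o, vX o, vA o)).toReal * ψb (vA o, vX o, vU o)
      ∂(M.μ 0) = ∫ q, ψb (q.2.2, q.2.1, q.1) ∂(M.num1 π) := by
    have hr : Measurable ((M.num1 π).rnDeriv M.den1) := Measure.measurable_rnDeriv _ _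
    have hG : Measurable fun q : 𝒰 × 𝒳 × 𝒜 =>
      ((M.num1 π).rnDeriv M.den1 q).toReal * ψb (q.2.2, q.2.1, q.1) := by fun_prop
    rw [← integral_toReal_rnDeriv_mul h.ac1]
    exact (integral_map hUXA.aemeasurable hG.aestronglyMeasurable).symm
  have hint : Integrable ψ (((M.num1 π).map fun q => (q.2.2, q.2.1, q.1)) ⊗ₘ
      M.proxyRewardKernel) := by
    have : IsProbabilityMeasure ((M.num1 π).map fun q => (q.2.2, q.2.1, q.1)) :=
      Measure.isProbabilityMeasure_map (by fun_prop)
    exact Integrable.of_bound hψ.aestronglyMeasurable B (ae_of_all _ hB)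
  rw [e1, e2, e3, ← integral_map (φ := fun q : 𝒰 × 𝒳 × 𝒜 => (q.2.2, q.2.1, q.1)) (by fun_prop)
    hψbm.aestronglyMeasurable, ← Measure.integral_compProd hint, h.num1_compProd,
    integral_map (by fun_prop) hψ.aestronglyMeasurable]

end PVModel

/-! ### The error identity for predicted values. -/

namespace PVModel

variable {𝒰 𝒳 𝒜 𝒵 𝒲 : Type*} [MeasurableSpace 𝒰] [MeasurableSpace 𝒳] [MeasurableSpace 𝒜]
  [MeasurableSpace 𝒵] [MeasurableSpace 𝒲] {M : PVModel 𝒰 𝒳 𝒜 𝒵 𝒲} {π : Policy 𝒳 𝒜} {L : ℝ}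

lemma ae_coreLaw_abs_reward_le (hr : ∀ p, ∀ᵐ y ∂(M.ρ p), |y| ≤ L) (ν : Measure 𝒳) [SFinite ν]
    (π : Kernel (𝒳 × 𝒰 × 𝒵 × 𝒲) 𝒜) [IsSFiniteKernel π] : ∀ᵐ c ∂(M.coreLaw ν π), |c.2| ≤ L := by
  have hs : MeasurableSet {c : Core 𝒰 𝒳 𝒜 𝒵 𝒲 | |c.2| ≤ L} :=
    measurableSet_le (by fun_prop) measurable_const
  exact (Measure.ae_compProd_iff hs).2 (ae_of_all _ fun p => hr _)

lemma ae_law_abs_reward_le (hr : ∀ p, ∀ᵐ y ∂(M.ρ p), |y| ≤ L) : ∀ᵐ o ∂M.law, |vY o| ≤ L := by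
  have h1 : ∀ᵐ c ∂M.obsCore, |c.2| ≤ L := ae_coreLaw_abs_reward_le hr _ _
  have h2 := M.map_core_law measurable_id
  rw [Measure.map_id] at h2
  rw [← h2] at h1
  exact ae_of_ae_map (by fun_prop) h1

lemma ae_μ_abs_reward_le (hr : ∀ p, ∀ᵐ y ∂(M.ρ p), |y| ≤ L) (k : Fin 4) :
    ∀ᵐ o ∂(M.μ k), |vY o| ≤ L :=
  cond_absolutelyContinuous.ae_le (ae_law_abs_reward_le hr)

lemma ae_intCore_abs_reward_le (hr : ∀ p, ∀ᵐ y ∂(M.ρ p), |y| ≤ L) (π : Policy 𝒳 𝒜) :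
    ∀ᵐ c ∂(M.intCore π), |c.2| ≤ L := ae_coreLaw_abs_reward_le hr _ _

instance : IsProbabilityMeasure (M.intCore π) := by unfold intCore; infer_instance

lemma map_context_action_intCore :
    (M.intCore π).map (fun c => (c.1.1.1, c.1.2)) = M.ptilde ⊗ₘ π.1 := by
  refine Measure.ext_of_lintegral _ fun F hF => ?_
  rw [lintegral_map hF (by fun_prop), M.lintegral_intCore (by fun_prop),
    Measure.lintegral_compProd hF]
  simp

lemma abs_integral_reward_le (hr : ∀ p, ∀ᵐ y ∂(M.ρ p), |y| ≤ L) (p : 𝒰 × 𝒳 × 𝒲 × 𝒜) :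
    |∫ y, y ∂(M.ρ p)| ≤ L := by
  have := norm_integral_le_of_norm_le_const (μ := M.ρ p) (f := fun y => y) (hr p)
  simpa using this

variable (M) in
lemma measurable_integral_reward : Measurable fun p => ∫ y, y ∂(M.ρ p) :=
  (measurable_snd.stronglyMeasurable.integral_kernel_prod_right' (κ := M.ρ)).measurable

variable (M) in
lemma integrable_cate (hr : ∀ p, ∀ᵐ y ∂(M.ρ p), |y| ≤ L) : Integrable M.cate (M.ptilde ⊗ₘ π.1) := by
  have hm2 : Measurable fun q : (𝒳 × 𝒜) × (𝒰 × 𝒵 × 𝒲) =>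
      ∫ y, y ∂(M.ρ (q.2.1, q.1.1, q.2.2.2, q.1.2)) :=
    M.measurable_integral_reward.comp (by fun_prop)
  refine Integrable.of_bound (hm2.stronglyMeasurable.integral_kernel_prod_right'
    (κ := M.κ.comap Prod.fst measurable_fst)).aestronglyMeasurable L (ae_of_all _ fun p => ?_)
  have := norm_integral_le_of_norm_le_const (μ := M.κ p.1)
    (f := fun s => ∫ y, y ∂(M.ρ (s.1, p.1, s.2.2, p.2)))
    (ae_of_all _ fun s => abs_integral_reward_le hr _)
  rw [probReal_univ, mul_one] at this
  exact this

/-- The value of the true CATE is the average reward. -/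
lemma valueOf_cate (hr : ∀ p, ∀ᵐ y ∂(M.ρ p), |y| ≤ L) : M.valueOf M.cate π = M.value π := by
  have hL := abs_integral_reward_le hr
  have hm := M.measurable_integral_reward
  have hi : Integrable (fun c : Core 𝒰 𝒳 𝒜 𝒵 𝒲 => c.2) (M.intCore π) :=
    Integrable.of_bound (by fun_prop) L (ae_intCore_abs_reward_le hr π)
  have hm1 : Measurable fun q : (𝒳 × 𝒰 × 𝒵 × 𝒲) × 𝒜 =>
      ∫ y, y ∂(M.ρ (q.1.2.1, q.1.1, q.1.2.2.2, q.2)) :=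
    hm.comp (by fun_prop)
  have hm2 : Measurable fun q : (𝒳 × 𝒜) × (𝒰 × 𝒵 × 𝒲) =>
      ∫ y, y ∂(M.ρ (q.2.1, q.1.1, q.2.2.2, q.1.2)) :=
    hm.comp (by fun_prop)
  have hi1 : Integrable (fun q : (𝒳 × 𝒰 × 𝒵 × 𝒲) × 𝒜 =>
      ∫ y, y ∂(M.ρ (q.1.2.1, q.1.1, q.1.2.2.2, q.2)))
      ((M.ptilde ⊗ₘ M.κ) ⊗ₘ (π.1.comap Prod.fst measurable_fst)) :=
    Integrable.of_bound hm1.aestronglyMeasurable L (ae_of_all _ fun _ => hL _)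
  have hi2 : Integrable (fun p : 𝒳 × 𝒰 × 𝒵 × 𝒲 => ∫ a,
      ∫ y, y ∂(M.ρ (p.2.1, p.1, p.2.2.2, a)) ∂(π.1 p.1)) (M.ptilde ⊗ₘ M.κ) := by
    refine Integrable.of_bound (hm1.stronglyMeasurable.integral_kernel_prod_right'
      (κ := π.1.comap Prod.fst measurable_fst)).aestronglyMeasurable L (ae_of_all _ fun p => ?_)
    have := norm_integral_le_of_norm_le_const (μ := π.1 p.1)
      (f := fun a => ∫ y, y ∂(M.ρ (p.2.1, p.1, p.2.2.2, a))) (ae_of_all _ fun a => hL _)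
    rw [probReal_univ, mul_one] at this
    exact this
  have hcate := M.integrable_cate hr (π := π)
  have e1 : M.value π = ∫ q, ∫ y, y ∂(M.ρ (q.1.2.1, q.1.1, q.1.2.2.2, q.2))
      ∂((M.ptilde ⊗ₘ M.κ) ⊗ₘ (π.1.comap Prod.fst measurable_fst)) := by
    rw [value]
    exact Measure.integral_compProd hi
  have e2 : M.value π = ∫ p, ∫ a, ∫ y, y ∂(M.ρ (p.2.1, p.1, p.2.2.2, a)) ∂(π.1 p.1)
      ∂(M.ptilde ⊗ₘ M.κ) := by rw [e1, Measure.integral_compProd hi1]; rfl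
  rw [e2, Measure.integral_compProd hi2, valueOf, Measure.integral_compProd hcate]
  refine integral_congr_ae (ae_of_all _ fun x => ?_)
  refine integral_integral_swap (μ := π.1 x) (ν := M.κ x)
    (f := fun a (s : 𝒰 × 𝒵 × 𝒲) => ∫ y, y ∂(M.ρ (s.1, x, s.2.2, a))) ?_
  exact Integrable.of_bound (hm2.comp (by fun_prop : Measurable
    fun p : 𝒜 × (𝒰 × 𝒵 × 𝒲) => ((x, p.1), p.2))).aestronglyMeasurable L (ae_of_all _ fun _ => hL _)

lemma instAlg_le (k : Fin 4) : instAlg k ≤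
    (inferInstance : MeasurableSpace (Trial 𝒰 𝒳 𝒜 𝒵 𝒲)) := by
  fin_cases k
  · exact Measurable.comap_le (by unfold inst0 vA vX vZ; fun_prop)
  · exact Measurable.comap_le (by unfold inst1 vA vX vZ vW; fun_prop)
  · exact Measurable.comap_le (by unfold inst2 vA vX vA' vW; fun_prop)
  · exact Measurable.comap_le (by unfold inst3 vX vA'; fun_prop)

section Weights

variable [StandardBorelSpace 𝒜] [Nonempty 𝒜] [StandardBorelSpace 𝒲] [Nonempty 𝒲]

/-- The weights `b₁, …, b₄` as functions of the trial. -/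
def weight (M : PVModel 𝒰 𝒳 𝒜 𝒵 𝒲) (π : Policy 𝒳 𝒜) (b₁ : 𝒳 × 𝒜 × 𝒵 → ℝ) :
    Fin 4 → Trial 𝒰 𝒳 𝒜 𝒵 𝒲 → ℝ :=
  ![fun o => b₁ (vX o, vA o, vZ o), fun o => M.b2 b₁ (vA o, vW o, vX o, vZ o),
    fun o => M.b3 π ((vW o, vX o, vA o), vA' o), fun o => M.b4 π (vX o, vA' o)]

lemma shiftNorm_eq_sum (b₁ : 𝒳 × 𝒜 × 𝒵 → ℝ) :
    M.shiftNorm π b₁ = ∑ k, eLpNorm (M.weight π b₁ k) 2 (M.μ k) := by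
  rw [Fin.sum_univ_four]
  rfl

/-- Each weight depends only on the conditioning variables of its equation. This is what allows
residuals to be replaced by their projections. -/
lemma stronglyMeasurable_weight {b₁ : 𝒳 × 𝒜 × 𝒵 → ℝ} (hb : Measurable b₁) (k : Fin 4) :
    StronglyMeasurable[instAlg k] (M.weight π b₁ k) := by
  have h3 : Measurable fun p : 𝒜 × 𝒲 × 𝒳 × 𝒜 =>
      ((M.num3 π).rnDeriv M.den3 ((p.2.1, p.2.2.1, p.1), p.2.2.2)).toReal :=
    ((Measure.measurable_rnDeriv _ _).comp (by fun_prop)).ennreal_toReal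
  have h2 : Measurable (M.b2 b₁) :=
    (hb.comp (by fun_prop)).mul ((Measure.measurable_rnDeriv _ _).comp (by fun_prop)).ennreal_toReal
  have h4 : Measurable (M.b4 π) := (Measure.measurable_rnDeriv _ _).ennreal_toReal
  fin_cases k
  · exact ((hb.comp (by fun_prop : Measurable fun p : 𝒜 × 𝒳 × 𝒵 => (p.2.1, p.1, p.2.2))).comp
      (comap_measurable inst0)).stronglyMeasurable
  · exact (h2.comp (comap_measurable inst1)).stronglyMeasurable
  · exact (h3.comp (comap_measurable inst2)).stronglyMeasurable
  · exact (h4.comp (comap_measurable inst3)).stronglyMeasurable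

lemma RatiosExist.integrable_b4 (h : M.RatiosExist π) :
    Integrable (fun o => M.b4 π (vX o, vA' o)) (M.μ 3) := by
  have h1 : Integrable (M.b4 π) M.den4 := Measure.integrable_toReal_rnDeriv
  have h4 : Measurable (M.b4 π) := (Measure.measurable_rnDeriv _ _).ennreal_toReal
  rw [h.den4_eq_map, Measure.map_map (by fun_prop) measurable_forget] at h1
  exact (integrable_map_measure h4.aestronglyMeasurable
    (Measurable.aemeasurable (by unfold vX vA'; fun_prop))).1 h1

end Weights

variable [StandardBorelSpace 𝒰] [StandardBorelSpace 𝒳] [StandardBorelSpace 𝒜]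
  [StandardBorelSpace 𝒵] [StandardBorelSpace 𝒲] [Nonempty 𝒜] [Nonempty 𝒲]

/-- The error of a predicted value is a combination of weighted residuals. -/
lemma RatiosExist.sum_integral_weight_mul_resid (h : M.RatiosExist π) (hI : M.PVIndep)
    {b₁ : 𝒳 × 𝒜 × 𝒵 → ℝ} (hb : M.IsShift π b₁) (hr : ∀ p, ∀ᵐ y ∂(M.ρ p), |y| ≤ L)
    {f : Bridge 𝒳 𝒜 𝒵 𝒲} (hf : f.Meas) {B : ℝ} (hB : (∀ p, |f.h1 p| ≤ B) ∧ (∀ p, |f.h2 p| ≤ B) ∧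
      (∀ p, |f.h3 p| ≤ B) ∧ (∀ p, |f.g p| ≤ B)) :
    ∑ k, ∫ o, M.weight π b₁ k o * f.resid k o ∂(M.μ k) = M.valueOf f.g π - M.value π := by
  obtain ⟨m1, m2, m3, m4⟩ := hf
  obtain ⟨B1, B2, B3, B4⟩ := hB
  have hbm := hb.1
  have hb1 := hb.2.1
  -- first two equations
  have t1 : ∫ o, M.weight π b₁ 1 o * f.resid 1 o ∂(M.μ 1) = ∫ o, b₁ (vX o, vA o, vZ o) *
      (f.h2 (vA o, vW o, vX o) - f.h1 (vY o, vA o, vX o, vZ o)) ∂(M.μ 0) :=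
    h.integral_b2_mul hbm (F := fun p => f.h2 (p.1.1.2, p.1.1.1.2.2.2, p.1.1.1.1) -
      f.h1 (p.1.2, p.1.1.2, p.1.1.1.1, p.1.1.1.2.2.1)) (by fun_prop)
  -- Under `μ 3` with weight `b4`, the `h3` term cancels the one in the last equation, just as `h1`
  -- cancels under `μ 0`.
  have t2 : ∫ o, M.weight π b₁ 2 o * f.resid 2 o ∂(M.μ 2) = ∫ o, M.b4 π (vX o, vA' o) *
      (f.h3 (vY o, vA o, vX o, vA' o) - f.h2 (vA' o, vW o, vX o)) ∂(M.μ 3) :=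
    h.integral_b3_mul (F := fun p => f.h3 (p.1.2, p.1.1.2, p.1.1.1.1, p.2) -
      f.h2 (p.2, p.1.1.1.2.2.2, p.1.1.1.1)) (by fun_prop)
  have mY : Measurable (vY : Trial 𝒰 𝒳 𝒜 𝒵 𝒲 → ℝ) := by unfold vY; fun_prop
  have mh1 : Measurable fun o : Trial 𝒰 𝒳 𝒜 𝒵 𝒲 => f.h1 (vY o, vA o, vX o, vZ o) := by
    unfold vY vA vX vZ; fun_prop
  have mh2 : Measurable fun o : Trial 𝒰 𝒳 𝒜 𝒵 𝒲 => f.h2 (vA o, vW o, vX o) := by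
    unfold vA vX vW; fun_prop
  have mh2' : Measurable fun o : Trial 𝒰 𝒳 𝒜 𝒵 𝒲 => f.h2 (vA' o, vW o, vX o) := by
    unfold vA' vX vW; fun_prop
  have mh3 : Measurable fun o : Trial 𝒰 𝒳 𝒜 𝒵 𝒲 => f.h3 (vY o, vA o, vX o, vA' o) := by
    unfold vY vA vX vA'; fun_prop
  have mg : Measurable fun o : Trial 𝒰 𝒳 𝒜 𝒵 𝒲 => f.g (vX o, vA' o) := by
    unfold vX vA'; fun_prop
  have iY : Integrable (fun o => b₁ (vX o, vA o, vZ o) * vY o) (M.μ 0) :=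
    hb1.mul_bdd mY.aestronglyMeasurable (ae_μ_abs_reward_le hr 0)
  have ih1 : Integrable (fun o => b₁ (vX o, vA o, vZ o) * f.h1 (vY o, vA o, vX o, vZ o)) (M.μ 0) :=
    hb1.mul_bdd mh1.aestronglyMeasurable (ae_of_all _ fun o => B1 _)
  have ih2 : Integrable (fun o => b₁ (vX o, vA o, vZ o) * f.h2 (vA o, vW o, vX o)) (M.μ 0) :=
    hb1.mul_bdd mh2.aestronglyMeasurable (ae_of_all _ fun o => B2 _)
  have i4 := h.integrable_b4
  have ih2' : Integrable (fun o => M.b4 π (vX o, vA' o) * f.h2 (vA' o, vW o, vX o)) (M.μ 3) :=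
    i4.mul_bdd mh2'.aestronglyMeasurable (ae_of_all _ fun o => B2 _)
  have ih3 : Integrable (fun o => M.b4 π (vX o, vA' o) * f.h3 (vY o, vA o, vX o, vA' o)) (M.μ 3) :=
    i4.mul_bdd mh3.aestronglyMeasurable (ae_of_all _ fun o => B3 _)
  have ig : Integrable (fun o => M.b4 π (vX o, vA' o) * f.g (vX o, vA' o)) (M.μ 3) :=
    i4.mul_bdd mg.aestronglyMeasurable (ae_of_all _ fun o => B4 _)
  have t0 : ∫ o, M.weight π b₁ 0 o * f.resid 0 o ∂(M.μ 0) = ∫ o, b₁ (vX o, vA o, vZ o) *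
      (f.h1 (vY o, vA o, vX o, vZ o) - vY o) ∂(M.μ 0) := rfl
  have t3 : ∫ o, M.weight π b₁ 3 o * f.resid 3 o ∂(M.μ 3) = ∫ o, M.b4 π (vX o, vA' o) *
      (f.g (vX o, vA' o) - f.h3 (vY o, vA o, vX o, vA' o)) ∂(M.μ 3) := rfl
  -- clamp the reward
  set cl : ℝ → ℝ := fun y => max (-|L|) (min |L| y) with hcl
  have hclm : Measurable cl := by fun_prop
  have hclB : ∀ y, |cl y| ≤ |L| := fun y => by
    rw [abs_le]
    exact ⟨le_max_left _ _, max_le (by linarith [abs_nonneg L]) (min_le_left _ _)⟩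
  have hcleq : ∀ y, |y| ≤ L → cl y = y := fun y hy => by
    have h1 : |y| ≤ |L| := hy.trans (le_abs_self L)
    rw [abs_le] at h1
    simp only [hcl]
    rw [min_eq_right h1.2, max_eq_right h1.1]
  -- `integral_b1_mul` wants a function bounded everywhere, while the reward is bounded only almost
  -- surely; clamping changes neither side.
  have e1 : ∫ o, b₁ (vX o, vA o, vZ o) * (f.h2 (vA o, vW o, vX o) - vY o) ∂(M.μ 0) =
      ∫ c, (f.h2 (c.1.2, c.1.1.2.2.2, c.1.1.1) - c.2) ∂(M.intCore π) := by
    have h1 := h.integral_b1_mul hI hb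
      (ψ := fun q => f.h2 (q.1.1, q.2.2, q.1.2.1) - cl q.2.1) (by fun_prop) (B := B + |L|)
      (fun p => (abs_sub _ _).trans (add_le_add (B2 _) (hclB _)))
    refine Eq.trans (integral_congr_ae ?_) (h1.trans (integral_congr_ae ?_))
    · filter_upwards [ae_μ_abs_reward_le hr 0] with o ho
      rw [hcleq _ ho]
    · filter_upwards [ae_intCore_abs_reward_le hr π] with c hc
      rw [hcleq _ hc]
  have e2 := h.integral_b4_mul (G := fun p => f.g (p.1, p.2.1) - f.h2 (p.2.1, p.2.2, p.1))
    (by fun_prop)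
  have iY' : Integrable (fun c : Core 𝒰 𝒳 𝒜 𝒵 𝒲 => c.2) (M.intCore π) :=
    Integrable.of_bound (by fun_prop) L (ae_intCore_abs_reward_le hr π)
  have ih' : Integrable (fun c : Core 𝒰 𝒳 𝒜 𝒵 𝒲 => f.h2 (c.1.2, c.1.1.2.2.2, c.1.1.1))
      (M.intCore π) :=
    Integrable.of_bound (Measurable.aestronglyMeasurable (by fun_prop)) B (ae_of_all _ fun c => B2 _)
  have ig' : Integrable (fun c : Core 𝒰 𝒳 𝒜 𝒵 𝒲 => f.g (c.1.1.1, c.1.2)) (M.intCore π) :=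
    Integrable.of_bound (Measurable.aestronglyMeasurable (by fun_prop)) B (ae_of_all _ fun c => B4 _)
  have e3 : ∫ c, f.g (c.1.1.1, c.1.2) ∂(M.intCore π) = M.valueOf f.g π := by
    rw [valueOf, ← map_context_action_intCore (M := M),
      integral_map (by fun_prop) m4.aestronglyMeasurable]
  rw [Fin.sum_univ_four, t0, t1, t2, t3]
  simp only [mul_sub] at e1 e2 ⊢
  rw [integral_sub ih1 iY, integral_sub ih2 ih1, integral_sub ih3 ih2', integral_sub ig ih3]
  rw [integral_sub ih2 iY, integral_sub ih' iY'] at e1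
  rw [integral_sub ig ih2', integral_sub ig' ih', e3] at e2
  rw [value]
  linarith

end PVModel

/-! ### Structure of the test and product classes. -/

section Classes

lemma pointwiseMeasurable_image_comp {α β : Type*} [MeasurableSpace α] [MeasurableSpace β]
    {F : Set (β → ℝ)} (hF : PointwiseMeasurable F) {φ : α → β} (hφ : Measurable φ) :
    PointwiseMeasurable ((fun θ => θ ∘ φ) '' F) := by
  obtain ⟨h1, F₀, h2, h3, h4⟩ := hF
  refine ⟨?_, (fun θ => θ ∘ φ) '' F₀, Set.image_mono h2, h3.image _, ?_⟩
  · rintro _ ⟨θ, hθ, rfl⟩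
    exact (h1 θ hθ).comp hφ
  · rintro _ ⟨θ, hθ, rfl⟩
    obtain ⟨s, hs1, hs2⟩ := h4 θ hθ
    exact ⟨fun n => s n ∘ φ, fun n => ⟨s n, hs1 n, rfl⟩, fun a => hs2 (φ a)⟩

lemma starConvex_image_comp {α β : Type*} {F : Set (β → ℝ)} (hF : StarConvex ℝ 0 F) (φ : α → β) :
    StarConvex ℝ 0 ((fun θ => θ ∘ φ) '' F) := by
  rintro _ ⟨θ, hθ, rfl⟩ a b ha hb hab
  exact ⟨a • 0 + b • θ, hF hθ ha hb hab, rfl⟩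

variable {𝒰 𝒳 𝒜 𝒵 𝒲 : Type*}

lemma DualClass.StarShaped.onTrial {Θ : DualClass 𝒳 𝒜 𝒵 𝒲} (h : Θ.StarShaped) (k : Fin 4) :
    StarConvex ℝ 0 (Θ.onTrial k : Set (Trial 𝒰 𝒳 𝒜 𝒵 𝒲 → ℝ)) := by
  obtain ⟨h1, h2, h3, h4⟩ := h
  fin_cases k
  exacts [starConvex_image_comp h1 _, starConvex_image_comp h2 _, starConvex_image_comp h3 _,
    starConvex_image_comp h4 _]

lemma DualClass.StarShaped.zero_mem_onTrial {Θ : DualClass 𝒳 𝒜 𝒵 𝒲} {k : Fin 4}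
    (hΘ : Θ.StarShaped)
    (h : (Θ.onTrial k : Set (Trial 𝒰 𝒳 𝒜 𝒵 𝒲 → ℝ)).Nonempty) :
    (0 : Trial 𝒰 𝒳 𝒜 𝒵 𝒲 → ℝ) ∈ Θ.onTrial k := by
  obtain ⟨θ, hθ⟩ := h
  have := hΘ.onTrial k hθ zero_le_one le_rfl (add_zero 1)
  simpa using this

/-- Scaling the test function scales the product, so star-shapedness comes from the test class alone
and the bridge class may be arbitrary. -/
lemma starConvex_prodClass {Θ : DualClass 𝒳 𝒜 𝒵 𝒲} (h : Θ.StarShaped) (ℋ : Set (Bridge 𝒳 𝒜 𝒵 𝒲))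
    (k : Fin 4) : StarConvex ℝ 0 (prodClass ℋ Θ k : Set (Trial 𝒰 𝒳 𝒜 𝒵 𝒲 → ℝ)) := by
  rintro _ ⟨f, hf, θ, hθ, rfl⟩ a b ha hb hab
  refine ⟨f, hf, a • 0 + b • θ, h.onTrial k hθ ha hb hab, ?_⟩
  ext o
  simp only [smul_zero, zero_add, Pi.smul_apply, smul_eq_mul]
  ring

lemma abs_onTrial_le {Θ : DualClass 𝒳 𝒜 𝒵 𝒲} {L : ℝ} (h : (∀ θ ∈ Θ.Θ1, ∀ p, |θ p| ≤ L) ∧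
    (∀ θ ∈ Θ.Θ2, ∀ p, |θ p| ≤ L) ∧ (∀ θ ∈ Θ.Θ3, ∀ p, |θ p| ≤ L) ∧ (∀ θ ∈ Θ.Θ4, ∀ p, |θ p| ≤ L))
    {k : Fin 4} {θ : Trial 𝒰 𝒳 𝒜 𝒵 𝒲 → ℝ} (hθ : θ ∈ Θ.onTrial k) (o : Trial 𝒰 𝒳 𝒜 𝒵 𝒲) :
    |θ o| ≤ L := by
  obtain ⟨h1, h2, h3, h4⟩ := h
  fin_cases k <;> obtain ⟨θ, hθ, rfl⟩ := hθ
  exacts [h1 _ hθ _, h2 _ hθ _, h3 _ hθ _, h4 _ hθ _]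

variable [MeasurableSpace 𝒳] [MeasurableSpace 𝒜] [MeasurableSpace 𝒵] [MeasurableSpace 𝒲]

lemma DualClass.Meas.stronglyMeasurable_onTrial {Θ : DualClass 𝒳 𝒜 𝒵 𝒲} (h : Θ.Meas) {k : Fin 4}
    {θ : Trial 𝒰 𝒳 𝒜 𝒵 𝒲 → ℝ} (hθ : θ ∈ Θ.onTrial k) : StronglyMeasurable[instAlg k] θ := by
  obtain ⟨h1, h2, h3, h4⟩ := h
  fin_cases k <;> obtain ⟨θ, hθ, rfl⟩ := hθ
  · exact ((h1.1 θ hθ).comp (comap_measurable inst0)).stronglyMeasurable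
  · exact ((h2.1 θ hθ).comp (comap_measurable inst1)).stronglyMeasurable
  · exact ((h3.1 θ hθ).comp (comap_measurable inst2)).stronglyMeasurable
  · exact ((h4.1 θ hθ).comp (comap_measurable inst3)).stronglyMeasurable

variable [MeasurableSpace 𝒰]

lemma measurable_inst0 : Measurable (inst0 : Trial 𝒰 𝒳 𝒜 𝒵 𝒲 → _) := by
  unfold inst0 vA vX vZ; fun_prop

lemma measurable_inst1 : Measurable (inst1 : Trial 𝒰 𝒳 𝒜 𝒵 𝒲 → _) := by
  unfold inst1 vA vX vZ vW; fun_prop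

lemma measurable_inst2 : Measurable (inst2 : Trial 𝒰 𝒳 𝒜 𝒵 𝒲 → _) := by
  unfold inst2 vA vX vA' vW; fun_prop

lemma measurable_inst3 : Measurable (inst3 : Trial 𝒰 𝒳 𝒜 𝒵 𝒲 → _) := by
  unfold inst3 vX vA'; fun_prop

lemma DualClass.Meas.onTrial {Θ : DualClass 𝒳 𝒜 𝒵 𝒲} (h : Θ.Meas) (k : Fin 4) :
    PointwiseMeasurable (Θ.onTrial k : Set (Trial 𝒰 𝒳 𝒜 𝒵 𝒲 → ℝ)) := by
  obtain ⟨h1, h2, h3, h4⟩ := h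
  fin_cases k
  exacts [pointwiseMeasurable_image_comp h1 measurable_inst0,
    pointwiseMeasurable_image_comp h2 measurable_inst1,
    pointwiseMeasurable_image_comp h3 measurable_inst2,
    pointwiseMeasurable_image_comp h4 measurable_inst3]

lemma Bridge.Meas.measurable_resid {h : Bridge 𝒳 𝒜 𝒵 𝒲} (hm : h.Meas) (k : Fin 4) :
    Measurable (h.resid k : Trial 𝒰 𝒳 𝒜 𝒵 𝒲 → ℝ) := by
  obtain ⟨m1, m2, m3, m4⟩ := hm
  have mY : Measurable (vY : Trial 𝒰 𝒳 𝒜 𝒵 𝒲 → ℝ) := by unfold vY; fun_prop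
  have mA : Measurable (vA : Trial 𝒰 𝒳 𝒜 𝒵 𝒲 → 𝒜) := by unfold vA; fun_prop
  have mA' : Measurable (vA' : Trial 𝒰 𝒳 𝒜 𝒵 𝒲 → 𝒜) := by unfold vA'; fun_prop
  have mX : Measurable (vX : Trial 𝒰 𝒳 𝒜 𝒵 𝒲 → 𝒳) := by unfold vX; fun_prop
  have mZ : Measurable (vZ : Trial 𝒰 𝒳 𝒜 𝒵 𝒲 → 𝒵) := by unfold vZ; fun_prop
  have mW : Measurable (vW : Trial 𝒰 𝒳 𝒜 𝒵 𝒲 → 𝒲) := by unfold vW; fun_prop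
  fin_cases k
  · exact (by fun_prop : Measurable fun o : Trial 𝒰 𝒳 𝒜 𝒵 𝒲 =>
      h.h1 (vY o, vA o, vX o, vZ o) - vY o)
  · exact (by fun_prop : Measurable fun o : Trial 𝒰 𝒳 𝒜 𝒵 𝒲 =>
      h.h2 (vA o, vW o, vX o) - h.h1 (vY o, vA o, vX o, vZ o))
  · exact (by fun_prop : Measurable fun o : Trial 𝒰 𝒳 𝒜 𝒵 𝒲 =>
      h.h3 (vY o, vA o, vX o, vA' o) - h.h2 (vA' o, vW o, vX o))
  · exact (by fun_prop : Measurable fun o : Trial 𝒰 𝒳 𝒜 𝒵 𝒲 =>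
      h.g (vX o, vA' o) - h.h3 (vY o, vA o, vX o, vA' o))

lemma pointwiseMeasurable_prodClass {ℋ : Set (Bridge 𝒳 𝒜 𝒵 𝒲)} {Θ : DualClass 𝒳 𝒜 𝒵 𝒲}
    (hℋ : BridgeClassMeas ℋ) (hΘ : Θ.Meas) (k : Fin 4) :
    PointwiseMeasurable (prodClass ℋ Θ k : Set (Trial 𝒰 𝒳 𝒜 𝒵 𝒲 → ℝ)) := by
  obtain ⟨h1, ℋ₀, h2, h3, h4⟩ := hℋ
  obtain ⟨t1, Θ₀, t2, t3, t4⟩ := hΘ.onTrial (𝒰 := 𝒰) k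
  refine ⟨?_, Set.image2 (fun f θ o => f.resid k o * θ o) ℋ₀ Θ₀, ?_, h3.image2 t3 _, ?_⟩
  · rintro _ ⟨f, hf, θ, hθ, rfl⟩
    exact ((h1 f hf).measurable_resid k).mul (t1 θ hθ)
  · rintro _ ⟨f, hf, θ, hθ, rfl⟩
    exact ⟨f, h2 hf, θ, t2 hθ, rfl⟩
  · rintro _ ⟨f, hf, θ, hθ, rfl⟩
    obtain ⟨s, s0, s1, s2, s3, s4⟩ := h4 f hf
    obtain ⟨t, ht0, ht⟩ := t4 θ hθ
    refine ⟨fun n o => (s n).resid k o * t n o, fun n => ⟨s n, s0 n, t n, ht0 n, rfl⟩, fun o => ?_⟩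
    refine Tendsto.mul ?_ (ht o)
    fin_cases k
    exacts [(s1 _).sub tendsto_const_nhds, (s2 _).sub (s1 _), (s3 _).sub (s2 _), (s4 _).sub (s3 _)]

end Classes

/-! ### The adversarial objective compared with the projected residual. -/

section LeastSquares

variable {Ω ι : Type*} [MeasurableSpace Ω]

/-- The conditional expectation is the projection: it has the same inner products. -/
lemma integral_mul_condExp {Ω : Type*} {m m₀ : MeasurableSpace Ω} {P : Measure Ω} (hm : m ≤ m₀)
    [IsFiniteMeasure P] {f r : Ω → ℝ} (hf : StronglyMeasurable[m] f)
    (hfr : Integrable (fun o => f o * r o) P) (hr : Integrable r P) :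
    ∫ o, f o * r o ∂P = ∫ o, f o * (P[r|m]) o ∂P := by
  rw [← integral_condExp hm]
  exact integral_congr_ae (condExp_mul_of_stronglyMeasurable_left hf hfr hr)

lemma abs_integral_mul_le_sqrt {P : Measure Ω} {f g : Ω → ℝ} (hf : MemLp f 2 P) (hg : MemLp g 2 P) :
    |∫ o, f o * g o ∂P| ≤ √(∫ o, f o ^ 2 ∂P) * √(∫ o, g o ^ 2 ∂P) := by
  have h := integral_mul_norm_le_Lp_mul_Lq (μ := P) (f := f) (g := g) Real.HolderConjugate.two_two
    (by simpa using hf) (by simpa using hg)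
  refine (abs_integral_le_integral_abs).trans ?_
  simp only [Real.norm_eq_abs, Real.rpow_two, sq_abs] at h
  simpa only [abs_mul, Real.sqrt_eq_rpow] using h

variable {P : Measure Ω} {D : Finset ι} {x : ι → Ω}
  {Q Θ : Set (Ω → ℝ)} {η B : ℝ} {r τ θ : Ω → ℝ}

/-- Lower and upper bounds of the empirical objective at a test function. -/
lemma abs_objective_le (hη : 0 ≤ η) (hB : 0 ≤ B) (hQ : UniformlyClose P D x Q η)
    (hΘ : UniformlyClose P D x Θ η) (hθ : θ ∈ Θ) (hq : (fun o => r o * θ o) ∈ Q)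
    (hrB : ∀ᵐ o ∂P, |r o| ≤ B) (hθ2 : MemLp θ 2 P)
    (hproj : ∫ o, r o * θ o ∂P = ∫ o, τ o * θ o ∂P) :
    empMean D x (fun o => r o * θ o) - 1 / 2 * empNorm D x θ ^ 2 ≤
        ∫ o, τ o * θ o ∂P + 1 / 2 * η * B * √(∫ o, θ o ^ 2 ∂P) - 1 / 4 * ∫ o, θ o ^ 2 ∂P +
          3 / 4 * η ^ 2 ∧
      ∫ o, τ o * θ o ∂P - 1 / 2 * η * B * √(∫ o, θ o ^ 2 ∂P) - 3 / 4 * ∫ o, θ o ^ 2 ∂P -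
          3 / 4 * η ^ 2 ≤
        empMean D x (fun o => r o * θ o) - 1 / 2 * empNorm D x θ ^ 2 := by
  have h1 := (hQ _ hq).1
  have h2 := (hΘ _ hθ).2
  have hn : empNorm D x θ ^ 2 = empMean D x fun a => θ a ^ 2 :=
    Real.sq_sqrt (div_nonneg (Finset.sum_nonneg fun _ _ => sq_nonneg _) (Nat.cast_nonneg _))
  -- Boundedness of the residual turns the deviation of the product into a term linear in the norm
  -- of `θ`, which the quadratic penalty can absorb.
  have h3 : √(∫ o, (r o * θ o) ^ 2 ∂P) ≤ B * √(∫ o, θ o ^ 2 ∂P) := by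
    have e : B * √(∫ o, θ o ^ 2 ∂P) = √(B ^ 2 * ∫ o, θ o ^ 2 ∂P) := by
      rw [Real.sqrt_mul (sq_nonneg B), Real.sqrt_sq hB]
    rw [e]
    refine Real.sqrt_le_sqrt ?_
    rw [← integral_const_mul]
    refine integral_mono_of_nonneg (ae_of_all _ fun _ => sq_nonneg _)
      (hθ2.integrable_sq.const_mul _) ?_
    filter_upwards [hrB] with o ho
    rw [mul_pow]
    exact mul_le_mul_of_nonneg_right (sq_le_sq' (abs_le.1 ho).1 (abs_le.1 ho).2) (sq_nonneg _)
  have h4 := mul_le_mul_of_nonneg_left h3 hη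
  rw [hproj] at h1
  rw [abs_le] at h1 h2
  rw [hn]
  constructor <;> nlinarith [h1.1, h1.2, h2.1, h2.2, h4]

/-- With `q = ‖θ‖` and `t = ‖τ‖`, the upper bound is at most `(t + η B / 2) q - q² / 4 + 3/4 η²`.
Its maximum over `q` is `(t + η B / 2)² + 3/4 η²`; the constants are relaxed to those of the
confidence threshold. -/
lemma objective_le (hη : 0 ≤ η) (hB : 0 ≤ B) (hQ : UniformlyClose P D x Q η)
    (hΘ : UniformlyClose P D x Θ η) (hθ : θ ∈ Θ) (hq : (fun o => r o * θ o) ∈ Q)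
    (hrB : ∀ᵐ o ∂P, |r o| ≤ B) (hθ2 : MemLp θ 2 P) (hτ2 : MemLp τ 2 P)
    (hproj : ∫ o, r o * θ o ∂P = ∫ o, τ o * θ o ∂P) :
    empMean D x (fun o => r o * θ o) - 1 / 2 * empNorm D x θ ^ 2 ≤
      2 * ∫ o, τ o ^ 2 ∂P + (2 * B ^ 2 + 5 / 4) * η ^ 2 := by
  have h1 := (abs_objective_le hη hB hQ hΘ hθ hq hrB hθ2 hproj).1
  have h2 := (abs_le.1 (abs_integral_mul_le_sqrt hτ2 hθ2)).2
  have hs : √(∫ o, θ o ^ 2 ∂P) ^ 2 = ∫ o, θ o ^ 2 ∂P :=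
    Real.sq_sqrt (integral_nonneg fun _ => sq_nonneg _)
  have ht : √(∫ o, τ o ^ 2 ∂P) ^ 2 = ∫ o, τ o ^ 2 ∂P :=
    Real.sq_sqrt (integral_nonneg fun _ => sq_nonneg _)
  generalize √(∫ o, θ o ^ 2 ∂P) = q at *
  generalize √(∫ o, τ o ^ 2 ∂P) = t at *
  rw [← hs] at h1
  rw [← ht]
  nlinarith [sq_nonneg (q / 2 - (t + 1 / 2 * η * B)), sq_nonneg (t - 1 / 2 * η * B),
    mul_nonneg (sq_nonneg B) (sq_nonneg η), sq_nonneg η, sq_nonneg (η * B)]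

/-- Test with `θ` close to `τ`. Expanding `‖θ - τ‖²` bounds the inner product below, and `⟨τ, θ⟩ -
3/4 ‖θ‖²` is then at least `‖τ‖² / 2 - ‖θ‖² / 4 - ε² / 2`, where `‖θ‖ ≤ ‖τ‖ + ε`. Cross terms are
absorbed by part of the quarter of `‖τ‖²` that is left. -/
lemma le_objective (hη : 0 ≤ η) (hB : 0 ≤ B) (hQ : UniformlyClose P D x Q η)
    (hΘ : UniformlyClose P D x Θ η) (hθ : θ ∈ Θ) (hq : (fun o => r o * θ o) ∈ Q)
    (hrB : ∀ᵐ o ∂P, |r o| ≤ B) (hθ2 : MemLp θ 2 P) (hτ2 : MemLp τ 2 P)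
    (hproj : ∫ o, r o * θ o ∂P = ∫ o, τ o * θ o ∂P) {ε : ℝ} (hε : 0 ≤ ε)
    (happ : ∫ o, (θ o - τ o) ^ 2 ∂P ≤ ε ^ 2) :
    ∫ o, τ o ^ 2 ∂P ≤ 16 * (empMean D x (fun o => r o * θ o) - 1 / 2 * empNorm D x θ ^ 2) +
      21 * ε ^ 2 + (32 * B ^ 2 + 12) * η ^ 2 := by
  have h1 := (abs_objective_le hη hB hQ hΘ hθ hq hrB hθ2 hproj).2
  have h2 := (abs_le.1 (abs_integral_mul_le_sqrt hτ2 hθ2)).2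
  have hs : √(∫ o, θ o ^ 2 ∂P) ^ 2 = ∫ o, θ o ^ 2 ∂P :=
    Real.sq_sqrt (integral_nonneg fun _ => sq_nonneg _)
  have ht : √(∫ o, τ o ^ 2 ∂P) ^ 2 = ∫ o, τ o ^ 2 ∂P :=
    Real.sq_sqrt (integral_nonneg fun _ => sq_nonneg _)
  have h3 : ∫ o, (θ o - τ o) ^ 2 ∂P =
      ∫ o, θ o ^ 2 ∂P - 2 * ∫ o, τ o * θ o ∂P + ∫ o, τ o ^ 2 ∂P := by
    have hi : Integrable (fun o => τ o * θ o) P := hτ2.integrable_mul hθ2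
    have e : ∀ o, (θ o - τ o) ^ 2 = θ o ^ 2 - 2 * (τ o * θ o) + τ o ^ 2 := fun o => by ring
    simp_rw [e]
    have hi2 : Integrable (fun o => 2 * (τ o * θ o)) P := hi.const_mul 2
    have hi3 : Integrable (fun o => θ o ^ 2 - 2 * (τ o * θ o)) P := hθ2.integrable_sq.sub hi2
    rw [integral_add hi3 hτ2.integrable_sq, integral_sub hθ2.integrable_sq hi2, integral_const_mul]
  have hq0 := Real.sqrt_nonneg (∫ o, θ o ^ 2 ∂P)
  have ht0 := Real.sqrt_nonneg (∫ o, τ o ^ 2 ∂P)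
  generalize √(∫ o, θ o ^ 2 ∂P) = q at *
  generalize √(∫ o, τ o ^ 2 ∂P) = t at *
  rw [h3, ← hs, ← ht] at happ
  rw [← hs] at h1
  rw [← ht]
  generalize ∫ o, τ o * θ o ∂P = I at *
  have hqt : q ≤ t + ε := by
    have : (q - t) ^ 2 ≤ ε ^ 2 := by nlinarith
    linarith [(abs_le.1 (abs_le_of_sq_le_sq this hε)).2]
  have hηB : 0 ≤ η * B := mul_nonneg hη hB
  have h5 := mul_le_mul_of_nonneg_left hqt hηB
  have h6 : q ^ 2 ≤ (t + ε) ^ 2 := pow_le_pow_left₀ hq0 hqt 2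
  nlinarith [sq_nonneg (t - 2 * ε), sq_nonneg (t - 4 * (η * B)), sq_nonneg (ε - 4 * (η * B))]

end LeastSquares

lemma eLpNorm_two_eq_ofReal_sqrt {Ω : Type*} [MeasurableSpace Ω] {P : Measure Ω} {f : Ω → ℝ}
    (hf : MemLp f 2 P) : eLpNorm f 2 P = ENNReal.ofReal √(∫ o, f o ^ 2 ∂P) := by
  rw [hf.eLpNorm_eq_integral_rpow_norm two_ne_zero ENNReal.ofNat_ne_top]
  simp [Real.sqrt_eq_rpow]

/-! ### Empirical losses on a good sample. -/

section Sample

variable {𝒰 𝒳 𝒜 𝒵 𝒲 : Type*} [MeasurableSpace 𝒰] [MeasurableSpace 𝒳] [MeasurableSpace 𝒜]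
  [MeasurableSpace 𝒵] [MeasurableSpace 𝒲] {M : PVModel 𝒰 𝒳 𝒜 𝒵 𝒲}
  {ℋ : Set (Bridge 𝒳 𝒜 𝒵 𝒲)} {Θ : DualClass 𝒳 𝒜 𝒵 𝒲} {Pol : Set (Policy 𝒳 𝒜)}
  {LY Lh Lθ Lα εH εΘ : ℝ} {f : Bridge 𝒳 𝒜 𝒵 𝒲} {k : Fin 4} {n : ℕ}
  {d : Fin n → Trial 𝒰 𝒳 𝒜 𝒵 𝒲} {η : Fin 4 → ℝ}

lemma PVModel.Regular.ae_abs_resid_le (hreg : M.Regular ℋ Θ LY Lh Lθ Lα) (hf : f ∈ ℋ) (k : Fin 4) :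
    ∀ᵐ o ∂(M.μ k), |f.resid k o| ≤ Lα := by
  filter_upwards [PVModel.ae_μ_abs_reward_le hreg.reward k] with o ho
  exact hreg.integrand f hf k o ho

lemma PVModel.Regular.nonneg (hreg : M.Regular ℋ Θ LY Lh Lθ Lα) (hf : f ∈ ℋ) : 0 ≤ Lα := by
  obtain ⟨o, ho⟩ := (PVModel.ae_law_abs_reward_le hreg.reward).exists
  exact (abs_nonneg _).trans (hreg.integrand f hf 0 o ho)

lemma PVModel.Regular.memLp_resid (hreg : M.Regular ℋ Θ LY Lh Lθ Lα) (hf : f ∈ ℋ) (hm : f.Meas)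
    (k : Fin 4) : MemLp (f.resid k) 2 (M.μ k) :=
  MemLp.of_bound (hm.measurable_resid k).aestronglyMeasurable Lα (hreg.ae_abs_resid_le hf k)

lemma PVModel.Regular.memLp_T (hreg : M.Regular ℋ Θ LY Lh Lθ Lα) (hf : f ∈ ℋ) (hm : f.Meas)
    (k : Fin 4) : MemLp (M.T k f) 2 (M.μ k) :=
  (hreg.memLp_resid hf hm k).condExp one_le_two

/-- An infimum over an empty class is infinite, which a finite compatibility error excludes. -/
lemma PVModel.Compatible.nonempty_onTrial (hc : M.Compatible ℋ Θ εΘ) (hf : f ∈ ℋ) (k : Fin 4) :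
    (Θ.onTrial k : Set (Trial 𝒰 𝒳 𝒜 𝒵 𝒲 → ℝ)).Nonempty := by
  by_contra h
  have h1 := hc f hf k
  rw [Set.not_nonempty_iff_eq_empty.1 h] at h1
  simp at h1

/-- The empirical moments of all the classes are close to the population ones. -/
def GoodSample (M : PVModel 𝒰 𝒳 𝒜 𝒵 𝒲) (ℋ : Set (Bridge 𝒳 𝒜 𝒵 𝒲)) (Θ : DualClass 𝒳 𝒜 𝒵 𝒲)
    (d : Fin n → Trial 𝒰 𝒳 𝒜 𝒵 𝒲) (η : Fin 4 → ℝ) : Prop :=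
  ∀ k, 0 ≤ η k ∧ UniformlyClose (M.μ k) (sub d k) d (prodClass ℋ Θ k) (η k) ∧
    UniformlyClose (M.μ k) (sub d k) d (Θ.onTrial k) (η k)

lemma PVModel.Regular.memLp_onTrial [IsProbabilityMeasure (M.μ k)]
    (hreg : M.Regular ℋ Θ LY Lh Lθ Lα) (hΘm : Θ.Meas)
    {θ : Trial 𝒰 𝒳 𝒜 𝒵 𝒲 → ℝ} (hθ : θ ∈ Θ.onTrial k) : MemLp θ 2 (M.μ k) :=
  MemLp.of_bound (((hΘm.onTrial k).1 θ hθ).aestronglyMeasurable) Lθ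
    (ae_of_all _ fun o => abs_onTrial_le hreg.test hθ o)

lemma PVModel.Regular.integral_mul_resid [IsProbabilityMeasure (M.μ k)]
    (hreg : M.Regular ℋ Θ LY Lh Lθ Lα) (hf : f ∈ ℋ) (hm : f.Meas)
    {w : Trial 𝒰 𝒳 𝒜 𝒵 𝒲 → ℝ} (hw : StronglyMeasurable[instAlg k] w) (hw2 : MemLp w 2 (M.μ k)) :
    ∫ o, w o * f.resid k o ∂(M.μ k) = ∫ o, w o * M.T k f o ∂(M.μ k) :=
  integral_mul_condExp (PVModel.instAlg_le k) hw (hw2.integrable_mul (hreg.memLp_resid hf hm k))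
    ((hreg.memLp_resid hf hm k).integrable one_le_two)

lemma PVModel.Regular.objective_le [IsProbabilityMeasure (M.μ k)]
    (hreg : M.Regular ℋ Θ LY Lh Lθ Lα) (hΘm : Θ.Meas) (hgood : GoodSample M ℋ Θ d η)
    (hf : f ∈ ℋ) (hm : f.Meas) {θ : Trial 𝒰 𝒳 𝒜 𝒵 𝒲 → ℝ} (hθ : θ ∈ Θ.onTrial k) :
    empMean (sub d k) d (fun o => f.resid k o * θ o) - 1 / 2 * empNorm (sub d k) d θ ^ 2 ≤
      2 * ∫ o, M.T k f o ^ 2 ∂(M.μ k) + (2 * Lα ^ 2 + 5 / 4) * η k ^ 2 := by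
  obtain ⟨h1, h2, h3⟩ := hgood k
  have hθ2 := hreg.memLp_onTrial hΘm hθ
  refine CCB.objective_le h1 (hreg.nonneg hf) h2 h3 hθ ⟨f, hf, θ, hθ, rfl⟩
    (hreg.ae_abs_resid_le hf k) hθ2 (hreg.memLp_T hf hm k) ?_
  have h4 := hreg.integral_mul_resid hf hm (hΘm.stronglyMeasurable_onTrial hθ) hθ2
  simpa only [mul_comm] using h4

/-- Ensures that the `sSup` in `lossK` is a genuine supremum and not the default value `0`. -/
lemma PVModel.Regular.bddAbove_objective [IsProbabilityMeasure (M.μ k)]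
    (hreg : M.Regular ℋ Θ LY Lh Lθ Lα) (hΘm : Θ.Meas) (hgood : GoodSample M ℋ Θ d η)
    (hf : f ∈ ℋ) (hm : f.Meas) :
    BddAbove ((fun θ : Trial 𝒰 𝒳 𝒜 𝒵 𝒲 → ℝ => empMean (sub d k) d (fun o => f.resid k o * θ o) -
      1 / 2 * empNorm (sub d k) d θ ^ 2) '' Θ.onTrial k) :=
  ⟨_, by rintro _ ⟨θ, hθ, rfl⟩; exact hreg.objective_le hΘm hgood hf hm hθ⟩

lemma PVModel.Regular.lossK_le [IsProbabilityMeasure (M.μ k)]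
    (hreg : M.Regular ℋ Θ LY Lh Lθ Lα) (hΘm : Θ.Meas) (hgood : GoodSample M ℋ Θ d η)
    (hc : M.Compatible ℋ Θ εΘ) (hf : f ∈ ℋ) (hm : f.Meas) :
    lossK Θ d k f ≤ 2 * ∫ o, M.T k f o ^ 2 ∂(M.μ k) + (2 * Lα ^ 2 + 5 / 4) * η k ^ 2 := by
  refine csSup_le ((hc.nonempty_onTrial hf k).image _) ?_
  rintro _ ⟨θ, hθ, rfl⟩
  exact hreg.objective_le hΘm hgood hf hm hθ

lemma PVModel.Regular.lossK_nonneg [IsProbabilityMeasure (M.μ k)]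
    (hreg : M.Regular ℋ Θ LY Lh Lθ Lα) (hΘm : Θ.Meas) (hΘs : Θ.StarShaped)
    (hgood : GoodSample M ℋ Θ d η) (hc : M.Compatible ℋ Θ εΘ) (hf : f ∈ ℋ) (hm : f.Meas) :
    0 ≤ lossK Θ d k f := by
  refine le_csSup (hreg.bddAbove_objective hΘm hgood hf hm)
    ⟨0, hΘs.zero_mem_onTrial (hc.nonempty_onTrial hf k), ?_⟩
  simp [empMean, empNorm]

/-- The infimum in compatibility need not be attained, so a level `ε` strictly above `εΘ` is used;
the positive threshold later supplies the slack. -/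
lemma PVModel.Regular.integral_T_sq_le [IsProbabilityMeasure (M.μ k)]
    (hreg : M.Regular ℋ Θ LY Lh Lθ Lα) (hΘm : Θ.Meas) (hgood : GoodSample M ℋ Θ d η)
    (hc : M.Compatible ℋ Θ εΘ) (hf : f ∈ ℋ) (hm : f.Meas) {ε : ℝ} (hε0 : 0 < ε) (hε : εΘ < ε) :
    ∫ o, M.T k f o ^ 2 ∂(M.μ k) ≤ 16 * lossK Θ d k f + 21 * ε ^ 2 +
      (32 * Lα ^ 2 + 12) * η k ^ 2 := by
  have h0 : (⨅ θ ∈ Θ.onTrial k, eLpNorm (fun o => θ o - M.T k f o) 2 (M.μ k)) < ENNReal.ofReal ε :=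
    (hc f hf k).trans_lt ((ENNReal.ofReal_lt_ofReal_iff hε0).2 hε)
  simp only [iInf_lt_iff] at h0
  obtain ⟨θ, hθ, hlt⟩ := h0
  obtain ⟨h1, h2, h3⟩ := hgood k
  have hθ2 := hreg.memLp_onTrial hΘm hθ
  have hT2 := hreg.memLp_T hf hm k
  have happ : ∫ o, (θ o - M.T k f o) ^ 2 ∂(M.μ k) ≤ ε ^ 2 := by
    have hs : MemLp (fun o => θ o - M.T k f o) 2 (M.μ k) := hθ2.sub hT2
    rw [eLpNorm_two_eq_ofReal_sqrt hs, ENNReal.ofReal_lt_ofReal_iff hε0] at hlt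
    exact (Real.sqrt_le_left hε0.le).1 hlt.le
  have h4 := hreg.integral_mul_resid hf hm (hΘm.stronglyMeasurable_onTrial hθ) hθ2
  have h5 := le_objective h1 (hreg.nonneg hf) h2 h3 hθ ⟨f, hf, θ, hθ, rfl⟩
    (hreg.ae_abs_resid_le hf k) hθ2 hT2 (by simpa only [mul_comm] using h4) hε0.le happ
  have h6 : empMean (sub d k) d (fun o => f.resid k o * θ o) - 1 / 2 * empNorm (sub d k) d θ ^ 2 ≤
      lossK Θ d k f := le_csSup (hreg.bddAbove_objective hΘm hgood hf hm) ⟨θ, hθ, rfl⟩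
  linarith

end Sample

/-! ### Confidence sets, pessimism and the regret. -/

section Regret

variable {𝒰 𝒳 𝒜 𝒵 𝒲 : Type*} [MeasurableSpace 𝒰] [MeasurableSpace 𝒳] [MeasurableSpace 𝒜]
  [MeasurableSpace 𝒵] [MeasurableSpace 𝒲] {M : PVModel 𝒰 𝒳 𝒜 𝒵 𝒲}
  {ℋ : Set (Bridge 𝒳 𝒜 𝒵 𝒲)} {Θ : DualClass 𝒳 𝒜 𝒵 𝒲} {Pol : Set (Policy 𝒳 𝒜)}
  {LY Lh Lθ Lα εH εΘ e : ℝ} {f : Bridge 𝒳 𝒜 𝒵 𝒲} {n : ℕ}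
  {d : Fin n → Trial 𝒰 𝒳 𝒜 𝒵 𝒲} {η : Fin 4 → ℝ}

lemma PVModel.Regular.loss_nonneg (hμ : ∀ k, IsProbabilityMeasure (M.μ k))
    (hreg : M.Regular ℋ Θ LY Lh Lθ Lα) (hΘm : Θ.Meas) (hΘs : Θ.StarShaped)
    (hgood : GoodSample M ℋ Θ d η) (hc : M.Compatible ℋ Θ εΘ) (hℋ : BridgeClassMeas ℋ)
    (hf : f ∈ ℋ) : 0 ≤ loss Θ d f :=
  Finset.sum_nonneg fun k _ =>
    have := hμ k
    hreg.lossK_nonneg hΘm hΘs hgood hc hf (hℋ.1 f hf)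

lemma PVModel.Regular.loss_le (hμ : ∀ k, IsProbabilityMeasure (M.μ k))
    (hreg : M.Regular ℋ Θ LY Lh Lθ Lα) (hΘm : Θ.Meas)
    (hgood : GoodSample M ℋ Θ d η) (hc : M.Compatible ℋ Θ εΘ) (hℋ : BridgeClassMeas ℋ)
    (hf : f ∈ ℋ) (hrm : M.rmse f ≤ εH) :
    loss Θ d f ≤ 2 * εH ^ 2 + (2 * Lα ^ 2 + 5 / 4) * ∑ k, η k ^ 2 := by
  have h1 : loss Θ d f ≤ ∑ k, (2 * ∫ o, M.T k f o ^ 2 ∂(M.μ k) + (2 * Lα ^ 2 + 5 / 4) * η k ^ 2) :=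
    Finset.sum_le_sum fun k _ =>
      have := hμ k
      hreg.lossK_le hΘm hgood hc hf (hℋ.1 f hf)
  rw [Finset.sum_add_distrib, ← Finset.mul_sum, ← Finset.mul_sum] at h1
  have h2 : ∑ k, ∫ o, M.T k f o ^ 2 ∂(M.μ k) ≤ εH ^ 2 := by
    have h0 : 0 ≤ M.rmse f := Real.sqrt_nonneg _
    exact (Real.sqrt_le_left (h0.trans hrm)).1 hrm
  linarith

/-- All losses are nonnegative since the zero test function is available, so it is enough that the
loss of `f` itself is below the threshold. -/
lemma PVModel.Regular.mem_confH (hμ : ∀ k, IsProbabilityMeasure (M.μ k))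
    (hreg : M.Regular ℋ Θ LY Lh Lθ Lα) (hΘm : Θ.Meas) (hΘs : Θ.StarShaped)
    (hgood : GoodSample M ℋ Θ d η) (hc : M.Compatible ℋ Θ εΘ) (hℋ : BridgeClassMeas ℋ)
    (hf : f ∈ ℋ) (hrm : M.rmse f ≤ εH)
    (he : 2 * εH ^ 2 + (2 * Lα ^ 2 + 5 / 4) * ∑ k, η k ^ 2 < e) : f ∈ confH ℋ Θ d e := by
  have h1 := hreg.loss_le hμ hΘm hgood hc hℋ hf hrm
  have h2 : 0 ≤ sInf (loss Θ d '' ℋ) := by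
    refine le_csInf ⟨_, f, hf, rfl⟩ ?_
    rintro _ ⟨f', hf', rfl⟩
    exact hreg.loss_nonneg hμ hΘm hΘs hgood hc hℋ hf'
  exact ⟨hf, by linarith⟩

/-- A member of the confidence set has loss at most `2 e`, and by nonnegativity so has each of its
four summands. The constant adds up `16 · 2`, `21` and `12 + 32 Lα²` from `integral_T_sq_le`; being
at least one, it bounds its own square root. -/
lemma PVModel.Regular.sqrt_integral_T_sq_le (hμ : ∀ k, IsProbabilityMeasure (M.μ k))
    (hreg : M.Regular ℋ Θ LY Lh Lθ Lα) (hΘm : Θ.Meas) (hΘs : Θ.StarShaped)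
    (hgood : GoodSample M ℋ Θ d η) (hc : M.Compatible ℋ Θ εΘ) (hℋ : BridgeClassMeas ℋ)
    {f₀ : Bridge 𝒳 𝒜 𝒵 𝒲} (hf₀ : f₀ ∈ ℋ) (hrm : M.rmse f₀ ≤ εH) (hεΘ : 0 ≤ εΘ)
    (he : 2 * εH ^ 2 + (2 * Lα ^ 2 + 5 / 4) * ∑ k, η k ^ 2 < e) (hf : f ∈ confH ℋ Θ d e)
    (k : Fin 4) :
    √(∫ o, M.T k f o ^ 2 ∂(M.μ k)) ≤
      (65 + 32 * Lα ^ 2) * (εΘ + √e + √(∑ k, η k ^ 2)) := by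
  have hμk := hμ k
  have hS : 0 ≤ ∑ k, η k ^ 2 := Finset.sum_nonneg fun _ _ => sq_nonneg _
  have he0 : 0 < e := by
    have : 0 ≤ (2 * Lα ^ 2 + 5 / 4) * ∑ k, η k ^ 2 := by positivity
    nlinarith [sq_nonneg εH]
  obtain ⟨hfℋ, hfl⟩ := hf
  have h1 := hreg.loss_le hμ hΘm hgood hc hℋ hf₀ hrm
  have h2 : sInf (loss Θ d '' ℋ) ≤ loss Θ d f₀ := by
    refine csInf_le ⟨0, ?_⟩ ⟨f₀, hf₀, rfl⟩
    rintro _ ⟨f', hf', rfl⟩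
    exact hreg.loss_nonneg hμ hΘm hΘs hgood hc hℋ hf'
  have h3 : lossK Θ d k f ≤ loss Θ d f :=
    Finset.single_le_sum (f := fun k => lossK Θ d k f) (fun j _ =>
      have := hμ j
      hreg.lossK_nonneg hΘm hΘs hgood hc hfℋ (hℋ.1 f hfℋ)) (Finset.mem_univ k)
  have h4 : η k ^ 2 ≤ ∑ k, η k ^ 2 :=
    Finset.single_le_sum (f := fun k => η k ^ 2) (fun j _ => sq_nonneg _) (Finset.mem_univ k)
  have hse := Real.sqrt_pos.2 he0
  have h5 := hreg.integral_T_sq_le hΘm hgood hc hfℋ (hℋ.1 f hfℋ) (k := k) (ε := εΘ + √e)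
    (by linarith) (by linarith)
  have hse2 := Real.sq_sqrt he0.le
  have hsη2 := Real.sq_sqrt hS
  have hsη := Real.sqrt_nonneg (∑ k, η k ^ 2)
  set s := εΘ + √e + √(∑ k, η k ^ 2) with hs
  have hs0 : 0 ≤ s := by positivity
  have b1 : e ≤ s ^ 2 := by rw [← hse2]; exact pow_le_pow_left₀ hse.le (by linarith) 2
  have b2 : (εΘ + √e) ^ 2 ≤ s ^ 2 := pow_le_pow_left₀ (by linarith) (by linarith) 2
  have b3 : η k ^ 2 ≤ s ^ 2 := by
    refine h4.trans ?_
    rw [← hsη2]; exact pow_le_pow_left₀ hsη (by linarith) 2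
  have b4 : (32 * Lα ^ 2 + 12) * η k ^ 2 ≤ (32 * Lα ^ 2 + 12) * s ^ 2 :=
    mul_le_mul_of_nonneg_left b3 (by positivity)
  have hA : 1 ≤ 65 + 32 * Lα ^ 2 := by nlinarith [sq_nonneg Lα]
  refine Real.sqrt_le_iff.2 ⟨by positivity, ?_⟩
  rw [mul_pow]
  calc ∫ o, M.T k f o ^ 2 ∂(M.μ k) ≤ (65 + 32 * Lα ^ 2) * s ^ 2 := by nlinarith
    _ ≤ (65 + 32 * Lα ^ 2) ^ 2 * s ^ 2 :=
      mul_le_mul_of_nonneg_right (le_self_pow₀ hA two_ne_zero) (sq_nonneg s)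

lemma PVModel.Regular.valueOf_le (hreg : M.Regular ℋ Θ LY Lh Lθ Lα) (hf : f ∈ ℋ) (hm : f.Meas)
    {π : Policy 𝒳 𝒜} {ε : ℝ} (hε : 0 ≤ ε)
    (h : eLpNorm (fun p => f.g p - M.cate p) 2 (M.ptilde ⊗ₘ π.1) ≤ ENNReal.ofReal ε) :
    M.valueOf f.g π ≤ M.value π + ε := by
  have hg : Integrable f.g (M.ptilde ⊗ₘ π.1) :=
    Integrable.of_bound hm.2.2.2.aestronglyMeasurable Lh (ae_of_all _ (hreg.bridge f hf).2.2.2)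
  have hcate := M.integrable_cate hreg.reward (π := π)
  have h2 : MemLp (fun p => f.g p - M.cate p) 2 (M.ptilde ⊗ₘ π.1) :=
    ⟨(hg.sub hcate).aestronglyMeasurable, h.trans_lt ENNReal.ofReal_lt_top⟩
  rw [eLpNorm_two_eq_ofReal_sqrt h2, ENNReal.ofReal_le_ofReal_iff hε] at h
  have h3 := (abs_le.1 (abs_integral_mul_le_sqrt h2 (memLp_const (1 : ℝ)))).2
  simp only [mul_one, one_pow, integral_const, probReal_univ, smul_eq_mul, Real.sqrt_one] at h3
  rw [integral_sub hg hcate] at h3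
  have h4 := PVModel.valueOf_cate hreg.reward (π := π)
  rw [← h4]
  simp only [PVModel.valueOf]
  linarith

/-- Bounds the predicted values below, so that the infimum defining the pessimistic value is
genuine. -/
lemma PVModel.Regular.neg_le_valueOf (hreg : M.Regular ℋ Θ LY Lh Lθ Lα) (hf : f ∈ ℋ)
    (π : Policy 𝒳 𝒜) : -Lh ≤ M.valueOf f.g π := by
  have h := norm_integral_le_of_norm_le_const (μ := M.ptilde ⊗ₘ π.1) (f := f.g) (C := Lh)
    (ae_of_all _ (hreg.bridge f hf).2.2.2)
  rw [probReal_univ, mul_one] at h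
  exact (abs_le.1 h).1

variable [StandardBorelSpace 𝒜] [StandardBorelSpace 𝒲] [Nonempty 𝒜] [Nonempty 𝒲]
  {π : Policy 𝒳 𝒜} {b₁ : 𝒳 × 𝒜 × 𝒵 → ℝ}

/-- `b4` has mean one under the probability measure `μ 3`, hence `L²` norm at least one. This lets
the additive realizability error be absorbed into a multiple of the shift norm. -/
lemma PVModel.RatiosExist.one_le_sum_sqrt (hR : M.RatiosExist π)
    (hw : MemLp (M.weight π b₁ 3) 2 (M.μ 3)) :
    1 ≤ ∑ k, √(∫ o, M.weight π b₁ k o ^ 2 ∂(M.μ k)) := by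
  have := M.isProbabilityMeasure_μ (hR.law_mask_ne_zero 3)
  have h1 := hR.integral_b4_mul (G := fun _ => 1) measurable_const
  have h2 := (abs_le.1 (abs_integral_mul_le_sqrt hw (memLp_const (1 : ℝ)))).2
  simp only [integral_const, probReal_univ, smul_eq_mul, mul_one, one_pow, Real.sqrt_one] at h1 h2
  have h3 : ∫ o, M.weight π b₁ 3 o ∂(M.μ 3) = 1 := h1
  rw [h3] at h2
  exact h2.trans (Finset.single_le_sum
    (f := fun k => √(∫ o, M.weight π b₁ k o ^ 2 ∂(M.μ k))) (fun _ _ => Real.sqrt_nonneg _)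
    (Finset.mem_univ 3))

variable [StandardBorelSpace 𝒰] [StandardBorelSpace 𝒳] [StandardBorelSpace 𝒵]

/-- The prediction error of a bridge vector is controlled by its projected residuals. -/
lemma PVModel.Regular.value_sub_valueOf_le (hreg : M.Regular ℋ Θ LY Lh Lθ Lα)
    (hR : M.RatiosExist π) (hI : M.PVIndep) (hb : M.IsShift π b₁)
    (hw : ∀ k, MemLp (M.weight π b₁ k) 2 (M.μ k)) (hf : f ∈ ℋ) (hm : f.Meas) {K : ℝ}
    (hK : ∀ k, √(∫ o, M.T k f o ^ 2 ∂(M.μ k)) ≤ K) :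
    M.value π - M.valueOf f.g π ≤ (∑ k, √(∫ o, M.weight π b₁ k o ^ 2 ∂(M.μ k))) * K := by
  have h1 := hR.sum_integral_weight_mul_resid hI hb hreg.reward hm (hreg.bridge f hf)
  have h2 : ∀ k, |∫ o, M.weight π b₁ k o * f.resid k o ∂(M.μ k)| ≤
      √(∫ o, M.weight π b₁ k o ^ 2 ∂(M.μ k)) * K := fun k => by
    have := M.isProbabilityMeasure_μ (hR.law_mask_ne_zero k)
    rw [hreg.integral_mul_resid hf hm (PVModel.stronglyMeasurable_weight hb.1 k) (hw k)]
    exact (abs_integral_mul_le_sqrt (hw k) (hreg.memLp_T hf hm k)).trans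
      (mul_le_mul_of_nonneg_left (hK k) (Real.sqrt_nonneg _))
  rw [Finset.sum_mul]
  calc M.value π - M.valueOf f.g π = -∑ k, ∫ o, M.weight π b₁ k o * f.resid k o ∂(M.μ k) := by
        rw [h1]; ring
    _ ≤ |∑ k, ∫ o, M.weight π b₁ k o * f.resid k o ∂(M.μ k)| := neg_le_abs _
    _ ≤ ∑ k, |∫ o, M.weight π b₁ k o * f.resid k o ∂(M.μ k)| := Finset.abs_sum_le_sum_abs _ _
    _ ≤ _ := Finset.sum_le_sum fun k _ => h2 k

/-- The regret bound on the event that the empirical moments are close to the population ones. -/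
theorem PVModel.Regular.ofReal_subopt_le (hreg : M.Regular ℋ Θ LY Lh Lθ Lα)
    (hR : M.RatiosExist π) (hI : M.PVIndep) (hb : M.IsShift π b₁)
    (hΘm : Θ.Meas) (hΘs : Θ.StarShaped) (hgood : GoodSample M ℋ Θ d η) (hc : M.Compatible ℋ Θ εΘ)
    (hℋ : BridgeClassMeas ℋ) (hεH : 0 ≤ εH) (hεΘ : 0 ≤ εΘ) (hreal : M.Realizable ℋ Pol εH)
    (hπ : π ∈ Pol) (he : 2 * εH ^ 2 + (2 * Lα ^ 2 + 5 / 4) * ∑ k, η k ^ 2 < e)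
    {πhat : Policy 𝒳 𝒜} (hcap : IsCAP M ℋ Θ Pol d e πhat) :
    ENNReal.ofReal (M.value π - M.value πhat) ≤ M.shiftNorm π b₁ *
      ENNReal.ofReal ((66 + 32 * Lα ^ 2) * (εΘ + εH + √e + √(∑ k, η k ^ 2))) := by
  obtain ⟨f₀, hf₀, hrm, hg₀⟩ := hreal
  have hμ : ∀ k, IsProbabilityMeasure (M.μ k) := fun k =>
    M.isProbabilityMeasure_μ (hR.law_mask_ne_zero k)
  have hS : 0 ≤ ∑ k, η k ^ 2 := Finset.sum_nonneg fun _ _ => sq_nonneg _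
  have he0 : 0 < e := by
    have : 0 ≤ (2 * Lα ^ 2 + 5 / 4) * ∑ k, η k ^ 2 := by positivity
    nlinarith [sq_nonneg εH]
  have hse := Real.sqrt_pos.2 he0
  have hsη := Real.sqrt_nonneg (∑ k, η k ^ 2)
  have hpos : 0 < (66 + 32 * Lα ^ 2) * (εΘ + εH + √e + √(∑ k, η k ^ 2)) := by positivity
  -- An infinite norm makes the right side infinite, because `e > 0` keeps the other factor
  -- positive.
  rcases eq_or_ne (M.shiftNorm π b₁) ⊤ with htop | htop
  · rw [htop, ENNReal.top_mul (ENNReal.ofReal_pos.2 hpos).ne']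
    exact le_top
  have hsum := M.shiftNorm_eq_sum (π := π) b₁
  have hw : ∀ k, MemLp (M.weight π b₁ k) 2 (M.μ k) := fun k => by
    refine ⟨((PVModel.stronglyMeasurable_weight hb.1 k).mono
      (PVModel.instAlg_le k)).aestronglyMeasurable, ?_⟩
    rw [hsum] at htop
    exact (ENNReal.sum_lt_top.1 htop.lt_top) k (Finset.mem_univ k)
  set N := ∑ k, √(∫ o, M.weight π b₁ k o ^ 2 ∂(M.μ k)) with hN
  have hN1 : 1 ≤ N := hR.one_le_sum_sqrt (hw 3)
  have hshift : M.shiftNorm π b₁ = ENNReal.ofReal N := by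
    rw [hsum, hN, ENNReal.ofReal_sum_of_nonneg fun _ _ => Real.sqrt_nonneg _]
    exact Finset.sum_congr rfl fun k _ => eLpNorm_two_eq_ofReal_sqrt (hw k)
  rw [hshift, ← ENNReal.ofReal_mul (by linarith)]
  refine ENNReal.ofReal_le_ofReal ?_
  have hmem := hreg.mem_confH hμ hΘm hΘs hgood hc hℋ hf₀ hrm he
  set K := (65 + 32 * Lα ^ 2) * (εΘ + √e + √(∑ k, η k ^ 2)) with hKdef
  -- Pessimism: the weights are needed only at the comparison policy. At `πhat` the pessimistic
  -- value is at most the prediction of `f₀`, which realizability compares with the true value.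
  have a1 : M.value π - N * K ≤ pessValue M ℋ Θ d e π := by
    refine le_csInf ⟨_, _, ⟨f₀, hmem, rfl⟩, rfl⟩ ?_
    rintro _ ⟨_, ⟨f, hf, rfl⟩, rfl⟩
    have := hreg.value_sub_valueOf_le hR hI hb hw hf.1 (hℋ.1 f hf.1) fun k =>
      hreg.sqrt_integral_T_sq_le hμ hΘm hΘs hgood hc hℋ hf₀ hrm hεΘ he hf k
    linarith
  have a2 := hcap.2 π hπ
  have a3 : pessValue M ℋ Θ d e πhat ≤ M.valueOf f₀.g πhat := by
    refine csInf_le ⟨-Lh, ?_⟩ ⟨_, ⟨f₀, hmem, rfl⟩, rfl⟩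
    rintro _ ⟨_, ⟨f, hf, rfl⟩, rfl⟩
    exact hreg.neg_le_valueOf hf.1 πhat
  have a4 := hreg.valueOf_le hf₀ (hℋ.1 f₀ hf₀) hεH (hg₀ πhat hcap.1)
  have hL : 0 ≤ Lα ^ 2 := sq_nonneg _
  have a5 : K + εH ≤ (66 + 32 * Lα ^ 2) * (εΘ + εH + √e + √(∑ k, η k ^ 2)) := by
    rw [hKdef]
    nlinarith [mul_nonneg hL hεH]
  have a6 : εH ≤ N * εH := le_mul_of_one_le_left hεH hN1
  calc M.value π - M.value πhat ≤ N * (K + εH) := by linarith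
    _ ≤ _ := mul_le_mul_of_nonneg_left a5 (by linarith)

end Regret

/-! ### The good event and the conclusion. -/

variable {𝒰 𝒳 𝒜 𝒵 𝒲 : Type*} [MeasurableSpace 𝒰] [MeasurableSpace 𝒳] [MeasurableSpace 𝒜]
  [MeasurableSpace 𝒵] [MeasurableSpace 𝒲] {M : PVModel 𝒰 𝒳 𝒜 𝒵 𝒲}
  {ℋ : Set (Bridge 𝒳 𝒜 𝒵 𝒲)} {Θ : DualClass 𝒳 𝒜 𝒵 𝒲} {LY Lh Lθ Lα : ℝ}

lemma BoundsCriticalRadius.nonneg {ι α : Type*} [Fintype ι] [DecidableEq ι] {c₀ c₁ ξ c η : ℝ}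
    {D : Finset ι} {x : ι → α} {F : Set (α → ℝ)} (hc₀ : 0 ≤ c₀) (hc : 0 ≤ c)
    (h : BoundsCriticalRadius c₀ c₁ ξ D x F c η) : 0 ≤ η := by
  obtain ⟨-, r, ⟨hr, -⟩, h2⟩ := h
  refine le_trans ?_ h2
  have := Real.sqrt_nonneg (Real.log (c₁ / ξ) / (D.card : ℝ))
  positivity

/-- With high probability, the empirical moments of all the classes are close to the population
ones at every scale that bounds the critical radii. -/
lemma PVModel.Regular.exists_goodSample (hreg : M.Regular ℋ Θ LY Lh Lθ Lα)
    (hℋ : BridgeClassMeas ℋ) (hΘm : Θ.Meas) (hΘs : Θ.StarShaped) {ξ : ℝ} (hξ0 : 0 < ξ)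
    (hξ1 : ξ < 1) (n : ℕ) :
    ∃ E : Set (Fin n → Trial 𝒰 𝒳 𝒜 𝒵 𝒲), MeasurableSet E ∧
      ENNReal.ofReal (1 - 8 * ξ) ≤ M.sampleLaw n E ∧
      ∀ d ∈ E, ∀ η : Fin 4 → ℝ, BoundsRadii 672 10 ξ Lθ Lα ℋ Θ d η → GoodSample M ℋ Θ d η := by
  -- The products are bounded only where the reward is, a set of full measure.
  have hG : MeasurableSet {o : Trial 𝒰 𝒳 𝒜 𝒵 𝒲 | |vY o| ≤ LY} :=
    measurableSet_le (by unfold vY; fun_prop) measurable_const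
  have hGP : ∀ᵐ o ∂M.law, o ∈ {o : Trial 𝒰 𝒳 𝒜 𝒵 𝒲 | |vY o| ≤ LY} :=
    PVModel.ae_law_abs_reward_le hreg.reward
  let bad : Set (Trial 𝒰 𝒳 𝒜 𝒵 𝒲 → ℝ) → ℝ → Fin 4 → Set (Fin n → Trial 𝒰 𝒳 𝒜 𝒵 𝒲) :=
    fun F c k => {d | ∃ η, BoundsCriticalRadius 672 10 ξ (sub d k) d F c η ∧
      ¬ UniformlyClose (M.μ k) (sub d k) d F η}
  have hbad : ∀ (F : Set (Trial 𝒰 𝒳 𝒜 𝒵 𝒲 → ℝ)) (c : ℝ) (k : Fin 4), StarConvex ℝ 0 F →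
      PointwiseMeasurable F → 1 ≤ c →
      (∀ g ∈ F, ∀ o ∈ {o : Trial 𝒰 𝒳 𝒜 𝒵 𝒲 | |vY o| ≤ LY}, |g o| ≤ c) →
      M.sampleLaw n (bad F c k) ≤ ENNReal.ofReal ξ := fun F c k h1 h2 h3 h4 =>
    measure_pi_subsample_not_uniformlyClose_le M.law (measurableSet_mask k) hG hGP h1 h2 h3 h4
      hξ0 hξ1
  let B : Fin 4 → Set (Fin n → Trial 𝒰 𝒳 𝒜 𝒵 𝒲) := fun k =>
    bad (prodClass ℋ Θ k) (max 1 (Lα * Lθ)) k ∪ bad (Θ.onTrial k) (max 1 Lθ) k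
  have hB : ∀ k, M.sampleLaw n (B k) ≤ ENNReal.ofReal (2 * ξ) := fun k => by
    rw [two_mul, ENNReal.ofReal_add hξ0.le hξ0.le]
    refine (measure_union_le _ _).trans (add_le_add ?_ ?_)
    · refine hbad _ _ k (starConvex_prodClass hΘs ℋ k) (pointwiseMeasurable_prodClass hℋ hΘm k)
        (le_max_left _ _) ?_
      rintro _ ⟨f, hf, θ, hθ, rfl⟩ o ho
      refine le_trans ?_ (le_max_right _ _)
      rw [abs_mul]
      exact mul_le_mul (hreg.integrand f hf k o ho) (abs_onTrial_le hreg.test hθ o) (abs_nonneg _)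
        (hreg.nonneg hf)
    · exact hbad _ _ k (hΘs.onTrial k) (hΘm.onTrial k) (le_max_left _ _) fun θ hθ o _ =>
        (abs_onTrial_le hreg.test hθ o).trans (le_max_right _ _)
  -- Two classes for each of four equations, at `ξ` apiece.
  have hU : M.sampleLaw n (⋃ k, B k) ≤ ENNReal.ofReal (8 * ξ) := by
    refine (measure_iUnion_fintype_le _ _).trans ((Finset.sum_le_sum fun k _ => hB k).trans ?_)
    rw [Finset.sum_const, Finset.card_univ, Fintype.card_fin, nsmul_eq_mul,
      ← ENNReal.ofReal_natCast, ← ENNReal.ofReal_mul (by positivity)]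
    exact ENNReal.ofReal_le_ofReal (by push_cast; linarith)
  have : IsProbabilityMeasure (M.sampleLaw n) := by unfold PVModel.sampleLaw; infer_instance
  refine ⟨(toMeasurable (M.sampleLaw n) (⋃ k, B k))ᶜ, (measurableSet_toMeasurable _ _).compl, ?_, ?_⟩
  · rw [prob_compl_eq_one_sub (measurableSet_toMeasurable _ _), measure_toMeasurable,
      ENNReal.ofReal_sub _ (by positivity), ENNReal.ofReal_one]
    exact tsub_le_tsub_left hU 1
  · intro d hd η hη k
    have hdk : d ∉ B k := fun h => hd (subset_toMeasurable _ _ (Set.mem_iUnion.2 ⟨k, h⟩))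
    refine ⟨(hη k).2.nonneg (by norm_num) (zero_le_one.trans (le_max_left _ _)), ?_, ?_⟩
    · by_contra h
      exact hdk (Or.inl ⟨η k, (hη k).1, h⟩)
    · by_contra h
      exact hdk (Or.inr ⟨η k, (hη k).2, h⟩)

end CCB

end

theorem mainTheorem2 :
    ∃ c₀ c₁ : ℝ, 0 < c₀ ∧ 1 ≤ c₁ ∧ ∀ Lα : ℝ, ∃ C : ℝ, 0 < C ∧
      ∀ (𝒰 𝒳 𝒜 𝒵 𝒲 : Type*)
        [MeasurableSpace 𝒰] [MeasurableSpace 𝒳] [MeasurableSpace 𝒜] [MeasurableSpace 𝒵]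
        [MeasurableSpace 𝒲] [StandardBorelSpace 𝒰] [StandardBorelSpace 𝒳] [StandardBorelSpace 𝒜]
        [StandardBorelSpace 𝒵] [StandardBorelSpace 𝒲] [Nonempty 𝒜] [Nonempty 𝒲]
        (M : CCB.PVModel 𝒰 𝒳 𝒜 𝒵 𝒲) (ℋ : Set (CCB.Bridge 𝒳 𝒜 𝒵 𝒲)) (Θ : CCB.DualClass 𝒳 𝒜 𝒵 𝒲)
        (Pol : Set (CCB.Policy 𝒳 𝒜)) (πstar : CCB.Policy 𝒳 𝒜) (b₁ : 𝒳 × 𝒜 × 𝒵 → ℝ)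
        (LY Lh Lθ εH εΘ ξ : ℝ) (T : ℕ),
        M.PVComplete → M.PVIndep → M.BridgeExists →
        CCB.BridgeClassMeas ℋ → Θ.Meas → Θ.StarShaped →
        0 ≤ εH → 0 ≤ εΘ →
        M.Realizable ℋ Pol εH → M.Compatible ℋ Θ εΘ → M.Regular ℋ Θ LY Lh Lθ Lα →
        M.IsOptimal Pol πstar →
        M.RatiosExist πstar → M.IsShift πstar b₁ →
        0 < ξ → ξ < 1 →
        ∃ E : Set (Fin T → CCB.Trial 𝒰 𝒳 𝒜 𝒵 𝒲), MeasurableSet E ∧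
          ENNReal.ofReal (1 - 8 * ξ) ≤ M.sampleLaw T E ∧
          ∀ d ∈ E, ∀ η : Fin 4 → ℝ, CCB.BoundsRadii c₀ c₁ ξ Lθ Lα ℋ Θ d η →
            ∀ e : ℝ, 2 * εH ^ 2 + (2 * Lα ^ 2 + 5 / 4) * ∑ k, η k ^ 2 < e →
              ∀ πhat : CCB.Policy 𝒳 𝒜, CCB.IsCAP M ℋ Θ Pol d e πhat →
                ENNReal.ofReal (M.value πstar - M.value πhat) ≤
                  M.shiftNorm πstar b₁ *
                    ENNReal.ofReal
                      (C * (εΘ + εH + Real.sqrt e + Real.sqrt (∑ k, η k ^ 2))) := by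
  -- `672 = 4 · 168` comes from the comparison of a critical radius with the grid, and `10` from the
  -- failure probability `5 exp (-L)` doubled by Markov's inequality.
  refine ⟨672, 10, by norm_num, by norm_num, fun Lα => ⟨66 + 32 * Lα ^ 2, by positivity, ?_⟩⟩
  intro 𝒰 𝒳 𝒜 𝒵 𝒲 _ _ _ _ _ _ _ _ _ _ _ _ M ℋ Θ Pol πstar b₁ LY Lh Lθ εH εΘ ξ T
    _ hI _ hℋ hΘm hΘs hεH hεΘ hreal hc hreg hopt hR hb hξ0 hξ1
  obtain ⟨E, hE, hprob, hgood⟩ := hreg.exists_goodSample hℋ hΘm hΘs hξ0 hξ1 T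
  refine ⟨E, hE, hprob, fun d hd η hη e he πhat hcap => ?_⟩
  exact hreg.ofReal_subopt_le hR hI hb hΘm hΘs (hgood d hd η hη) hc hℋ hεH hεΘ hreal hopt.1 he hcap
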